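/- Let $k\ge 3$ and let $L_i(n)=A_in+B_i$ ($1\le i\le k$) be pairwise distinct linear forms with $A_i\in\{1,2,\dots\}$, $B_i\in\mathbf Z$. Put $\mathcal P(n)=\prod_{i=1}^kL_i(n)$ and assume that $(L_1,\dots,L_k)$ is admissible, that is, for every prime $p$ fewer than $p$ of the integers $1\le n\le p$ satisfy $\mathcal P(n)\equiv 0 \pmod p$. Let $\vartheta>0$. For real $N>16$ put $$D_0=\log\log\log N,\qquad W=\prod_{p<D_0}p,\qquad R=N^{\vartheta},$$ where $p$ runs over primes; only $N$ so large that $D_0>A_iB_j-A_jB_i$ and $D_0>A_i$ for all $i,j$ are considered. Let $\nu_0$ be an integer with $(\mathcal P(\nu_0),W)=1$. Put $$\mathcal R_k=\Big\{t\in[0,1]^k:\sum_{i=1}^kt_i\le 1\Big\},\qquad \mathcal R_k'=\Big\{t\in[0,1]^k:\sum_{i\ne j}t_i\le 1\text{ for each }j=1,\dots,k\Big\}.$$ Let $F:\mathbf R^k\to\mathbf R_{\ge 0}$ be a nonzero function such that one of the following holds: 1. $\vartheta<\frac12-\eta$ for some $\eta>0$, $F$ is supported on $\mathcal R_k$ and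 is differentiable in the interior of $\mathcal R_k$; 2. $\vartheta<\frac{k-1}{2k}-\eta$ for some $\eta>0$, $F$ is supported on $\mathcal R_k'$ and is differentiable in the interior of $\mathcal R_k'$. Assume that $$F_{\max}=\sup_{t\in[0,1]^k}\Big(|F(t)|+\sum_{i=1}^k\Big|\frac{\partial F}{\partial t_i}(t)\Big|\Big)$$ is finite, where a partial derivative is counted as $0$ at a boundary point of the region at which it does not exist. For $r=(r_1,\dots,r_k)\in\{1,2,\dots\}^k$ let $$y_{r_1,\dots,r_k}=F\Big(\frac{\log r_1}{\log R},\dots,\frac{\log r_k}{\log R}\Big)$$ if $\prod_ir_i$ is square-free and coprime to $W$ and $\prod_{i\ne j}r_i<R$ for each $j$, and $y_{r_1,\dots,r_k}=0$ otherwise. For $d\in\{1,2,\dots\}^k$ let $$\lambda_{d_1,\dots,d_k}=\Big(\prod_{i=1}^k\mu(d_i)d_i\Big)\sum_{\substack{r_1,\dots,r_k\\ \forall i\ d_i\mid r_i}}\frac{y_{r_1,\dots,r_k}}{\prod_{i=1}^k\varphi(r_i)},\qquad \Lambda_{\mathrm{Sel}}^2(n)=\Big(\sum_{\substack{d_1,\dots,d_k\\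 \forall i\ d_i\mid L_i(n)}}\lambda_{d_1,\dots,d_k}\Big)^2 .$$ Then $$\sum_{\substack{N<n\le 2N\\ n\equiv\nu_0\bmod W}}\Lambda_{\mathrm{Sel}}^2(n)=\frac{\varphi(W)^kN(\log R)^k}{W^{k+1}}\int_0^1\!\!\cdots\!\int_0^1F(t_1,\dots,t_k)^2\,dt_1\cdots dt_k+O\Big(\frac{F_{\max}^2\,\varphi(W)^kN(\log R)^k}{W^{k+1}D_0}\Big),$$ where the implied constant depends only on $k$, the $A_i$, the $B_i$ and $\vartheta$ (in particular not on $N$, $\nu_0$, $F$ or $\eta$). -/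

import Mathlib

open scoped BigOperators

namespace MultSieve

noncomputable section

/-- The value `L_i(n) = A_i n + B_i` of the `i`-th linear form. -/
def linForm {k : ℕ} (A : Fin k → ℕ) (B : Fin k → ℤ) (i : Fin k) (n : ℤ) : ℤ :=
  (A i : ℤ) * n + B i

/-- `P(n) = ∏ L_i(n)`. -/
def formProd {k : ℕ} (A : Fin k → ℕ) (B : Fin k → ℤ) (n : ℤ) : ℤ :=
  ∏ i, linForm A B i n

/-- `ν_p(H)`, the number of `1 ≤ n ≤ p` with `P(n) ≡ 0 mod p`. -/
def rootCount {k : ℕ} (A : Fin k → ℕ) (B : Fin k → ℤ) (p : ℕ) : ℕ :=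
  ((Finset.Icc 1 p).filter (fun n : ℕ => (p : ℤ) ∣ formProd A B (n : ℤ))).card

/-- The tuple `(A_i n + B_i)_i` is admissible: positive leading coefficients, pairwise distinct
forms, and `ν_p(H) < p` for every prime `p`. -/
structure Admissible {k : ℕ} (A : Fin k → ℕ) (B : Fin k → ℤ) : Prop where
  pos : ∀ i, 0 < A i
  distinct : ∀ i j, i ≠ j → (A i, B i) ≠ (A j, B j)
  rootCount_lt : ∀ p : ℕ, p.Prime → rootCount A B p < p

/-- `D_0 = log log log N`. -/
def D0 (N : ℝ) : ℝ := Real.log (Real.log (Real.log N))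

/-- `W = ∏_{p < D_0} p`, the product being over primes. -/
def bigW (N : ℝ) : ℕ := ∏ p ∈ (Finset.range ⌈D0 N⌉₊).filter Nat.Prime, p

theorem mem_bigW_index {N : ℝ} {p : ℕ} :
    p ∈ (Finset.range ⌈D0 N⌉₊).filter Nat.Prime ↔ (p : ℝ) < D0 N ∧ p.Prime := by
  simp [Nat.lt_ceil]

/-- `R_k`: the points of `[0,1]^k` with `t_1 + ⋯ + t_k ≤ 1`. -/
def region (k : ℕ) : Set (Fin k → ℝ) :=
  {t | (∀ i, 0 ≤ t i ∧ t i ≤ 1) ∧ ∑ i, t i ≤ 1}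

/-- `R'_k`: the points of `[0,1]^k` with `∑_{i ≠ j} t_i ≤ 1` for every `j`. -/
def regionExt (k : ℕ) : Set (Fin k → ℝ) :=
  {t | (∀ i, 0 ≤ t i ∧ t i ≤ 1) ∧ ∀ j, ∑ i ∈ Finset.univ.erase j, t i ≤ 1}

/-- `|F(t)| + ∑ |∂F/∂t_i (t)|`. A partial derivative that does not exist at `t` (which can happen
only on the boundary of the region where `F` lives) counts as `0`. -/
def sizeAt {k : ℕ} (F : (Fin k → ℝ) → ℝ) (t : Fin k → ℝ) : ℝ :=
  |F t| + ∑ i, |lineDeriv ℝ F t (Pi.single i 1)|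

/-- `F_max`, the supremum of `|F| + ∑ |∂F/∂t_i|` over `[0,1]^k`; meaningful when this function is
bounded on the cube. -/
def Fmax {k : ℕ} (F : (Fin k → ℝ) → ℝ) : ℝ :=
  sSup (sizeAt F '' Set.Icc 0 1)

open scoped Classical in
/-- `y_r = F(log r_1 / log R, …, log r_k / log R)` if `r = ∏ r_i` is square-free, coprime to `W` and
`r / r_j < R` for all `j`; and `y_r = 0` otherwise. -/
def weightY {k : ℕ} (F : (Fin k → ℝ) → ℝ) (R : ℝ) (W : ℕ) (r : Fin k → ℕ) : ℝ :=
  if Squarefree (∏ i, r i) ∧ Nat.Coprime (∏ i, r i) W ∧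
      ∀ j, ((∏ i ∈ Finset.univ.erase j, r i : ℕ) : ℝ) < R then
    F (fun i => Real.log (r i) / Real.log R)
  else 0

/-- The tuples of positive integers `r` with all `r_i ≤ R`. For `k ≥ 2` every tuple of positive
integers outside the box has `y_r = 0` and `λ_r = 0` (see `weightY_eq_zero`, `lam_eq_zero` below),
so that sums over the box are the sums over all tuples of positive integers. -/
def box (k : ℕ) (R : ℝ) : Finset (Fin k → ℕ) :=
  Fintype.piFinset (fun _ => Finset.Icc 1 ⌊R⌋₊)

/-- `λ_d = (∏ μ(d_i) d_i) ∑_{r : d_i ∣ r_i} y_r / ∏ φ(r_i)`. -/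
def lam {k : ℕ} (F : (Fin k → ℝ) → ℝ) (R : ℝ) (W : ℕ) (d : Fin k → ℕ) : ℝ :=
  (∏ i, (ArithmeticFunction.moebius (d i) : ℝ) * (d i : ℝ)) *
    ∑ r ∈ (box k R).filter (fun r => ∀ i, d i ∣ r i),
      weightY F R W r / ∏ i, (Nat.totient (r i) : ℝ)

/-- `Λ_Sel²(n) = (∑_{d : d_i ∣ L_i(n)} λ_d)²`. -/
def LambdaSelSq {k : ℕ} (A : Fin k → ℕ) (B : Fin k → ℤ) (F : (Fin k → ℝ) → ℝ) (R : ℝ) (W : ℕ)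
    (n : ℤ) : ℝ :=
  (∑ d ∈ (box k R).filter (fun d => ∀ i, (d i : ℤ) ∣ linForm A B i n), lam F R W d) ^ 2

/-- The sum of `Λ_Sel²(n)` over `N < n ≤ 2N`, `n ≡ ν₀ mod W`, where `R = N^ϑ`. -/
def selSum {k : ℕ} (A : Fin k → ℕ) (B : Fin k → ℤ) (F : (Fin k → ℝ) → ℝ) (θ : ℝ) (N : ℝ)
    (ν₀ : ℤ) : ℝ :=
  ∑ n ∈ (Finset.Ioc ⌊N⌋₊ ⌊2 * N⌋₊).filter (fun n : ℕ => (n : ℤ) ≡ ν₀ [ZMOD (bigW N : ℤ)]),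
    LambdaSelSq A B F (N ^ θ) (bigW N) (n : ℤ)

theorem weightY_eq_zero {k : ℕ} (hk : 2 ≤ k) (F : (Fin k → ℝ) → ℝ) (R : ℝ) (W : ℕ)
    (r : Fin k → ℕ) (hr : ∀ i, 1 ≤ r i) (hbox : r ∉ box k R) : weightY F R W r = 0 := by
  unfold weightY
  rw [if_neg]
  rintro ⟨-, -, h⟩
  apply hbox
  rw [box, Fintype.mem_piFinset]
  intro i
  rw [Finset.mem_Icc]
  refine ⟨hr i, Nat.le_floor ?_⟩
  haveI : Nontrivial (Fin k) := Fin.nontrivial_iff_two_le.mpr hk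
  obtain ⟨j, hj⟩ := exists_ne i
  have h1 : r i ≤ ∏ l ∈ Finset.univ.erase j, r l :=
    Finset.single_le_prod' (f := r) (fun l _ => hr l) (by simp [hj.symm])
  exact le_trans (by exact_mod_cast h1) (h j).le

theorem lam_eq_zero {k : ℕ} (F : (Fin k → ℝ) → ℝ) (R : ℝ) (W : ℕ)
    (d : Fin k → ℕ) (hd : ∀ i, 1 ≤ d i) (hbox : d ∉ box k R) : lam F R W d = 0 := by
  unfold lam
  rw [Finset.filter_false_of_mem, Finset.sum_empty, mul_zero]
  intro r hr h
  apply hbox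
  rw [box, Fintype.mem_piFinset] at hr ⊢
  intro i
  have := Finset.mem_Icc.mp (hr i)
  exact Finset.mem_Icc.mpr ⟨hd i, (Nat.le_of_dvd this.1 (h i)).trans this.2⟩

end

end MultSieve

/-! ### Equidistribution of weighted atoms on the unit interval and the unit cube -/

namespace MultSieve
noncomputable section

open MeasureTheory Set

/-! Substituting the definition of λ and summing over d first turns ∑_{d_i ∣ L_i(n)} λ_d into ∑_r
y_r / ∏ φ(r_i) · ψ_r(n), where ψ_r(n) is the product over i and over primes p ∣ r_i of 1 - p if p ∣
L_i(n) and of 1 otherwise (`sum_lam_eq`). The λ_d therefore never need to be estimated. For p not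
dividing W the forms have distinct roots modulo p, and each local factor has mean zero modulo p. By
the Chinese remainder theorem the mean of ψ_r ψ_s over a class modulo W vanishes unless ∏ r_i and ∏
s_i have the same primes; then a prime contributes p - 1 if it lies in the same component of r and
s, and -1 otherwise (`abs_sum_tupleChar_mul_sub_le`). The error from incomplete periods is at most a
product of local L¹ bounds, which after division by the totients becomes (∑ |y_r| 2^{ω(r)})². On the
support ∏ r_i ≤ N^β with β < 1/2, so Rankin's trick (`sum_suppY_two_pow_le`) saves a power of N,
more than enough to absorb the powers of W and D_0.

The remaining quadratic form is nearly diagonal. The row of r has absolute sum at most ∏ (p - 1 + k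
- 1), against the diagonal entry ∏ (p - 1) (`sum_abs_pairCoeff_le`). All primes involved are at
least D_0, so summation over r leaves an off-diagonal part of relative size O(1/D_0)
(`abs_quadForm_sub_diag_le`, `Rough.twistSum_pow_sub_le`).

The diagonal ∑ y_r² / ∏ φ(r_i) is a Riemann sum. Masses 1/φ(u) at log u / log R, over square-free u
≤ R coprime to W and normalised by V = (φ(W)/W) log R, have distribution function t + O(1/D_0); this
comes from harmonic sums over integers coprime to W (`Rough.abs_totSum_sub_le`,
`Rough.nearUniform`). Since F is only differentiable with bounded partial derivatives inside a
convex region, sum and integral are compared one coordinate at a time, through monotone functions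
and their level sets (`NearUniform.monotoneOn`, `NearUniform.pi`). Tuples with a shared prime or
lying on a boundary hyperplane have relative mass O(1/D_0) (`Rough.abs_diag_sub_le`).
`exists_selSum_bound` combines the estimates; the two cases of the theorem differ only in the region
and in β, which is ϑ or ϑk/(k-1). -/

/-- The atoms `x u` with weights `w u` are distributed on `[0,1]` up to discrepancy `ε`. -/
structure NearUniform {ι : Type*} (S : Finset ι) (w x : ι → ℝ) (ε : ℝ) : Prop where
  nonneg : ∀ u ∈ S, 0 ≤ w u
  mem : ∀ u ∈ S, x u ∈ Icc (0 : ℝ) 1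
  cdf : ∀ t ∈ Icc (0 : ℝ) 1, |∑ u ∈ S with x u ≤ t, w u - t| ≤ ε

/-- `f` vanishes off an interval inside `[0,1]`, on which it is bounded by `M` and
`K`-Lipschitz. -/
def NiceSlice (M K : ℝ) (f : ℝ → ℝ) : Prop :=
  ∃ J : Set ℝ, J.OrdConnected ∧ J ⊆ Icc 0 1 ∧ (∀ s ∉ J, f s = 0) ∧ (∀ s ∈ J, |f s| ≤ M) ∧
    ∀ s ∈ J, ∀ t ∈ J, |f s - f t| ≤ K * |s - t|

variable {ι : Type*} {S : Finset ι} {w x : ι → ℝ} {ε : ℝ}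

theorem NearUniform.eps_nonneg (h : NearUniform S w x ε) : 0 ≤ ε :=
  (abs_nonneg _).trans (h.cdf 0 (by simp))

theorem NearUniform.sum_le (h : NearUniform S w x ε) : ∑ u ∈ S, w u ≤ 1 + ε := by
  have := h.cdf 1 (by simp)
  rw [Finset.filter_true_of_mem (fun u hu => (h.mem u hu).2)] at this
  linarith [(abs_le.mp this).2]

/-- There are finitely many atoms, so for t slightly below a the conditions x ≤ t and x < a select
the same ones; then t tends to a. -/
theorem NearUniform.lt (h : NearUniform S w x ε) {a : ℝ} (ha : a ∈ Icc (0 : ℝ) 1) :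
    |∑ u ∈ S with x u < a, w u - a| ≤ ε := by
  rcases ha.1.eq_or_lt with h0 | h0
  · rw [Finset.filter_false_of_mem (fun u hu => by have := (h.mem u hu).1; linarith)]
    simpa [← h0] using h.eps_nonneg
  obtain ⟨t₀, ht₀, h1, h2⟩ : ∃ t₀, 0 ≤ t₀ ∧ t₀ < a ∧ ∀ u ∈ S, x u < a → x u ≤ t₀ := by
    by_cases hE : (S.filter (fun u => x u < a)).Nonempty
    · obtain ⟨m, hm, hmax⟩ := Finset.exists_max_image _ x hE
      rw [Finset.mem_filter] at hm
      exact ⟨x m, (h.mem m hm.1).1, hm.2, fun u hu hlt => hmax u (by simp [hu, hlt])⟩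
    · rw [Finset.not_nonempty_iff_eq_empty, Finset.filter_eq_empty_iff] at hE
      exact ⟨0, le_rfl, h0, fun u hu hlt => absurd hlt (hE hu)⟩
  refine le_of_forall_pos_le_add fun δ hδ => ?_
  set t := max t₀ (a - δ) with ht
  have hta : t < a := max_lt h1 (by linarith)
  have ht0 : t₀ ≤ t := le_max_left _ _
  have htd : a - δ ≤ t := le_max_right _ _
  have := h.cdf t ⟨ht₀.trans ht0, hta.le.trans ha.2⟩
  have e : S.filter (fun u => x u ≤ t) = S.filter (fun u => x u < a) := by
    refine Finset.filter_congr fun u hu => ⟨fun h => h.trans_lt hta, fun h => (h2 u hu h).trans ht0⟩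
  rw [e] at this
  rw [abs_le] at this ⊢
  constructor <;> linarith [this.1, this.2]

/-- Whatever endpoints J contains, its mass is squeezed between differences of the open and closed
distribution functions at inf J and sup J, and each of the two endpoints costs ε. -/
theorem NearUniform.interval (h : NearUniform S w x ε) {J : Set ℝ} (hJ : J.OrdConnected)
    (hJ1 : J ⊆ Icc 0 1) [DecidablePred (fun u => x u ∈ J)] :
    |∑ u ∈ S with x u ∈ J, w u - volume.real J| ≤ 2 * ε := by
  have hε := h.eps_nonneg
  rcases J.eq_empty_or_nonempty with rfl | hne
  · simpa using hε
  have hbb : BddBelow J := ⟨0, fun y hy => (hJ1 hy).1⟩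
  have hba : BddAbove J := ⟨1, fun y hy => (hJ1 hy).2⟩
  set a := sInf J with ha
  set b := sSup J with hb
  have hsub : J ⊆ Icc a b := fun y hy => ⟨csInf_le hbb hy, le_csSup hba hy⟩
  have hsup : Ioo a b ⊆ J := by
    intro y hy
    obtain ⟨c, hc, hcy⟩ := exists_lt_of_csInf_lt hne hy.1
    obtain ⟨d, hd, hyd⟩ := exists_lt_of_lt_csSup hne hy.2
    exact hJ.out hc hd ⟨hcy.le, hyd.le⟩
  have hab : a ≤ b := csInf_le_csSup hne hbb hba
  have ha0 : 0 ≤ a := le_csInf hne fun y hy => (hJ1 hy).1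
  have hb1 : b ≤ 1 := csSup_le hne fun y hy => (hJ1 hy).2
  have hvol : volume.real J = b - a := by
    refine le_antisymm ?_ ?_
    · have := measureReal_mono (μ := volume) hsub (by simp)
      simpa [Real.volume_real_Icc_of_le hab] using this
    · have := measureReal_mono (μ := volume) hsup
        ((measure_mono hsub).trans_lt (by simp)).ne
      simpa [Real.volume_real_Ioo_of_le hab] using this
  rw [hvol]
  have A := h.cdf b ⟨ha0.trans hab, hb1⟩
  have B := h.lt (a := a) ⟨ha0, hab.trans hb1⟩
  have C := h.lt (a := b) ⟨ha0.trans hab, hb1⟩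
  have D := h.cdf a ⟨ha0, hab.trans hb1⟩
  have u1 : ∑ u ∈ S with x u ∈ J, w u + ∑ u ∈ S with x u < a, w u ≤ ∑ u ∈ S with x u ≤ b, w u := by
    rw [Finset.sum_filter, Finset.sum_filter, Finset.sum_filter, ← Finset.sum_add_distrib]
    refine Finset.sum_le_sum fun u hu => ?_
    have hw := h.nonneg u hu
    by_cases hj : x u ∈ J
    · have := hsub hj
      simp [hj, this.2, not_lt.mpr this.1]
    · by_cases hl : x u < a
      · simp [hj, hl, hl.le.trans hab]
      · simp only [hj, hl, if_false]; split_ifs <;> linarith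
  have u2 : ∑ u ∈ S with x u < b, w u ≤ ∑ u ∈ S with x u ∈ J, w u + ∑ u ∈ S with x u ≤ a, w u := by
    rw [Finset.sum_filter, Finset.sum_filter, Finset.sum_filter, ← Finset.sum_add_distrib]
    refine Finset.sum_le_sum fun u hu => ?_
    have hw := h.nonneg u hu
    by_cases hl : x u < b
    · by_cases hl2 : x u ≤ a
      · simp only [hl, hl2, if_true]; split_ifs <;> linarith
      · have : x u ∈ J := hsup ⟨not_le.mp hl2, hl⟩
        simp [hl, hl2, this]
    · simp only [hl, if_false]; split_ifs <;> linarith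
  rw [abs_le] at *
  constructor <;> linarith [A.1, A.2, B.1, B.2, C.1, C.2, D.1, D.2]

/-- Layer cake: for c > 0 the set {g ≥ c} is an interval inside J, so its mass is off by at most 2ε;
integrating over 0 < c ≤ M gives the bound. -/
theorem NearUniform.monotoneOn (h : NearUniform S w x ε) {J : Set ℝ} (hJ : J.OrdConnected)
    (hJ1 : J ⊆ Icc 0 1) {g : ℝ → ℝ} (hg0 : ∀ s ∉ J, g s = 0) (hg : MonotoneOn g J) {M : ℝ}
    (hM0 : 0 ≤ M) (hM : ∀ s ∈ J, 0 ≤ g s ∧ g s ≤ M) :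
    |∑ u ∈ S, w u * g (x u) - ∫ s, g s ∂(volume.restrict (Icc (0 : ℝ) 1))| ≤ 2 * ε * M := by
  classical
  have hb : ∀ s, 0 ≤ g s ∧ g s ≤ M := fun s => by
    by_cases hs : s ∈ J
    · exact hM s hs
    · simp [hg0 s hs, hM0]
  have hlev : ∀ c > 0, ({s | c ≤ g s}).OrdConnected ∧ {s | c ≤ g s} ⊆ J := by
    intro c hc
    have hsub : {s | c ≤ g s} ⊆ J := by
      intro s hs
      by_contra hn
      simp only [mem_ofPred_eq, hg0 s hn] at hs
      linarith
    refine ⟨⟨fun s hs t ht y hy => ?_⟩, hsub⟩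
    have hyJ := hJ.out (hsub hs) (hsub ht) hy
    exact le_trans (show c ≤ g s from hs) (hg (hsub hs) hyJ hy.1)
  have hmeas : Measurable g := by
    refine measurable_of_Ici fun c => ?_
    rcases le_or_gt c 0 with hc | hc
    · have : g ⁻¹' Ici c = univ := by ext s; simpa using hc.trans (hb s).1
      rw [this]; exact MeasurableSet.univ
    · exact (hlev c hc).1.measurableSet
  have hint : ∀ (μ : Measure ℝ) [IsFiniteMeasure μ], Integrable g μ := fun μ _ =>
    Integrable.of_bound hmeas.aestronglyMeasurable M
      (Filter.Eventually.of_forall fun s => by rw [Real.norm_eq_abs, abs_of_nonneg (hb s).1]; exact (hb s).2)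
  -- The weighted sum is the integral against a finite discrete measure, so the layer-cake formula
  -- applies to it exactly as to Lebesgue measure.
  set ν : Measure ℝ := ∑ u ∈ S, ENNReal.ofReal (w u) • Measure.dirac (x u) with hν
  have : IsFiniteMeasure ν := by
    refine ⟨?_⟩
    rw [hν, Measure.finsetSum_apply]
    simp
  have hνint : ∫ s, g s ∂ν = ∑ u ∈ S, w u * g (x u) := by
    rw [hν, integral_finsetSum_measure]
    · refine Finset.sum_congr rfl fun u hu => ?_
      rw [integral_smul_measure, integral_dirac, ENNReal.toReal_ofReal (h.nonneg u hu), smul_eq_mul]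
    · intro u _
      exact (hint (Measure.dirac (x u))).smul_measure (by simp)
  have hνset : ∀ s : Set ℝ, MeasurableSet s → ν.real s = ∑ u ∈ S with x u ∈ s, w u := by
    intro s hs
    rw [measureReal_def, hν, Measure.finsetSum_apply, ENNReal.toReal_sum, Finset.sum_filter]
    · refine Finset.sum_congr rfl fun u hu => ?_
      by_cases hus : x u ∈ s <;> simp [Measure.dirac_apply' _ hs, hus, h.nonneg u hu]
    · intro u _
      by_cases hus : x u ∈ s <;> simp [Measure.dirac_apply' _ hs, hus]
  rw [← hνint, (hint ν).integral_eq_integral_Ioc_meas_le (M := M) (ae_of_all _ fun s => (hb s).1)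
      (ae_of_all _ fun s => (hb s).2),
    (hint _).integral_eq_integral_Ioc_meas_le (M := M) (ae_of_all _ fun s => (hb s).1)
      (ae_of_all _ fun s => (hb s).2)]
  have hanti : ∀ (μ : Measure ℝ) [IsFiniteMeasure μ],
      Integrable (fun c => μ.real {a | c ≤ g a}) (volume.restrict (Ioc 0 M)) := by
    intro μ _
    refine Integrable.of_bound (Antitone.measurable fun c d hcd => ?_).aestronglyMeasurable
      (μ.real univ) (ae_of_all _ fun c => ?_)
    · exact measureReal_mono fun a (ha : d ≤ g a) => hcd.trans ha
    · rw [Real.norm_eq_abs, abs_of_nonneg measureReal_nonneg]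
      exact measureReal_mono (subset_univ _)
  rw [← integral_sub (hanti _) (hanti _)]
  have hfin : volume (Ioc 0 M) < ⊤ := by simp
  have := norm_setIntegral_le_of_norm_le_const (μ := volume) (s := Ioc 0 M) (C := 2 * ε)
    (f := fun c => ν.real {a | c ≤ g a} - (volume.restrict (Icc (0 : ℝ) 1)).real {a | c ≤ g a})
    hfin (fun c hc => by
      obtain ⟨h1, h2⟩ := hlev c hc.1
      rw [hνset _ h1.measurableSet, measureReal_restrict_apply h1.measurableSet,
        inter_eq_left.mpr (h2.trans hJ1), Real.norm_eq_abs]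
      exact h.interval h1 (h2.trans hJ1))
  simpa [Real.volume_real_Ioc_of_le hM0] using this

/-- A K-Lipschitz function becomes monotone on J after adding K s, and nonnegative after adding M.
Hence f is a difference of two monotone functions bounded by 2M + K and M + K, and 2ε(3M + 2K) is
the total error. -/
theorem NearUniform.niceSlice (h : NearUniform S w x ε) {M K : ℝ} {f : ℝ → ℝ} (hM : 0 ≤ M)
    (hK : 0 ≤ K) (hf : NiceSlice M K f) :
    |∑ u ∈ S, w u * f (x u) - ∫ s, f s ∂(volume.restrict (Icc (0 : ℝ) 1))| ≤
      ε * (6 * M + 4 * K) := by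
  classical
  obtain ⟨J, hJ, hJ1, h0, hb, hl⟩ := hf
  set g₁ : ℝ → ℝ := fun s => if s ∈ J then f s + K * s + M else 0 with hg1
  set g₂ : ℝ → ℝ := fun s => if s ∈ J then K * s + M else 0 with hg2
  have hsub : ∀ s, f s = g₁ s - g₂ s := by
    intro s
    by_cases hs : s ∈ J
    · simp only [hg1, hg2, hs, if_true]; ring
    · simp [hg1, hg2, hs, h0 s hs]
  have m1 : MonotoneOn g₁ J := by
    intro s hs t ht hst
    simp only [hg1, hs, ht, if_true]
    have := (abs_le.mp (hl s hs t ht)).2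
    rw [abs_of_nonpos (by linarith : s - t ≤ 0)] at this
    nlinarith
  have m2 : MonotoneOn g₂ J := by
    intro s hs t ht hst
    simp only [hg2, hs, ht, if_true]
    nlinarith
  have b1 : ∀ s ∈ J, 0 ≤ g₁ s ∧ g₁ s ≤ 2 * M + K := by
    intro s hs
    simp only [hg1, hs, if_true]
    have := abs_le.mp (hb s hs)
    have h01 := hJ1 hs
    constructor <;> nlinarith [h01.1, h01.2, this.1, this.2]
  have b2 : ∀ s ∈ J, 0 ≤ g₂ s ∧ g₂ s ≤ M + K := by
    intro s hs
    simp only [hg2, hs, if_true]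
    have h01 := hJ1 hs
    constructor <;> nlinarith [h01.1, h01.2]
  have z1 : ∀ s ∉ J, g₁ s = 0 := fun s hs => by simp [hg1, hs]
  have z2 : ∀ s ∉ J, g₂ s = 0 := fun s hs => by simp [hg2, hs]
  have e1 := h.monotoneOn hJ hJ1 z1 m1 (by positivity) b1
  have e2 := h.monotoneOn hJ hJ1 z2 m2 (by positivity) b2
  have intg : ∀ g : ℝ → ℝ, (∀ s ∉ J, g s = 0) → MonotoneOn g J → ∀ C, (∀ s ∈ J, 0 ≤ g s ∧ g s ≤ C) →
      Integrable g (volume.restrict (Icc (0 : ℝ) 1)) := by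
    intro g z m C b
    have : g = J.indicator g := by
      ext s; by_cases hs : s ∈ J <;> simp [hs, z]
    rw [this]
    refine IntegrableOn.integrable_indicator ?_ hJ.measurableSet
    have : IsFiniteMeasure (volume.restrict J) :=
      ⟨by rw [Measure.restrict_apply_univ]; exact (measure_mono hJ1).trans_lt (by simp)⟩
    rw [IntegrableOn, Measure.restrict_restrict hJ.measurableSet, inter_eq_left.mpr hJ1]
    refine Integrable.of_bound (aemeasurable_restrict_of_monotoneOn hJ.measurableSet m).aestronglyMeasurable C ?_
    filter_upwards [ae_restrict_mem hJ.measurableSet] with s hs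
    rw [Real.norm_eq_abs, abs_of_nonneg (b s hs).1]; exact (b s hs).2
  have i1 := intg g₁ z1 m1 _ b1
  have i2 := intg g₂ z2 m2 _ b2
  have es : ∑ u ∈ S, w u * f (x u) = ∑ u ∈ S, w u * g₁ (x u) - ∑ u ∈ S, w u * g₂ (x u) := by
    rw [← Finset.sum_sub_distrib]
    exact Finset.sum_congr rfl fun u _ => by rw [hsub]; ring
  have ei : ∫ s, f s ∂(volume.restrict (Icc (0 : ℝ) 1)) =
      ∫ s, g₁ s ∂(volume.restrict (Icc (0 : ℝ) 1)) - ∫ s, g₂ s ∂(volume.restrict (Icc (0 : ℝ) 1)) := by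
    rw [← integral_sub i1 i2]
    exact integral_congr_ae (ae_of_all _ hsub)
  rw [es, ei]
  rw [abs_le] at *
  constructor <;> linarith [e1.1, e1.2, e2.1, e2.2]

theorem sum_piFinset_succ {k : ℕ} (S : Finset ι) (f : (Fin (k + 1) → ι) → ℝ) :
    ∑ u ∈ Fintype.piFinset (fun _ : Fin (k + 1) => S), f u =
      ∑ a ∈ S, ∑ v ∈ Fintype.piFinset (fun _ : Fin k => S), f (Fin.cons a v) := by
  rw [← Finset.sum_product']
  refine Finset.sum_nbij' (fun u => (u 0, Fin.tail u)) (fun p => Fin.cons p.1 p.2) ?_ ?_ ?_ ?_ ?_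
  · intro u hu
    rw [Fintype.mem_piFinset] at hu
    simp only [Finset.mem_product, Fintype.mem_piFinset]
    exact ⟨hu 0, fun i => hu i.succ⟩
  · rintro ⟨a, v⟩ hu
    simp only [Finset.mem_product, Fintype.mem_piFinset] at hu ⊢
    intro i
    refine Fin.cases ?_ (fun j => ?_) i
    · simpa using hu.1
    · simpa using hu.2 j
  · intro u _; simp
  · intro u _; simp
  · intro u _; simp

instance isProbabilityMeasure_restrict_Icc :
    IsProbabilityMeasure (volume.restrict (Icc (0 : ℝ) 1)) := ⟨by simp⟩

/-- Lebesgue measure on the unit cube. -/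
abbrev cubeMeasure (k : ℕ) : Measure (Fin k → ℝ) :=
  Measure.pi fun _ => volume.restrict (Icc (0 : ℝ) 1)

theorem integral_cubeMeasure_succ {k : ℕ} {G : (Fin (k + 1) → ℝ) → ℝ}
    (hG : Integrable G (cubeMeasure (k + 1))) :
    ∫ t, G t ∂(cubeMeasure (k + 1)) =
      ∫ t', ∫ s, G (Fin.cons s t') ∂(volume.restrict (Icc (0 : ℝ) 1)) ∂(cubeMeasure k) := by
  have hp := (measurePreserving_piFinSuccAbove
    (fun _ : Fin (k + 1) => volume.restrict (Icc (0 : ℝ) 1)) 0).symm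
  have hG' := (hp.integrable_comp_emb (MeasurableEquiv.measurableEmbedding _)).mpr hG
  rw [← hp.integral_comp', integral_prod_symm]
  · simp only [MeasurableEquiv.piFinSuccAbove_symm_apply, Fin.insertNthEquiv, Fin.insertNth_zero,
      Fin.zero_succAbove, Equiv.coe_fn_mk, cast_eq]
  · exact hG'

/-- Induction on the dimension. With the first atom fixed, the other coordinates are integrated by
the induction hypothesis; the sum over the first atom is then moved under the integral and compared
slice by slice. -/
theorem NearUniform.pi (h : NearUniform S w x ε) {M K m : ℝ} (hM : 0 ≤ M) (hK : 0 ≤ K)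
    (hm : 1 ≤ m) (hS : ∑ u ∈ S, w u ≤ m) :
    ∀ (k : ℕ) (G : (Fin k → ℝ) → ℝ), Measurable G → (∀ t, |G t| ≤ M) →
      (∀ t i, NiceSlice M K (fun s => G (Function.update t i s))) →
      |∑ u ∈ Fintype.piFinset (fun _ : Fin k => S), (∏ i, w (u i)) * G (fun i => x (u i)) -
          ∫ t, G t ∂(cubeMeasure k)| ≤ k * (ε * (6 * M + 4 * K)) * m ^ k := by
  intro k
  have hε := h.eps_nonneg
  set E := ε * (6 * M + 4 * K) with hE
  have hE0 : 0 ≤ E := by positivity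
  induction k with
  | zero =>
    intro G _ _ _
    rw [show cubeMeasure 0 = Measure.dirac (fun _ => (0 : ℝ)) from Measure.pi_of_empty _ _]
    simp only [Fintype.piFinset_of_isEmpty, integral_dirac]
    simp [Subsingleton.elim _ (fun _ : Fin 0 => (0 : ℝ))]
  | succ k ih =>
    intro G hGm hGb hGs
    have hint : ∀ (n : ℕ) (H : (Fin n → ℝ) → ℝ), Measurable H → (∀ t, |H t| ≤ M) →
        Integrable H (cubeMeasure n) := fun n H h1 h2 =>
      Integrable.of_bound h1.aestronglyMeasurable M (ae_of_all _ h2)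
    have hcons : ∀ a : ℝ, Measurable fun t' : Fin k → ℝ => G (Fin.cons a t') := fun a =>
      hGm.comp (by
        refine measurable_pi_lambda _ fun i => ?_
        refine Fin.cases ?_ (fun j => ?_) i
        · simp
        · simpa using measurable_pi_apply j)
    rw [sum_piFinset_succ, integral_cubeMeasure_succ (hint _ G hGm hGb)]
    have key1 : ∀ a ∈ S,
        |∑ v ∈ Fintype.piFinset (fun _ : Fin k => S), (∏ i, w (v i)) *
            G (Fin.cons (x a) (fun i => x (v i))) -
          ∫ t', G (Fin.cons (x a) t') ∂(cubeMeasure k)| ≤ k * E * m ^ k := by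
      intro a _
      refine ih (fun t' => G (Fin.cons (x a) t')) (hcons _) (fun t => hGb _) fun t i => ?_
      have := hGs (Fin.cons (x a) t) i.succ
      simpa only [Fin.cons_update] using this
    have e1 : ∀ a ∈ S, ∑ v ∈ Fintype.piFinset (fun _ : Fin k => S),
          (∏ i, w ((Fin.cons a v : Fin (k + 1) → ι) i)) *
            G (fun i => x ((Fin.cons a v : Fin (k + 1) → ι) i)) =
        w a * ∑ v ∈ Fintype.piFinset (fun _ : Fin k => S), (∏ i, w (v i)) *
            G (Fin.cons (x a) (fun i => x (v i))) := by
      intro a _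
      rw [Finset.mul_sum]
      refine Finset.sum_congr rfl fun v _ => ?_
      rw [Fin.prod_univ_succ]
      simp only [Fin.cons_zero, Fin.cons_succ]
      rw [mul_assoc]
      congr 3
      ext i
      refine Fin.cases ?_ (fun j => ?_) i <;> simp
    rw [Finset.sum_congr rfl e1]
    have e2 : ∑ a ∈ S, w a * ∫ t', G (Fin.cons (x a) t') ∂(cubeMeasure k) =
        ∫ t', ∑ a ∈ S, w a * G (Fin.cons (x a) t') ∂(cubeMeasure k) := by
      rw [integral_finsetSum]
      · exact Finset.sum_congr rfl fun a _ => (integral_const_mul _ _).symm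
      · exact fun a _ => (hint _ _ (hcons _) (fun t => hGb _)).const_mul _
    have A : |∑ a ∈ S, w a * ∑ v ∈ Fintype.piFinset (fun _ : Fin k => S), (∏ i, w (v i)) *
            G (Fin.cons (x a) (fun i => x (v i))) -
          ∑ a ∈ S, w a * ∫ t', G (Fin.cons (x a) t') ∂(cubeMeasure k)| ≤ m * (k * E * m ^ k) := by
      rw [← Finset.sum_sub_distrib]
      refine (Finset.abs_sum_le_sum_abs _ _).trans ?_
      calc _ ≤ ∑ a ∈ S, w a * (k * E * m ^ k) := Finset.sum_le_sum fun a ha => by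
            rw [← mul_sub, abs_mul, abs_of_nonneg (h.nonneg a ha)]
            exact mul_le_mul_of_nonneg_left (key1 a ha) (h.nonneg a ha)
        _ ≤ _ := by
            rw [← Finset.sum_mul]
            exact mul_le_mul_of_nonneg_right hS (by positivity)
    have hcons2 : Measurable fun p : (Fin k → ℝ) × ℝ => G (Fin.cons p.2 p.1) :=
      hGm.comp (by
        refine measurable_pi_lambda _ fun i => ?_
        refine Fin.cases ?_ (fun j => ?_) i
        · simpa using measurable_snd
        · simpa [Function.comp_def] using (measurable_pi_apply j).comp measurable_fst)
    have B : |∫ t', ∑ a ∈ S, w a * G (Fin.cons (x a) t') ∂(cubeMeasure k) -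
          ∫ t', ∫ s, G (Fin.cons s t') ∂(volume.restrict (Icc (0 : ℝ) 1)) ∂(cubeMeasure k)| ≤ E := by
      have hm2 : StronglyMeasurable fun t' : Fin k → ℝ =>
          ∫ s, G (Fin.cons s t') ∂(volume.restrict (Icc (0 : ℝ) 1)) :=
        StronglyMeasurable.integral_prod_right (f := fun t' s => G (Fin.cons s t'))
          hcons2.stronglyMeasurable
      rw [← integral_sub]
      · have := norm_integral_le_of_norm_le_const (μ := cubeMeasure k) (C := E)
          (f := fun t' => ∑ a ∈ S, w a * G (Fin.cons (x a) t') -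
            ∫ s, G (Fin.cons s t') ∂(volume.restrict (Icc (0 : ℝ) 1)))
          (ae_of_all _ fun t' => by
            have hs := hGs (Fin.cons 0 t') 0
            simp only [Fin.update_cons_zero] at hs
            exact h.niceSlice hM hK hs)
        simpa using this
      · exact integrable_finsetSum _ fun a _ => (hint _ _ (hcons _) (fun t => hGb _)).const_mul _
      · refine Integrable.of_bound hm2.aestronglyMeasurable M (ae_of_all _ fun t' => ?_)
        have := norm_integral_le_of_norm_le_const (μ := volume.restrict (Icc (0 : ℝ) 1)) (C := M)
          (f := fun s => G (Fin.cons s t')) (ae_of_all _ fun s => hGb (Fin.cons s t'))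
        simpa using this
    rw [← e2] at B
    -- The two errors are m · (k E m^k) and E; since m ≥ 1, together they are at most (k + 1) E
    -- m^(k+1).
    have hmk : E ≤ E * m ^ (k + 1) := le_mul_of_one_le_right hE0 (one_le_pow₀ hm)
    refine (abs_sub_le _ _ _).trans ((add_le_add A B).trans ?_)
    push_cast
    rw [pow_succ] at hmk ⊢
    nlinarith

end

end MultSieve

/-! ### Regularity of F² cut off to an open convex set -/

namespace MultSieve
noncomputable section

open MeasureTheory Set

variable {k : ℕ} {F : (Fin k → ℝ) → ℝ}

theorem sizeAt_le_Fmax (hb : BddAbove (sizeAt F '' Icc 0 1)) {t : Fin k → ℝ} (ht : t ∈ Icc 0 1) :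
    sizeAt F t ≤ Fmax F :=
  le_csSup hb (mem_image_of_mem _ ht)

theorem abs_le_Fmax (hb : BddAbove (sizeAt F '' Icc 0 1)) {t : Fin k → ℝ} (ht : t ∈ Icc 0 1) :
    |F t| ≤ Fmax F := by
  refine le_trans ?_ (sizeAt_le_Fmax hb ht)
  rw [sizeAt]
  exact le_add_of_nonneg_right (Finset.sum_nonneg fun _ _ => abs_nonneg _)

theorem abs_lineDeriv_le_Fmax (hb : BddAbove (sizeAt F '' Icc 0 1)) {t : Fin k → ℝ}
    (ht : t ∈ Icc 0 1) (i : Fin k) : |lineDeriv ℝ F t (Pi.single i 1)| ≤ Fmax F := by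
  refine le_trans ?_ (sizeAt_le_Fmax hb ht)
  rw [sizeAt]
  exact (Finset.single_le_sum (f := fun i => |lineDeriv ℝ F t (Pi.single i 1)|)
    (fun _ _ => abs_nonneg _) (Finset.mem_univ i)).trans (le_add_of_nonneg_left (abs_nonneg _))

theorem Fmax_nonneg (hb : BddAbove (sizeAt F '' Icc 0 1)) : 0 ≤ Fmax F :=
  (abs_nonneg _).trans (abs_le_Fmax hb (t := 0) ⟨le_rfl, fun _ => zero_le_one⟩)

theorem abs_indicator_sq_le (hb : BddAbove (sizeAt F '' Icc 0 1)) {U : Set (Fin k → ℝ)}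
    (hU1 : U ⊆ Icc 0 1) (t : Fin k → ℝ) : |U.indicator (fun t => F t ^ 2) t| ≤ Fmax F ^ 2 := by
  by_cases ht : t ∈ U
  · rw [indicator_of_mem ht, abs_pow]
    exact pow_le_pow_left₀ (abs_nonneg _) (abs_le_Fmax hb (hU1 ht)) 2
  · rw [indicator_of_notMem ht]
    simpa using sq_nonneg (Fmax F)

theorem measurable_indicator_sq {U : Set (Fin k → ℝ)} (hUo : IsOpen U)
    (hd : DifferentiableOn ℝ F U) : Measurable (U.indicator fun t => F t ^ 2) := by
  classical
  rw [← Set.piecewise_eq_indicator]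
  exact (hd.continuousOn.pow 2).measurable_piecewise continuousOn_const hUo.measurableSet

/-- A coordinate line meets a convex set in an interval, on which the partial derivative is bounded
by `Fmax F`; the mean value inequality makes F Lipschitz there, and F² = F · F doubles the constant.
The cut-off to an open set avoids the boundary, where F need not be regular. -/
theorem niceSlice_indicator_sq (hb : BddAbove (sizeAt F '' Icc 0 1)) {U : Set (Fin k → ℝ)}
    (hUo : IsOpen U) (hUc : Convex ℝ U) (hU1 : U ⊆ Icc 0 1) (hd : DifferentiableOn ℝ F U)
    (t : Fin k → ℝ) (i : Fin k) :
    NiceSlice (Fmax F ^ 2) (2 * Fmax F ^ 2)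
      (fun s => U.indicator (fun t => F t ^ 2) (Function.update t i s)) := by
  have hF0 := Fmax_nonneg hb
  have haff : ∀ s s', Function.update t i s' = Function.update t i s + (s' - s) • Pi.single i 1 := by
    intro s s'
    ext j
    by_cases hj : j = i
    · subst hj; simp
    · simp [hj]
  have hJc : Convex ℝ {s | Function.update t i s ∈ U} := by
    intro s hs s' hs' a b ha hb' hab
    have : Function.update t i (a • s + b • s') =
        a • Function.update t i s + b • Function.update t i s' := by
      ext j
      by_cases hj : j = i
      · subst hj; simp
      · simp only [Function.update_of_ne hj, Pi.add_apply, Pi.smul_apply, smul_eq_mul]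
        rw [← add_mul, hab, one_mul]
    show _ ∈ U
    rw [this]
    exact hUc hs hs' ha hb' hab
  refine ⟨{s | Function.update t i s ∈ U}, hJc.ordConnected, fun s hs => ?_, fun s hs => ?_,
    fun s _ => abs_indicator_sq_le hb hU1 _, fun s hs s' hs' => ?_⟩
  · have := hU1 hs
    have h1 := this.1 i
    have h2 := this.2 i
    simp only [Function.update_self] at h1 h2
    exact ⟨h1, h2⟩
  · exact indicator_of_notMem (s := U) hs _
  · have hderiv : ∀ y ∈ {s | Function.update t i s ∈ U},
        HasDerivWithinAt (fun s => F (Function.update t i s))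
          (lineDeriv ℝ F (Function.update t i y) (Pi.single i 1))
          {s | Function.update t i s ∈ U} y := by
      intro y hy
      have h1 : DifferentiableAt ℝ F (Function.update t i y) :=
        (hd _ hy).differentiableAt (hUo.mem_nhds hy)
      have h2 := (h1.lineDifferentiableAt (v := Pi.single i 1)).hasLineDerivAt
      rw [HasLineDerivAt] at h2
      have h3 : HasDerivAt (fun s => F (Function.update t i y + (s - y) • Pi.single i 1))
          (lineDeriv ℝ F (Function.update t i y) (Pi.single i 1)) y := by
        refine HasDerivAt.comp_sub_const (f := fun r => F (Function.update t i y + r • Pi.single i 1)) y y ?_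
        simpa using h2
      refine (h3.congr_of_eventuallyEq (Filter.Eventually.of_forall fun s => ?_)).hasDerivWithinAt
      simp only
      rw [haff y s]
    have hlip := hJc.norm_image_sub_le_of_norm_hasDerivWithin_le (C := Fmax F) hderiv
      (fun y hy => abs_lineDeriv_le_Fmax hb (hU1 hy) i) hs' hs
    have a1 := abs_le_Fmax hb (hU1 hs)
    have a2 := abs_le_Fmax hb (hU1 hs')
    simp only [Real.norm_eq_abs] at hlip
    beta_reduce
    rw [indicator_of_mem (s := U) hs, indicator_of_mem (s := U) hs']
    rw [show F (Function.update t i s) ^ 2 - F (Function.update t i s') ^ 2 =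
      (F (Function.update t i s) - F (Function.update t i s')) *
        (F (Function.update t i s) + F (Function.update t i s')) by ring, abs_mul]
    calc _ ≤ (Fmax F * |s - s'|) * (Fmax F + Fmax F) :=
          mul_le_mul hlip ((abs_add_le _ _).trans (add_le_add a1 a2)) (abs_nonneg _) (by positivity)
      _ = _ := by ring

theorem cubeMeasure_eq (k : ℕ) :
    cubeMeasure k = (volume : Measure (Fin k → ℝ)).restrict (Icc 0 1) := by
  rw [cubeMeasure, ← Measure.restrict_pi_pi, volume_pi, ← Set.pi_univ_Icc]
  rfl

/-- The 14 is 6 + 4 · 2, from M = `Fmax F`² and K = 2M in `NearUniform.pi`; the cut-off does not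
change the integral because F is carried by U up to a null set. -/
theorem NearUniform.sum_indicator_sq {ι : Type*} {S : Finset ι} {w x : ι → ℝ} {ε m : ℝ}
    (h : NearUniform S w x ε) (hm : 1 ≤ m) (hS : ∑ u ∈ S, w u ≤ m)
    (hb : BddAbove (sizeAt F '' Icc 0 1)) {U : Set (Fin k → ℝ)}
    (hUo : IsOpen U) (hUc : Convex ℝ U) (hU1 : U ⊆ Icc 0 1) (hd : DifferentiableOn ℝ F U)
    (hnull : volume (Function.support F \ U) = 0) :
    |∑ u ∈ Fintype.piFinset (fun _ : Fin k => S), (∏ i, w (u i)) *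
        U.indicator (fun t => F t ^ 2) (fun i => x (u i)) - ∫ t in Icc 0 1, F t ^ 2| ≤
      k * (ε * (14 * Fmax F ^ 2)) * m ^ k := by
  have hF0 := Fmax_nonneg hb
  have := h.pi (sq_nonneg (Fmax F)) (by positivity) hm hS k _ (measurable_indicator_sq hUo hd)
    (abs_indicator_sq_le hb hU1) (niceSlice_indicator_sq hb hUo hUc hU1 hd)
  rw [cubeMeasure_eq, integral_congr_ae (g := fun t => F t ^ 2)] at this
  · refine this.trans (le_of_eq ?_); ring
  · have h0 : ∀ᵐ t ∂(volume.restrict (Icc (0 : Fin k → ℝ) 1)), t ∉ Function.support F \ U :=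
      ae_restrict_of_ae (measure_eq_zero_iff_ae_notMem.mp hnull)
    filter_upwards [h0] with t ht
    by_cases htU : t ∈ U
    · rw [indicator_of_mem htU]
    · rw [indicator_of_notMem htU]
      have : F t = 0 := by
        by_contra hne
        exact ht ⟨hne, htU⟩
      simp [this]

end

end MultSieve

/-! ### Multiplicative sums over square-free integers coprime to W -/

namespace MultSieve
noncomputable section

open Finset

/-- Square-free integers in `[1, x]` coprime to `W`. -/
def sfc (W : ℕ) (x : ℝ) : Finset ℕ :=
  (Icc 1 ⌊x⌋₊).filter fun u => Squarefree u ∧ u.Coprime W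

/-- Primes in `[1, x]` not dividing `W`. -/
def primesOff (W : ℕ) (x : ℝ) : Finset ℕ :=
  (Icc 1 ⌊x⌋₊).filter fun p => p.Prime ∧ ¬ p ∣ W

/-- `∏_{p ∣ u} b(p)`. -/
def wt (b : ℕ → ℝ) (u : ℕ) : ℝ := ∏ p ∈ u.primeFactors, b p

/-- All primes not dividing `W` are at least `z`. -/
structure Rough (W : ℕ) (z : ℝ) : Prop where
  ne_zero : W ≠ 0
  one_lt : 1 < z
  le_prime : ∀ p : ℕ, p.Prime → ¬ p ∣ W → z ≤ p

variable {W : ℕ} {x z : ℝ}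

theorem mem_sfc {u : ℕ} : u ∈ sfc W x ↔ (1 ≤ u ∧ u ≤ ⌊x⌋₊) ∧ Squarefree u ∧ u.Coprime W := by
  simp [sfc]

theorem mem_primesOff {p : ℕ} :
    p ∈ primesOff W x ↔ (1 ≤ p ∧ p ≤ ⌊x⌋₊) ∧ p.Prime ∧ ¬ p ∣ W := by
  simp [primesOff]

theorem primeFactors_subset_primesOff {u : ℕ} (h1 : u ≤ ⌊x⌋₊) (hc : u.Coprime W) :
    u.primeFactors ⊆ primesOff W x := by
  intro p hp
  rw [Nat.mem_primeFactors] at hp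
  rw [mem_primesOff]
  refine ⟨⟨hp.1.one_le, (Nat.le_of_dvd (Nat.pos_of_ne_zero hp.2.2) hp.2.1).trans h1⟩, hp.1, ?_⟩
  intro hd
  exact Nat.not_coprime_of_dvd_of_dvd hp.1.one_lt hp.2.1 hd hc

/-- Telescoping with 1/n² ≤ 2(1/n - 1/(n+1)) from n = ⌈z⌉ - 1; primality plays no role. -/
theorem sum_inv_sq_le (hz : 1 < z) (P : Finset ℕ) (hP : ∀ p ∈ P, 2 ≤ p ∧ z ≤ p) :
    ∑ p ∈ P, 1 / ((p : ℝ) - 1) ^ 2 ≤ 4 / z := by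
  obtain ⟨B, hB⟩ : ∃ B, ∀ p ∈ P, p ≤ B := ⟨P.sup id, fun p hp => Finset.le_sup (f := id) hp⟩
  set n₀ := ⌈z⌉₊ with hn₀
  have hn2 : 2 ≤ n₀ := Nat.lt_ceil.mpr (by simpa using hz)
  have hzn : z ≤ n₀ := Nat.le_ceil z
  have hzn' : (n₀ : ℝ) < z + 1 := Nat.ceil_lt_add_one (by linarith)
  have key : ∀ n : ℕ, n₀ - 1 ≤ n →
      ∑ p ∈ Ioc (n₀ - 1) n, 1 / ((p : ℝ) - 1) ^ 2 ≤ 2 * (1 / ((n₀ : ℝ) - 1) - 1 / n) := by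
    intro n hn
    induction n, hn using Nat.le_induction with
    | base =>
      rw [Nat.cast_sub (by omega)]; simp
    | succ n hn ih =>
      rw [Finset.sum_Ioc_succ_top (by omega)]
      have hn1 : (1 : ℝ) ≤ n := by exact_mod_cast (by omega : 1 ≤ n)
      have : 1 / (((n + 1 : ℕ) : ℝ) - 1) ^ 2 ≤ 2 * (1 / (n : ℝ) - 1 / ((n + 1 : ℕ) : ℝ)) := by
        push_cast
        rw [add_sub_cancel_right, div_sub_div _ _ (by positivity) (by positivity), mul_div_assoc',
          div_le_div_iff₀ (by positivity) (by positivity)]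
        nlinarith
      linarith
  have hsub : P ⊆ Ioc (n₀ - 1) (max B (n₀ - 1)) := by
    intro p hp
    rw [Finset.mem_Ioc]
    have h1 : n₀ ≤ p := Nat.ceil_le.mpr (hP p hp).2
    exact ⟨by omega, (hB p hp).trans (le_max_left _ _)⟩
  calc _ ≤ ∑ p ∈ Ioc (n₀ - 1) (max B (n₀ - 1)), 1 / ((p : ℝ) - 1) ^ 2 :=
        Finset.sum_le_sum_of_subset_of_nonneg hsub fun _ _ _ => by positivity
    _ ≤ 2 * (1 / ((n₀ : ℝ) - 1) - 1 / (max B (n₀ - 1) : ℕ)) := key _ (le_max_right _ _)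
    _ ≤ 2 * (1 / ((n₀ : ℝ) - 1)) := by
        have : (0 : ℝ) ≤ 1 / (max B (n₀ - 1) : ℕ) := by positivity
        linarith
    _ ≤ 4 / z := by
        have : (2 : ℝ) ≤ n₀ := by exact_mod_cast hn2
        rw [mul_one_div, div_le_div_iff₀ (by linarith) (by linarith)]
        linarith

theorem Rough.sum_primesOff (h : Rough W z) :
    ∑ p ∈ primesOff W x, 1 / ((p : ℝ) - 1) ^ 2 ≤ 4 / z :=
  sum_inv_sq_le h.one_lt _ fun p hp => by
    rw [mem_primesOff] at hp
    exact ⟨hp.2.1.two_le, h.le_prime p hp.2.1 hp.2.2⟩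

theorem exp_sub_one_le (y : ℝ) : Real.exp y ≤ 1 + y * Real.exp y := by
  have h := Real.add_one_le_exp (-y)
  have : Real.exp y * Real.exp (-y) = 1 := by rw [← Real.exp_add]; simp
  nlinarith [Real.exp_pos y]

theorem Rough.prod_primesOff (h : Rough W z) {K : ℝ} (hK : 0 ≤ K) (a : ℕ → ℝ)
    (ha : ∀ p, p.Prime → 0 ≤ a p ∧ a p ≤ K / ((p : ℝ) - 1) ^ 2) :
    ∏ p ∈ primesOff W x, (1 + a p) ≤ 1 + 4 * K * Real.exp (4 * K) / z := by
  have hz := h.one_lt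
  have h1 : ∑ p ∈ primesOff W x, a p ≤ 4 * K / z := by
    calc _ ≤ ∑ p ∈ primesOff W x, K * (1 / ((p : ℝ) - 1) ^ 2) := Finset.sum_le_sum fun p hp => by
          rw [mul_one_div]; exact (ha p (mem_primesOff.mp hp).2.1).2
      _ ≤ K * (4 / z) := by
          rw [← Finset.mul_sum]; exact mul_le_mul_of_nonneg_left h.sum_primesOff hK
      _ = _ := by ring
  have h2 : 4 * K / z ≤ 4 * K := div_le_self (by positivity) hz.le
  have h0 : 0 ≤ 4 * K / z := by positivity
  calc _ ≤ ∏ p ∈ primesOff W x, Real.exp (a p) := by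
        refine Finset.prod_le_prod (fun p hp => ?_) fun p _ => ?_
        · have := (ha p (mem_primesOff.mp hp).2.1).1; linarith
        · rw [add_comm]; exact Real.add_one_le_exp _
    _ = Real.exp (∑ p ∈ primesOff W x, a p) := (Real.exp_sum _ _).symm
    _ ≤ Real.exp (4 * K / z) := Real.exp_le_exp.mpr h1
    _ ≤ 1 + 4 * K / z * Real.exp (4 * K / z) := exp_sub_one_le _
    _ ≤ 1 + 4 * K / z * Real.exp (4 * K) := by gcongr
    _ = _ := by ring

theorem wt_nonneg {b : ℕ → ℝ} (hb : ∀ p, p.Prime → 0 ≤ b p) (u : ℕ) : 0 ≤ wt b u :=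
  Finset.prod_nonneg fun p hp => hb p (Nat.prime_of_mem_primeFactors hp)

theorem primeFactors_prime_mul {q v : ℕ} (hq : q.Prime) (hv : v ≠ 0) :
    (q * v).primeFactors = insert q v.primeFactors := by
  rw [Nat.primeFactors_mul hq.ne_zero hv, hq.primeFactors]; rfl

theorem wt_prime_mul {b : ℕ → ℝ} {q v : ℕ} (hq : q.Prime) (hv : v ≠ 0) (hqv : ¬ q ∣ v) :
    wt b (q * v) = b q * wt b v := by
  rw [wt, primeFactors_prime_mul hq hv, Finset.prod_insert, wt]
  exact fun h => hqv (Nat.dvd_of_mem_primeFactors h)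

/-- Division by q is injective on the multiples of q and stays in the index set; square-freeness
makes the quotient prime to q. -/
theorem sum_sfc_dvd_le {q : ℕ} (hq : q.Prime) (f g : ℕ → ℝ) (hg : ∀ v ∈ sfc W x, 0 ≤ g v)
    (hfg : ∀ v ∈ sfc W x, ¬ q ∣ v → f (q * v) ≤ g v) :
    ∑ u ∈ sfc W x with q ∣ u, f u ≤ ∑ v ∈ sfc W x, g v := by
  have hmem : ∀ u ∈ (sfc W x).filter (fun u => q ∣ u), u / q ∈ sfc W x ∧ ¬ q ∣ u / q ∧
      q * (u / q) = u := by
    intro u hu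
    rw [Finset.mem_filter, mem_sfc] at hu
    obtain ⟨⟨⟨h1, h2⟩, hs, hc⟩, v, rfl⟩ := hu
    rw [Nat.mul_div_cancel_left _ hq.pos, mem_sfc]
    have hv : v ≠ 0 := by rintro rfl; simp at h1
    refine ⟨⟨⟨Nat.pos_of_ne_zero hv, ?_⟩, hs.of_mul_right, hc.coprime_mul_left⟩, ?_, rfl⟩
    · exact (Nat.le_mul_of_pos_left v hq.pos).trans h2
    · have := (Nat.squarefree_mul_iff.mp hs).1
      exact (Nat.Prime.coprime_iff_not_dvd hq).mp this
  calc _ ≤ ∑ u ∈ (sfc W x).filter (fun u => q ∣ u), g (u / q) := Finset.sum_le_sum fun u hu => by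
        obtain ⟨h1, h2, h3⟩ := hmem u hu
        have := hfg _ h1 h2
        rwa [h3] at this
    _ = ∑ v ∈ ((sfc W x).filter (fun u => q ∣ u)).image (fun u => u / q), g v := by
        rw [Finset.sum_image]
        intro u hu u' hu' he
        rw [← (hmem u hu).2.2, ← (hmem u' hu').2.2]
        exact congrArg _ he
    _ ≤ _ := by
        refine Finset.sum_le_sum_of_subset_of_nonneg ?_ fun v hv _ => hg v hv
        intro v hv
        obtain ⟨u, hu, rfl⟩ := Finset.mem_image.mp hv
        exact (hmem u hu).1

theorem sum_wt_dvd_le {b : ℕ → ℝ} (hb : ∀ p, p.Prime → 0 ≤ b p) {q : ℕ} (hq : q.Prime) :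
    ∑ u ∈ sfc W x with q ∣ u, wt b u ≤ b q * ∑ u ∈ sfc W x, wt b u := by
  rw [Finset.mul_sum]
  refine sum_sfc_dvd_le hq _ _ (fun v _ => mul_nonneg (hb q hq) (wt_nonneg hb v)) fun v hv hqv => ?_
  rw [wt_prime_mul hq (by have := (mem_sfc.mp hv).1.1; omega) hqv]

/-- The factors 1 + c(p) are inserted one prime at a time. Inserting q changes only the multiples of
q, whose sum is at most b(q) times the whole, so it costs a factor at most 1 + b(q) c(q). Both sides
keep the same cut-off x, so no asymptotic formula is needed. -/
theorem sum_wt_twist_le {b c : ℕ → ℝ} (hb : ∀ p, p.Prime → 0 ≤ b p) (hc : ∀ p, p.Prime → 0 ≤ c p) :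
    ∑ u ∈ sfc W x, wt (fun p => b p * (1 + c p)) u ≤
      (∏ p ∈ primesOff W x, (1 + b p * c p)) * ∑ u ∈ sfc W x, wt b u := by
  have key : ∀ Q : Finset ℕ, (∀ p ∈ Q, p.Prime) →
      ∑ u ∈ sfc W x, wt b u * ∏ p ∈ u.primeFactors ∩ Q, (1 + c p) ≤
        (∏ p ∈ Q, (1 + b p * c p)) * ∑ u ∈ sfc W x, wt b u := by
    intro Q
    induction Q using Finset.induction_on with
    | empty => simp
    | insert q Q hqQ ih =>
      intro hQ
      have hq := hQ q (Finset.mem_insert_self _ _)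
      have ih := ih fun p hp => hQ p (Finset.mem_insert_of_mem hp)
      have hQp : ∀ u : ℕ, 0 ≤ ∏ p ∈ u.primeFactors ∩ Q, (1 + c p) := fun u =>
        Finset.prod_nonneg fun p hp => by
          have := hc p (hQ p (Finset.mem_insert_of_mem (Finset.mem_inter.mp hp).2)); linarith
      have split : ∀ u ∈ sfc W x, wt b u * ∏ p ∈ u.primeFactors ∩ insert q Q, (1 + c p) =
          wt b u * ∏ p ∈ u.primeFactors ∩ Q, (1 + c p) +
            if q ∣ u then c q * (wt b u * ∏ p ∈ u.primeFactors ∩ Q, (1 + c p)) else 0 := by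
        intro u hu
        have hu0 : u ≠ 0 := by have := (mem_sfc.mp hu).1.1; omega
        by_cases hqu : q ∣ u
        · rw [Finset.inter_insert_of_mem (Nat.mem_primeFactors.mpr ⟨hq, hqu, hu0⟩),
            Finset.prod_insert (fun h => hqQ (Finset.mem_inter.mp h).2), if_pos hqu]
          ring
        · rw [Finset.inter_insert_of_notMem (fun h => hqu (Nat.dvd_of_mem_primeFactors h)),
            if_neg hqu, add_zero]
      rw [Finset.sum_congr rfl split, Finset.sum_add_distrib, ← Finset.sum_filter, ← Finset.mul_sum,
        Finset.prod_insert hqQ]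
      have hd : ∑ u ∈ sfc W x with q ∣ u, wt b u * ∏ p ∈ u.primeFactors ∩ Q, (1 + c p) ≤
          ∑ u ∈ sfc W x, b q * (wt b u * ∏ p ∈ u.primeFactors ∩ Q, (1 + c p)) := by
        refine sum_sfc_dvd_le hq _ _
          (fun v _ => mul_nonneg (hb q hq) (mul_nonneg (wt_nonneg hb v) (hQp v))) fun v hv hqv => ?_
        have hv0 : v ≠ 0 := by have := (mem_sfc.mp hv).1.1; omega
        rw [wt_prime_mul hq hv0 hqv, primeFactors_prime_mul hq hv0,
          Finset.insert_inter_of_notMem hqQ, mul_assoc]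
      rw [← Finset.mul_sum] at hd
      have hcq := hc q hq
      have hbq := hb q hq
      calc _ ≤ (1 + b q * c q) * ∑ u ∈ sfc W x, wt b u * ∏ p ∈ u.primeFactors ∩ Q, (1 + c p) := by
            nlinarith [mul_le_mul_of_nonneg_left hd hcq]
        _ ≤ _ := by
            rw [mul_assoc]
            exact mul_le_mul_of_nonneg_left ih (by positivity)
  refine le_trans (le_of_eq ?_) (key _ fun p hp => (mem_primesOff.mp hp).2.1)
  refine Finset.sum_congr rfl fun u hu => ?_
  have hu := mem_sfc.mp hu
  rw [Finset.inter_eq_left.mpr (primeFactors_subset_primesOff hu.1.2 hu.2.2), wt, wt,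
    ← Finset.prod_mul_distrib]

/-- A square-free integer is determined by its set of primes, so the sum is part of the expanded
product. -/
theorem sum_wt_le_prod {b : ℕ → ℝ} (hb : ∀ p, p.Prime → 0 ≤ b p) :
    ∑ u ∈ sfc W x, wt b u ≤ ∏ p ∈ primesOff W x, (1 + b p) := by
  rw [Finset.prod_one_add]
  have hinj : Set.InjOn Nat.primeFactors (sfc W x : Set ℕ) := by
    intro u hu v hv h
    rw [← Nat.prod_primeFactors_of_squarefree (mem_sfc.mp hu).2.1,
      ← Nat.prod_primeFactors_of_squarefree (mem_sfc.mp hv).2.1, h]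
  calc _ = ∑ t ∈ (sfc W x).image Nat.primeFactors, ∏ p ∈ t, b p := by
        rw [Finset.sum_image hinj]; rfl
    _ ≤ _ := by
        refine Finset.sum_le_sum_of_subset_of_nonneg ?_ fun t ht _ =>
          Finset.prod_nonneg fun p hp => hb p ?_
        · intro t ht
          obtain ⟨u, hu, rfl⟩ := Finset.mem_image.mp ht
          have hu := mem_sfc.mp hu
          exact Finset.mem_powerset.mpr (primeFactors_subset_primesOff hu.1.2 hu.2.2)
        · exact (mem_primesOff.mp (Finset.mem_powerset.mp ht hp)).2.1

theorem totient_eq_prod_of_squarefree {u : ℕ} (hu : Squarefree u) :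
    (Nat.totient u : ℝ) = ∏ p ∈ u.primeFactors, ((p : ℝ) - 1) := by
  have h := Nat.totient_mul_prod_primeFactors u
  rw [Nat.prod_primeFactors_of_squarefree hu, mul_comm] at h
  rw [Nat.eq_of_mul_eq_mul_left (Nat.pos_of_ne_zero hu.ne_zero) h, Nat.cast_prod]
  refine Finset.prod_congr rfl fun p hp => ?_
  rw [Nat.cast_sub (Nat.prime_of_mem_primeFactors hp).one_le, Nat.cast_one]

theorem inv_totient_eq_wt {u : ℕ} (hu : Squarefree u) :
    1 / (Nat.totient u : ℝ) = wt (fun p => 1 / ((p : ℝ) - 1)) u := by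
  rw [totient_eq_prod_of_squarefree hu, wt, Finset.prod_div_distrib, Finset.prod_const_one]

theorem inv_eq_wt {u : ℕ} (hu : Squarefree u) :
    1 / (u : ℝ) = wt (fun p => 1 / (p : ℝ)) u := by
  nth_rewrite 1 [← Nat.prod_primeFactors_of_squarefree hu]
  rw [wt, Finset.prod_div_distrib, Finset.prod_const_one, Nat.cast_prod]

/-! ### The totient sum and the harmonic sum -/

/-- `∑_{u ≤ x} μ²(u) / φ(u)` over `u` coprime to `W`. -/
def totSum (W : ℕ) (x : ℝ) : ℝ := ∑ u ∈ sfc W x, 1 / (Nat.totient u : ℝ)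

/-- `∑_{m ≤ x} 1 / m` over `m` coprime to `W`. -/
def harmSum (W : ℕ) (x : ℝ) : ℝ := ∑ m ∈ Icc 1 ⌊x⌋₊ with m.Coprime W, 1 / (m : ℝ)

theorem totSum_eq : totSum W x = ∑ u ∈ sfc W x, wt (fun p => 1 / ((p : ℝ) - 1)) u :=
  Finset.sum_congr rfl fun _ hu => inv_totient_eq_wt (mem_sfc.mp hu).2.1

theorem totSum_nonneg : 0 ≤ totSum W x := Finset.sum_nonneg fun _ _ => by positivity

theorem harmSum_nonneg : 0 ≤ harmSum W x := Finset.sum_nonneg fun _ _ => by positivity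

theorem one_lt_cast_prime {p : ℕ} (hp : p.Prime) : (1 : ℝ) < p := by exact_mod_cast hp.one_lt

theorem Rough.sum_twist_le (h : Rough W z) {K : ℝ} (hK : 0 ≤ K) :
    ∑ u ∈ sfc W x, wt (fun p => 1 / ((p : ℝ) - 1) * (1 + K / ((p : ℝ) - 1))) u ≤
      (1 + 4 * K * Real.exp (4 * K) / z) * totSum W x := by
  rw [totSum_eq]
  have hp0 : ∀ p : ℕ, p.Prime → 0 < (p : ℝ) - 1 := fun p hp => by linarith [one_lt_cast_prime hp]
  refine (sum_wt_twist_le (fun p hp => (one_div_pos.mpr (hp0 p hp)).le)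
    (fun p hp => div_nonneg hK (hp0 p hp).le)).trans ?_
  refine mul_le_mul_of_nonneg_right (h.prod_primesOff hK _ fun p hp => ?_)
    (Finset.sum_nonneg fun u _ => wt_nonneg (fun p hp => (one_div_pos.mpr (hp0 p hp)).le) u)
  have e : 1 / ((p : ℝ) - 1) * (K / ((p : ℝ) - 1)) = K / ((p : ℝ) - 1) ^ 2 := by
    rw [div_mul_div_comm, one_mul, sq]
  rw [e]
  exact ⟨div_nonneg hK (sq_nonneg _), le_rfl⟩

theorem sum_inv_sfc_le : ∑ u ∈ sfc W x, 1 / (u : ℝ) ≤ harmSum W x := by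
  refine Finset.sum_le_sum_of_subset_of_nonneg ?_ fun _ _ _ => by positivity
  intro u hu
  have := mem_sfc.mp hu
  exact Finset.mem_filter.mpr ⟨Finset.mem_Icc.mpr this.1, this.2.2⟩

theorem sum_harm_dvd_le {d : ℕ} (hd : 0 < d) :
    ∑ m ∈ Icc 1 ⌊x⌋₊ with (m.Coprime W ∧ d ∣ m), 1 / (m : ℝ) ≤ 1 / d * harmSum W x := by
  set A := (Icc 1 ⌊x⌋₊).filter (fun m => m.Coprime W ∧ d ∣ m) with hA
  have hmem : ∀ m ∈ A, m / d ∈ (Icc 1 ⌊x⌋₊).filter (fun m => m.Coprime W) ∧ d * (m / d) = m := by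
    intro m hm
    rw [hA, Finset.mem_filter, Finset.mem_Icc] at hm
    obtain ⟨⟨h1, h2⟩, hc, v, rfl⟩ := hm
    rw [Nat.mul_div_cancel_left _ hd, Finset.mem_filter, Finset.mem_Icc]
    have hv : v ≠ 0 := by rintro rfl; simp at h1
    exact ⟨⟨⟨Nat.pos_of_ne_zero hv, (Nat.le_mul_of_pos_left v hd).trans h2⟩,
      hc.coprime_mul_left⟩, rfl⟩
  rw [harmSum, Finset.mul_sum]
  calc _ = ∑ m ∈ A, 1 / (d : ℝ) * (1 / ((m / d : ℕ) : ℝ)) := Finset.sum_congr rfl fun m hm => by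
        nth_rewrite 1 [← (hmem m hm).2]
        push_cast
        rw [one_div_mul_one_div]
    _ = ∑ v ∈ A.image (fun m => m / d), 1 / (d : ℝ) * (1 / (v : ℝ)) := by
        rw [Finset.sum_image]
        intro u hu u' hu' he
        rw [← (hmem u hu).2, ← (hmem u' hu').2]
        exact congrArg _ he
    _ ≤ _ := by
        refine Finset.sum_le_sum_of_subset_of_nonneg ?_ fun v hv _ => by positivity
        intro v hv
        obtain ⟨u, hu, rfl⟩ := Finset.mem_image.mp hv
        exact (hmem u hu).1

theorem sum_biUnion_le_sum {α β : Type*} [DecidableEq β] (s : Finset α) (t : α → Finset β)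
    {f : β → ℝ} (hf : ∀ b, 0 ≤ f b) : ∑ b ∈ s.biUnion t, f b ≤ ∑ a ∈ s, ∑ b ∈ t a, f b := by
  classical
  induction s using Finset.induction_on with
  | empty => simp
  | insert a s ha ih =>
    rw [Finset.biUnion_insert, Finset.sum_insert ha]
    have h := Finset.sum_union_inter (f := f) (s₁ := t a) (s₂ := s.biUnion t)
    have h0 := Finset.sum_nonneg (s := t a ∩ s.biUnion t) (f := f) fun b _ => hf b
    linarith

/-- An integer coprime to W that is not square-free is divisible by p² for some prime p ∤ W, and
multiples of p² carry at most a share 1/p² of the harmonic sum. -/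
theorem Rough.harmSum_sub_le (h : Rough W z) :
    harmSum W x - ∑ u ∈ sfc W x, 1 / (u : ℝ) ≤ 4 / z * harmSum W x := by
  have hle : harmSum W x ≤ ∑ u ∈ sfc W x, 1 / (u : ℝ) +
      ∑ p ∈ primesOff W x, ∑ m ∈ Icc 1 ⌊x⌋₊ with (m.Coprime W ∧ p ^ 2 ∣ m), 1 / (m : ℝ) := by
    have hcov : (Icc 1 ⌊x⌋₊).filter (fun m => m.Coprime W) ⊆ sfc W x ∪
        (primesOff W x).biUnion fun p =>
          (Icc 1 ⌊x⌋₊).filter (fun m => m.Coprime W ∧ p ^ 2 ∣ m) := by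
      intro m hm
      rw [Finset.mem_filter] at hm
      rw [Finset.mem_union]
      by_cases hs : Squarefree m
      · exact Or.inl (mem_sfc.mpr ⟨Finset.mem_Icc.mp hm.1, hs, hm.2⟩)
      · right
        rw [Nat.squarefree_iff_prime_squarefree] at hs
        push Not at hs
        obtain ⟨p, hp, hpm⟩ := hs
        have hm1 := Finset.mem_Icc.mp hm.1
        rw [Finset.mem_biUnion]
        refine ⟨p, primeFactors_subset_primesOff hm1.2 hm.2
          (Nat.mem_primeFactors.mpr ⟨hp, dvd_of_mul_left_dvd hpm, by omega⟩),
          Finset.mem_filter.mpr ⟨hm.1, hm.2, by rwa [sq]⟩⟩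
    calc _ ≤ ∑ m ∈ sfc W x ∪ (primesOff W x).biUnion fun p =>
          (Icc 1 ⌊x⌋₊).filter (fun m => m.Coprime W ∧ p ^ 2 ∣ m), 1 / (m : ℝ) :=
          Finset.sum_le_sum_of_subset_of_nonneg hcov fun _ _ _ => by positivity
      _ ≤ _ := by
          have hu := Finset.sum_union_inter (f := fun m : ℕ => 1 / (m : ℝ)) (s₁ := sfc W x)
            (s₂ := (primesOff W x).biUnion fun p =>
              (Icc 1 ⌊x⌋₊).filter (fun m => m.Coprime W ∧ p ^ 2 ∣ m))
          have h0 := Finset.sum_nonneg (s := sfc W x ∩ (primesOff W x).biUnion fun p =>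
              (Icc 1 ⌊x⌋₊).filter (fun m => m.Coprime W ∧ p ^ 2 ∣ m))
              (f := fun m : ℕ => 1 / (m : ℝ)) fun _ _ => by positivity
          have hb := sum_biUnion_le_sum (primesOff W x)
            (fun p => (Icc 1 ⌊x⌋₊).filter (fun m => m.Coprime W ∧ p ^ 2 ∣ m))
            (f := fun m : ℕ => 1 / (m : ℝ)) fun _ => by positivity
          linarith
  have h2 : ∑ p ∈ primesOff W x, ∑ m ∈ Icc 1 ⌊x⌋₊ with (m.Coprime W ∧ p ^ 2 ∣ m), 1 / (m : ℝ) ≤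
      4 / z * harmSum W x := by
    calc _ ≤ ∑ p ∈ primesOff W x, 1 / ((p : ℝ) - 1) ^ 2 * harmSum W x :=
          Finset.sum_le_sum fun p hp => by
            have hp := (mem_primesOff.mp hp).2.1
            refine (sum_harm_dvd_le (pow_pos hp.pos 2)).trans ?_
            refine mul_le_mul_of_nonneg_right ?_ harmSum_nonneg
            have := one_lt_cast_prime hp
            push_cast
            apply one_div_le_one_div_of_le (by nlinarith) (by nlinarith)
      _ ≤ _ := by
          rw [← Finset.sum_mul]
          exact mul_le_mul_of_nonneg_right h.sum_primesOff harmSum_nonneg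
  linarith

/-- Since 1/(p-1) = (1/p)(1 + 1/(p-1)), the totient sum is a twist of ∑ 1/u, with b(p)c(p) =
1/(p(p-1)) summable over primes p ≥ z to O(1/z). -/
theorem Rough.abs_totSum_sub_harmSum (h : Rough W z) :
    |totSum W x - harmSum W x| ≤ 4 * Real.exp 4 / z * harmSum W x := by
  have hz := h.one_lt
  have hp0 : ∀ p : ℕ, p.Prime → 0 < (p : ℝ) - 1 := fun p hp => by linarith [one_lt_cast_prime hp]
  have hpp : ∀ p : ℕ, p.Prime → 0 < (p : ℝ) := fun p hp => by linarith [one_lt_cast_prime hp]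
  have h1 : ∑ u ∈ sfc W x, 1 / (u : ℝ) ≤ totSum W x := by
    refine Finset.sum_le_sum fun u hu => ?_
    have hu1 := (mem_sfc.mp hu).1.1
    have : 0 < Nat.totient u := Nat.totient_pos.mpr hu1
    exact one_div_le_one_div_of_le (by exact_mod_cast this) (by exact_mod_cast Nat.totient_le u)
  have h2 : totSum W x ≤ (1 + 4 * 1 * Real.exp (4 * 1) / z) * ∑ u ∈ sfc W x, 1 / (u : ℝ) := by
    have e1 : ∑ u ∈ sfc W x, 1 / (u : ℝ) = ∑ u ∈ sfc W x, wt (fun p => 1 / (p : ℝ)) u :=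
      Finset.sum_congr rfl fun u hu => inv_eq_wt (mem_sfc.mp hu).2.1
    have e2 : totSum W x = ∑ u ∈ sfc W x, wt (fun p => 1 / (p : ℝ) * (1 + 1 / ((p : ℝ) - 1))) u := by
      rw [totSum_eq]
      refine Finset.sum_congr rfl fun u _ => Finset.prod_congr rfl fun p hp => ?_
      have hp := Nat.prime_of_mem_primeFactors hp
      have := hp0 p hp
      have := hpp p hp
      field_simp
      ring
    rw [e1, e2]
    refine (sum_wt_twist_le (fun p hp => (one_div_pos.mpr (hpp p hp)).le)
      (fun p hp => (one_div_pos.mpr (hp0 p hp)).le)).trans ?_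
    refine mul_le_mul_of_nonneg_right (h.prod_primesOff zero_le_one _ fun p hp => ?_)
      (Finset.sum_nonneg fun u _ => wt_nonneg (fun p hp => (one_div_pos.mpr (hpp p hp)).le) u)
    have a := hp0 p hp
    have b := hpp p hp
    refine ⟨by positivity, ?_⟩
    rw [one_div_mul_one_div]
    exact one_div_le_one_div_of_le (by positivity) (by nlinarith)
  have h3 := h.harmSum_sub_le (x := x)
  have h4 := sum_inv_sfc_le (W := W) (x := x)
  have h5 := harmSum_nonneg (W := W) (x := x)
  have h6 : 4 / z ≤ 4 * Real.exp 4 / z := by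
    gcongr
    linarith [Real.add_one_le_exp 4]
  have h7 : 0 ≤ 4 * Real.exp 4 / z := by positivity
  simp only [mul_one] at h2
  rw [abs_le]
  constructor
  · nlinarith
  · nlinarith

theorem totient_div_eq_sum_moebius (hW : W ≠ 0) :
    (Nat.totient W : ℝ) / W = ∑ d ∈ W.divisors, (ArithmeticFunction.moebius d : ℝ) / d := by
  have := (ArithmeticFunction.sum_eq_iff_sum_mul_moebius_eq (R := ℝ) (f := fun n => (Nat.totient n : ℝ))
    (g := fun n => (n : ℝ))).mp (fun n _ => by exact_mod_cast congrArg (Nat.cast (R := ℝ)) (Nat.sum_totient n))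
    W (Nat.pos_of_ne_zero hW)
  rw [← this, Nat.sum_divisorsAntidiagonal (f := fun a b => (ArithmeticFunction.moebius a : ℝ) * (b : ℝ)),
    Finset.sum_div]
  refine Finset.sum_congr rfl fun d hd => ?_
  have hdW := Nat.dvd_of_mem_divisors hd
  have hd0 : (d : ℝ) ≠ 0 := by
    have := Nat.pos_of_mem_divisors hd
    positivity
  rw [Nat.cast_div hdW hd0]
  have : (W : ℝ) ≠ 0 := by exact_mod_cast hW
  field_simp

theorem sum_inv_floor_eq_harmonic (y : ℝ) :
    ∑ m ∈ Icc 1 ⌊y⌋₊, 1 / (m : ℝ) = (harmonic ⌊y⌋₊ : ℝ) := by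
  rw [harmonic_eq_sum_Icc]
  push_cast
  simp

theorem sum_moebius_divisors (n : ℕ) :
    ∑ d ∈ n.divisors, (ArithmeticFunction.moebius d : ℝ) = if n = 1 then 1 else 0 := by
  have h : (ArithmeticFunction.moebius * (ArithmeticFunction.zeta : ArithmeticFunction ℤ)) n =
      ∑ d ∈ n.divisors, ArithmeticFunction.moebius d := ArithmeticFunction.coe_mul_zeta_apply
  rw [ArithmeticFunction.moebius_mul_coe_zeta, ArithmeticFunction.one_apply] at h
  have := congrArg (Int.cast (R := ℝ)) h
  push_cast at this
  exact this.symm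

theorem sum_multiples_inv {d : ℕ} (hd : 0 < d) :
    ∑ m ∈ Icc 1 ⌊x⌋₊ with d ∣ m, 1 / (m : ℝ) = 1 / d * (harmonic ⌊x / d⌋₊ : ℝ) := by
  rw [← sum_inv_floor_eq_harmonic, Finset.mul_sum]
  symm
  refine Finset.sum_nbij' (fun v => d * v) (fun m => m / d) ?_ ?_ ?_ ?_ ?_
  · intro v hv
    rw [Finset.mem_Icc, Nat.floor_div_natCast] at hv
    rw [Finset.mem_filter, Finset.mem_Icc]
    refine ⟨⟨Nat.mul_pos hd hv.1, ?_⟩, dvd_mul_right _ _⟩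
    rw [mul_comm]
    exact (Nat.le_div_iff_mul_le hd).mp hv.2
  · intro m hm
    rw [Finset.mem_filter, Finset.mem_Icc] at hm
    rw [Finset.mem_Icc, Nat.floor_div_natCast]
    exact ⟨Nat.div_pos (Nat.le_of_dvd hm.1.1 hm.2) hd, Nat.div_le_div_right hm.1.2⟩
  · intro v _; exact Nat.mul_div_cancel_left _ hd
  · intro m hm
    exact Nat.mul_div_cancel' (Finset.mem_filter.mp hm).2
  · intro v _; push_cast; rw [one_div_mul_one_div]

/-- The crude bound d covers log d ≤ d - 1 plus the error 1 of the harmonic number; for d > x the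
harmonic number is 0 and log x < log d. -/
theorem abs_harmonic_floor_div_sub_log_le (hx : 1 ≤ x) {d : ℕ} (hd : 0 < d) :
    |(harmonic ⌊x / d⌋₊ : ℝ) - Real.log x| ≤ d := by
  have hd0 : (0 : ℝ) < d := by exact_mod_cast hd
  have hlogd : Real.log d ≤ d - 1 := Real.log_le_sub_one_of_pos hd0
  have hd1 : (1 : ℝ) ≤ d := by exact_mod_cast hd
  have hl0 : 0 ≤ Real.log d := Real.log_nonneg hd1
  have hx0 : 0 < x := by linarith
  rcases le_or_gt 1 (x / d) with h | h
  · have h1 := log_le_harmonic_floor (x / d) (by positivity)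
    have h2 := harmonic_floor_le_one_add_log (x / d) h
    rw [Real.log_div hx0.ne' hd0.ne'] at h1 h2
    rw [abs_le]
    constructor <;> linarith
  · rw [Nat.floor_eq_zero.mpr h]
    have := Real.log_nonneg hx
    have h3 : Real.log x < Real.log d := Real.log_lt_log hx0 ((div_lt_one hd0).mp h)
    simp only [harmonic_zero, Rat.cast_zero, zero_sub, abs_neg]
    rw [abs_of_nonneg this]
    linarith

/-- Möbius inversion over the divisors of W. The error d is multiplied by |μ(d)|/d, so each divisor
costs at most 1, and there are at most W of them. This crude bound suffices because W is tiny
compared with log R. -/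
theorem abs_harmSum_sub_le (hW : W ≠ 0) (hx : 1 ≤ x) :
    |harmSum W x - (Nat.totient W : ℝ) / W * Real.log x| ≤ W := by
  have e1 : harmSum W x = ∑ d ∈ W.divisors,
      (ArithmeticFunction.moebius d : ℝ) / d * (harmonic ⌊x / d⌋₊ : ℝ) := by
    have a1 : harmSum W x = ∑ m ∈ Icc 1 ⌊x⌋₊, ∑ d ∈ W.divisors,
        if d ∣ m then (ArithmeticFunction.moebius d : ℝ) * (1 / (m : ℝ)) else 0 := by
      rw [harmSum, Finset.sum_filter]
      refine Finset.sum_congr rfl fun m hm => ?_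
      rw [← Finset.sum_filter, ← Finset.sum_mul]
      have hm0 : m ≠ 0 := by have := (Finset.mem_Icc.mp hm).1; omega
      have hg : m.gcd W ≠ 0 := by simp [hm0]
      have hset : W.divisors.filter (fun d => d ∣ m) = (m.gcd W).divisors := by
        ext d
        simp only [Finset.mem_filter, Nat.mem_divisors, Nat.dvd_gcd_iff]
        tauto
      rw [hset, sum_moebius_divisors]
      by_cases hc : m.Coprime W
      · rw [if_pos hc, if_pos hc, one_mul]
      · rw [if_neg hc, if_neg hc, zero_mul]
    rw [a1, Finset.sum_comm]
    refine Finset.sum_congr rfl fun d hd => ?_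
    rw [← Finset.sum_filter, ← Finset.mul_sum, sum_multiples_inv (Nat.pos_of_mem_divisors hd)]
    ring
  rw [e1, totient_div_eq_sum_moebius hW, Finset.sum_mul, ← Finset.sum_sub_distrib]
  refine (Finset.abs_sum_le_sum_abs _ _).trans ?_
  calc _ ≤ ∑ d ∈ W.divisors, (1 : ℝ) := Finset.sum_le_sum fun d hd => by
        have hd0 := Nat.pos_of_mem_divisors hd
        have hd1 : (0 : ℝ) < d := by exact_mod_cast hd0
        rw [← mul_sub, abs_mul, abs_div, abs_of_pos hd1]
        have hmu : |(ArithmeticFunction.moebius d : ℝ)| ≤ 1 := by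
          exact_mod_cast ArithmeticFunction.abs_moebius_le_one (n := d)
        calc _ ≤ 1 / (d : ℝ) * d := by
              refine mul_le_mul ?_ (abs_harmonic_floor_div_sub_log_le hx hd0) (abs_nonneg _)
                (by positivity)
              gcongr
          _ = 1 := by field_simp
    _ ≤ W := by
        rw [Finset.sum_const, nsmul_eq_mul, mul_one]
        exact_mod_cast Nat.card_divisors_le_self W

/-- `T(x) = (φ(W)/W) log x (1 + O(1/z)) + O(W)`. -/
theorem Rough.abs_totSum_sub_le (h : Rough W z) (hx : 1 ≤ x) :
    |totSum W x - (Nat.totient W : ℝ) / W * Real.log x| ≤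
      4 * Real.exp 4 / z * ((Nat.totient W : ℝ) / W * Real.log x + W) + W := by
  have h1 := h.abs_totSum_sub_harmSum (x := x)
  have h2 := abs_harmSum_sub_le h.ne_zero hx
  have hz := h.one_lt
  have h3 : harmSum W x ≤ (Nat.totient W : ℝ) / W * Real.log x + W := by
    linarith [(abs_le.mp h2).2]
  have h4 : 4 * Real.exp 4 / z * harmSum W x ≤
      4 * Real.exp 4 / z * ((Nat.totient W : ℝ) / W * Real.log x + W) :=
    mul_le_mul_of_nonneg_left h3 (by positivity)
  calc _ ≤ |totSum W x - harmSum W x| + |harmSum W x - (Nat.totient W : ℝ) / W * Real.log x| :=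
        abs_sub_le _ _ _
    _ ≤ _ := by linarith

end

end MultSieve

/-! ### Mean values of products of local factors in a residue class -/

namespace MultSieve
noncomputable section

open Finset

theorem abs_card_modEq_sub_le {a b q : ℕ} (hab : a ≤ b) (hq : 0 < q) (v : ℕ) :
    |(((Ioc a b).filter (fun n => n ≡ v [MOD q])).card : ℝ) - ((b : ℝ) - a) / q| ≤ 1 := by
  have h := Nat.Ioc_filter_modEq_card a b hq v
  have hq0 : (0 : ℚ) < q := by exact_mod_cast hq
  have hmono : ⌊((a : ℚ) - v) / q⌋ ≤ ⌊((b : ℚ) - v) / q⌋ := by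
    apply Int.floor_le_floor
    gcongr
  rw [max_eq_left (by linarith)] at h
  have h1 := Int.floor_le (((a : ℚ) - v) / q)
  have h2 := Int.lt_floor_add_one (((a : ℚ) - v) / q)
  have h3 := Int.floor_le (((b : ℚ) - v) / q)
  have h4 := Int.lt_floor_add_one (((b : ℚ) - v) / q)
  have e : ((b : ℚ) - a) / q = ((b : ℚ) - v) / q - ((a : ℚ) - v) / q := by ring
  have h' : (((Ioc a b).filter (fun n => n ≡ v [MOD q])).card : ℚ) =
      (⌊((b : ℚ) - v) / q⌋ : ℚ) - (⌊((a : ℚ) - v) / q⌋ : ℚ) := by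
    exact_mod_cast congrArg (Int.cast (R := ℚ)) h
  have : |(((Ioc a b).filter (fun n => n ≡ v [MOD q])).card : ℚ) - ((b : ℚ) - a) / q| ≤ 1 := by
    rw [h', e, abs_le]
    constructor <;> linarith
  have h5 := (Rat.cast_le (K := ℝ)).mpr this
  push_cast at h5
  exact h5

/-- Products of functions periodic modulo distinct primes are equidistributed in a residue class. -/
theorem abs_sum_prod_periodic_sub_le {a b : ℕ} (hab : a ≤ b) (f : ℕ → ℕ → ℝ) (S : Finset ℕ) :
    (∀ p ∈ S, p.Prime ∧ ∀ n, f p n = f p (n % p)) → ∀ q : ℕ, 0 < q →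
      (∀ p ∈ S, ¬ p ∣ q) → ∀ v : ℕ,
      |∑ n ∈ Ioc a b with n ≡ v [MOD q], ∏ p ∈ S, f p n -
          ((b : ℝ) - a) / q * ∏ p ∈ S, ((∑ x ∈ range p, f p x) / p)| ≤
        ∏ p ∈ S, ∑ x ∈ range p, |f p x| := by
  induction S using Finset.induction_on with
  | empty =>
    intro _ q hq _ v
    simpa using abs_card_modEq_sub_le hab hq v
  | insert p S hpS ih =>
    intro hS q hq hqS v
    obtain ⟨hp, hper⟩ := hS p (mem_insert_self _ _)
    have hcop : q.Coprime p := ((Nat.Prime.coprime_iff_not_dvd hp).mpr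
      (hqS p (mem_insert_self _ _))).symm
    have ih' := ih (fun l hl => hS l (mem_insert_of_mem hl)) (q * p) (Nat.mul_pos hq hp.pos)
      (fun l hl hd => by
        have hl' := (hS l (mem_insert_of_mem hl)).1
        rcases hl'.dvd_mul.mp hd with h | h
        · exact hqS l (mem_insert_of_mem hl) h
        · rw [(Nat.prime_dvd_prime_iff_eq hl' hp).mp h] at hl
          exact hpS hl)
    -- Sorting n by its residue x modulo p fixes the factor at p and, by the Chinese remainder
    -- theorem, leaves one class modulo q p for the other factors.
    have split : ∑ n ∈ Ioc a b with n ≡ v [MOD q], ∏ l ∈ insert p S, f l n =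
        ∑ x ∈ range p, f p x * ∑ n ∈ Ioc a b with
          n ≡ (Nat.chineseRemainder hcop v x : ℕ) [MOD q * p], ∏ l ∈ S, f l n := by
      have : ∀ n ∈ (Ioc a b).filter (fun n => n ≡ v [MOD q]), ∏ l ∈ insert p S, f l n =
          ∑ x ∈ range p, if n % p = x then f p x * ∏ l ∈ S, f l n else 0 := by
        intro n _
        rw [prod_insert hpS, Finset.sum_ite_eq, if_pos (mem_range.mpr (Nat.mod_lt _ hp.pos)),
          ← hper]
      rw [sum_congr rfl this, sum_comm]
      refine sum_congr rfl fun x hx => ?_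
      rw [← sum_filter, filter_filter, mul_sum]
      refine sum_congr (filter_congr fun n _ => ?_) fun _ _ => rfl
      have hc := (Nat.chineseRemainder hcop v x).2
      rw [← Nat.modEq_and_modEq_iff_modEq_mul hcop]
      have hx' : n % p = x ↔ n ≡ x [MOD p] := by
        rw [Nat.ModEq, Nat.mod_eq_of_lt (mem_range.mp hx)]
      rw [hx']
      constructor
      · rintro ⟨h1, h2⟩
        exact ⟨h1.trans hc.1.symm, h2.trans hc.2.symm⟩
      · rintro ⟨h1, h2⟩
        exact ⟨h1.trans hc.1, h2.trans hc.2⟩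
    rw [split, prod_insert hpS, prod_insert hpS]
    have hp0 : (p : ℝ) ≠ 0 := by exact_mod_cast hp.ne_zero
    have hq0 : (q : ℝ) ≠ 0 := by exact_mod_cast hq.ne'
    have e : ((b : ℝ) - a) / q * ((∑ x ∈ range p, f p x) / p *
          ∏ l ∈ S, ((∑ x ∈ range l, f l x) / l)) =
        ∑ x ∈ range p, f p x * (((b : ℝ) - a) / (q * p : ℕ) *
          ∏ l ∈ S, ((∑ x ∈ range l, f l x) / l)) := by
      rw [← sum_mul]
      push_cast
      field_simp
    rw [e, ← sum_sub_distrib, sum_mul]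
    refine (abs_sum_le_sum_abs _ _).trans (sum_le_sum fun x _ => ?_)
    rw [← mul_sub, abs_mul]
    exact mul_le_mul_of_nonneg_left (ih' _) (abs_nonneg _)

theorem sum_range_point {p a : ℕ} (ha : a < p) (α β : ℝ) :
    ∑ x ∈ range p, (α + if x = a then β else 0) = p * α + β := by
  rw [sum_add_distrib, Finset.sum_ite_eq', if_pos (mem_range.mpr ha)]
  simp

/-- The local factor `1 - p 1_{x = a}`. -/
theorem sum_pair_point {p a b : ℕ} (ha : a < p) (hb : b < p) :
    ∑ x ∈ range p, (if x = a then 1 - (p : ℝ) else 1) * (if x = b then 1 - (p : ℝ) else 1) =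
      if a = b then (p : ℝ) * (p - 1) else -p := by
  have : ∀ x : ℕ, (if x = a then 1 - (p : ℝ) else 1) * (if x = b then 1 - (p : ℝ) else 1) =
      (1 + if x = a then -(p : ℝ) else 0) +
        if x = b then (if a = b then (p : ℝ) ^ 2 - p else -p) else 0 := by
    intro x
    by_cases h1 : x = a <;> by_cases h2 : x = b
    · subst h1; subst h2; simp; ring
    · subst h1; simp [h2]; ring
    · subst h2; simp [h1, Ne.symm h1]; ring
    · simp [h1, h2]
  rw [sum_congr rfl fun x _ => this x, sum_add_distrib, sum_range_point ha, Finset.sum_ite_eq',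
    if_pos (mem_range.mpr hb)]
  split_ifs <;> ring

/-- The bound is the product of the two single sums in `sum_abs_point` rather than the exact value,
so that the remainder later separates into a factor for r and one for s. -/
theorem sum_abs_pair_point_le {p a b : ℕ} (hp : 2 ≤ p) (ha : a < p) (hb : b < p) :
    ∑ x ∈ range p, |(if x = a then 1 - (p : ℝ) else 1) * (if x = b then 1 - (p : ℝ) else 1)| ≤
      (2 * ((p : ℝ) - 1)) * (2 * (p - 1)) := by
  have hp2 : (2 : ℝ) ≤ p := by exact_mod_cast hp
  have : ∀ x : ℕ, |(if x = a then 1 - (p : ℝ) else 1) * (if x = b then 1 - (p : ℝ) else 1)| =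
      (1 + if x = a then (p : ℝ) - 2 else 0) +
        if x = b then (if a = b then ((p : ℝ) - 1) ^ 2 - (p - 1) else (p : ℝ) - 2) else 0 := by
    intro x
    have h1p : |1 - (p : ℝ)| = p - 1 := by rw [abs_of_nonpos (by linarith)]; ring
    rw [abs_mul]
    by_cases h1 : x = a <;> by_cases h2 : x = b
    · subst h1; subst h2; simp [h1p]; ring
    · subst h1; simp [h2, h1p]; ring
    · subst h2; simp [h1, Ne.symm h1, h1p]; ring
    · simp [h1, h2]
  rw [sum_congr rfl fun x _ => this x, sum_add_distrib, sum_range_point ha, Finset.sum_ite_eq',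
    if_pos (mem_range.mpr hb)]
  split_ifs <;> nlinarith

theorem sum_abs_point {p a : ℕ} (hp : 2 ≤ p) (ha : a < p) :
    ∑ x ∈ range p, |if x = a then 1 - (p : ℝ) else 1| = 2 * (p - 1) := by
  have hp2 : (2 : ℝ) ≤ p := by exact_mod_cast hp
  have : ∀ x : ℕ, |if x = a then 1 - (p : ℝ) else 1| = 1 + if x = a then (p : ℝ) - 2 else 0 := by
    intro x
    by_cases h : x = a
    · simp only [h, if_true]
      rw [abs_of_nonpos (by linarith)]; ring
    · simp [h]
  rw [sum_congr rfl fun x _ => this x, sum_range_point ha]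
  ring

variable {k : ℕ} {A : Fin k → ℕ} {B : Fin k → ℤ}

/-- `1 - p` if `p ∣ L_i(n)`, and `1` otherwise. -/
def locFactor (A : Fin k → ℕ) (B : Fin k → ℤ) (p : ℕ) (i : Fin k) (n : ℕ) : ℝ :=
  if (p : ℤ) ∣ linForm A B i n then 1 - (p : ℝ) else 1

/-- The product of the local factors at `p` over the components of `r` divisible by `p`. -/
def tupleFactor (A : Fin k → ℕ) (B : Fin k → ℤ) (r : Fin k → ℕ) (p n : ℕ) : ℝ :=
  ∏ i, if p ∣ r i then locFactor A B p i n else 1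

/-- `∏_{p ∣ r_1 ⋯ r_k}` of the local factors. -/
def tupleChar (A : Fin k → ℕ) (B : Fin k → ℤ) (r : Fin k → ℕ) (n : ℕ) : ℝ :=
  ∏ p ∈ (∏ i, r i).primeFactors, tupleFactor A B r p n

/-- The prime `p` divides no leading coefficient and no resultant. -/
def GoodPrime (A : Fin k → ℕ) (B : Fin k → ℤ) (p : ℕ) : Prop :=
  p.Prime ∧ (∀ i, ¬ p ∣ A i) ∧ ∀ i j, i ≠ j → ¬ (p : ℤ) ∣ (A i : ℤ) * B j - (A j : ℤ) * B i

/-- The leading coefficient is invertible modulo p, so the root is -B_i / A_i. -/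
theorem GoodPrime.exists_root {p : ℕ} (h : GoodPrime A B p) (i : Fin k) :
    ∃ a < p, ∀ n : ℕ, (p : ℤ) ∣ linForm A B i n ↔ n % p = a := by
  have := Fact.mk h.1
  have hA : (A i : ZMod p) ≠ 0 := by
    rw [Ne, ZMod.natCast_eq_zero_iff]; exact h.2.1 i
  refine ⟨(-(B i : ZMod p) / (A i : ZMod p)).val, ZMod.val_lt _, fun n => ?_⟩
  rw [← ZMod.intCast_zmod_eq_zero_iff_dvd, linForm]
  push_cast
  have : n % p = (n : ZMod p).val := (ZMod.val_natCast p n).symm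
  rw [this, (ZMod.val_injective p).eq_iff, eq_div_iff hA]
  constructor
  · intro h; linear_combination h
  · intro h; linear_combination h

/-- The resultant is an integer combination of L_i(n) and L_j(n). -/
theorem GoodPrime.not_both {p : ℕ} (h : GoodPrime A B p) {i j : Fin k} (hij : i ≠ j) (n : ℤ) :
    ¬ ((p : ℤ) ∣ linForm A B i n ∧ (p : ℤ) ∣ linForm A B j n) := by
  rintro ⟨h1, h2⟩
  apply h.2.2 i j hij
  have : (A i : ℤ) * B j - (A j : ℤ) * B i =
      (A i : ℤ) * linForm A B j n - (A j : ℤ) * linForm A B i n := by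
    unfold linForm; ring
  rw [this]
  exact dvd_sub (h2.mul_left _) (h1.mul_left _)

theorem GoodPrime.exists_roots {p : ℕ} (h : GoodPrime A B p) :
    ∃ a : Fin k → ℕ, (∀ i, a i < p) ∧ Function.Injective a ∧
      ∀ i n, locFactor A B p i n = if n % p = a i then 1 - (p : ℝ) else 1 := by
  choose a ha hr using h.exists_root
  refine ⟨a, ha, fun i j hij => ?_, fun i n => ?_⟩
  · by_contra hne
    refine h.not_both hne (a i) ⟨(hr i (a i)).mpr (Nat.mod_eq_of_lt (ha i)), (hr j (a i)).mpr ?_⟩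
    rw [← hij]; exact Nat.mod_eq_of_lt (ha i)
  · rw [locFactor]
    simp only [hr]

theorem exists_unique_dvd {r : Fin k → ℕ} (hr : Squarefree (∏ i, r i)) {p : ℕ} (hp : p.Prime)
    (hd : p ∣ ∏ i, r i) : ∃ i, p ∣ r i ∧ ∀ j, p ∣ r j → j = i := by
  obtain ⟨i, -, hi⟩ := (Prime.dvd_finsetProd_iff hp.prime _).mp hd
  refine ⟨i, hi, fun j hj => ?_⟩
  by_contra hne
  have h2 : p * p ∣ ∏ i, r i := by
    rw [← Finset.mul_prod_erase univ r (mem_univ i)]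
    exact mul_dvd_mul hi (hj.trans (dvd_prod_of_mem r (mem_erase.mpr ⟨hne, mem_univ j⟩)))
  exact hp.one_lt.ne' (Nat.isUnit_iff.mp (hr p h2))

theorem tupleFactor_eq {r : Fin k → ℕ} {p : ℕ} {i : Fin k} (hi : p ∣ r i)
    (hu : ∀ j, p ∣ r j → j = i) (n : ℕ) : tupleFactor A B r p n = locFactor A B p i n := by
  rw [tupleFactor, prod_eq_single i]
  · rw [if_pos hi]
  · intro j _ hj
    rw [if_neg fun h => hj (hu j h)]
  · intro h; exact absurd (mem_univ i) h

/-- The mean value of `ψ_r ψ_s`. -/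
def pairCoeff (r s : Fin k → ℕ) : ℝ :=
  open scoped Classical in
  if (∏ i, r i).primeFactors = (∏ i, s i).primeFactors then
    ∏ p ∈ (∏ i, r i).primeFactors, if ∃ i, p ∣ r i ∧ p ∣ s i then (p : ℝ) - 1 else -1
  else 0

/-- The product factors over the primes of ∏ r_i and ∏ s_i. A single local factor has mean zero, two
equal ones have mean p - 1, and two with distinct roots have mean -1. -/
theorem abs_sum_tupleChar_mul_sub_le {r s : Fin k → ℕ} (hr : Squarefree (∏ i, r i))
    (hs : Squarefree (∏ i, s i)) {W : ℕ} (hW : 0 < W) (hrW : (∏ i, r i).Coprime W)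
    (hsW : (∏ i, s i).Coprime W)
    (hgood : ∀ p : ℕ, p.Prime → ¬ p ∣ W → GoodPrime A B p) {a b : ℕ} (hab : a ≤ b) (v : ℕ) :
    |∑ n ∈ Ioc a b with n ≡ v [MOD W], tupleChar A B r n * tupleChar A B s n -
        ((b : ℝ) - a) / W * pairCoeff r s| ≤
      (∏ p ∈ (∏ i, r i).primeFactors, (2 * ((p : ℝ) - 1))) *
        ∏ p ∈ (∏ i, s i).primeFactors, (2 * ((p : ℝ) - 1)) := by
  classical
  set S := (∏ i, r i).primeFactors with hS
  set T := (∏ i, s i).primeFactors with hT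
  -- Both products are extended over the union of the two prime sets by factors 1, so that the
  -- equidistribution lemma for distinct primes applies once.
  set f : ℕ → ℕ → ℝ := fun p n =>
    (if p ∈ S then tupleFactor A B r p n else 1) * (if p ∈ T then tupleFactor A B s p n else 1)
    with hf
  have hST : ∀ p ∈ S ∪ T, p.Prime ∧ ¬ p ∣ W := by
    intro p hp
    rcases mem_union.mp hp with h | h
    · have := Nat.mem_primeFactors.mp h
      exact ⟨this.1, fun hd => Nat.not_coprime_of_dvd_of_dvd this.1.one_lt this.2.1 hd hrW⟩
    · have := Nat.mem_primeFactors.mp h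
      exact ⟨this.1, fun hd => Nat.not_coprime_of_dvd_of_dvd this.1.one_lt this.2.1 hd hsW⟩
  have hprod : ∀ n, tupleChar A B r n * tupleChar A B s n = ∏ p ∈ S ∪ T, f p n := by
    intro n
    rw [hf, prod_mul_distrib, prod_ite_mem, prod_ite_mem, union_inter_cancel_left,
      union_inter_cancel_right]
    rfl
  -- local description of `f`
  have hS' : ∀ p ∈ S, ∃ i, p ∣ r i ∧ ∀ j, p ∣ r j → j = i := fun p hp =>
    exists_unique_dvd hr (Nat.prime_of_mem_primeFactors hp) (Nat.dvd_of_mem_primeFactors hp)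
  have hT' : ∀ p ∈ T, ∃ i, p ∣ s i ∧ ∀ j, p ∣ s j → j = i := fun p hp =>
    exists_unique_dvd hs (Nat.prime_of_mem_primeFactors hp) (Nat.dvd_of_mem_primeFactors hp)
  have hper : ∀ p ∈ S ∪ T, p.Prime ∧ ∀ n, f p n = f p (n % p) := by
    intro p hp
    obtain ⟨hpp, hpW⟩ := hST p hp
    refine ⟨hpp, fun n => ?_⟩
    obtain ⟨a, -, -, ha⟩ := (hgood p hpp hpW).exists_roots
    simp only [hf, tupleFactor, ha, Nat.mod_mod]
  have hmain := abs_sum_prod_periodic_sub_le hab f (S ∪ T) hper W hW (fun p hp => (hST p hp).2) v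
  have hloc : ∀ p ∈ S ∪ T,
      (∑ x ∈ range p, f p x) / p =
        (if p ∈ S ∧ p ∈ T then (if ∃ i, p ∣ r i ∧ p ∣ s i then (p : ℝ) - 1 else -1) else 0) ∧
      ∑ x ∈ range p, |f p x| ≤
        (if p ∈ S then 2 * ((p : ℝ) - 1) else 1) * (if p ∈ T then 2 * ((p : ℝ) - 1) else 1) := by
    intro p hp
    obtain ⟨hpp, hpW⟩ := hST p hp
    have hp0 : (p : ℝ) ≠ 0 := by exact_mod_cast hpp.ne_zero
    obtain ⟨c, hc, hinj, hcl⟩ := (hgood p hpp hpW).exists_roots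
    have hmod : ∀ x ∈ range p, ∀ i, locFactor A B p i x = if x = c i then 1 - (p : ℝ) else 1 := by
      intro x hx i
      rw [hcl, Nat.mod_eq_of_lt (mem_range.mp hx)]
    have hsum1 : ∀ i, ∑ x ∈ range p, (if x = c i then 1 - (p : ℝ) else 1) = 0 := by
      intro i
      have : ∀ x : ℕ, (if x = c i then 1 - (p : ℝ) else 1) = 1 + if x = c i then -(p : ℝ) else 0 := by
        intro x; split_ifs <;> ring
      rw [sum_congr rfl fun x _ => this x, sum_range_point (hc i)]
      ring
    by_cases h1 : p ∈ S
    · obtain ⟨i, hi, hiu⟩ := hS' p h1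
      by_cases h2 : p ∈ T
      · obtain ⟨j, hj, hju⟩ := hT' p h2
        have hfx : ∀ x ∈ range p, f p x =
            (if x = c i then 1 - (p : ℝ) else 1) * (if x = c j then 1 - (p : ℝ) else 1) := by
          intro x hx
          simp only [hf, h1, h2, if_true]
          rw [tupleFactor_eq hi hiu, tupleFactor_eq hj hju, hmod x hx, hmod x hx]
        constructor
        · rw [sum_congr rfl hfx, sum_pair_point (hc i) (hc j),
            if_pos (show p ∈ S ∧ p ∈ T from ⟨h1, h2⟩)]
          by_cases hij : i = j
          · subst hij
            rw [if_pos rfl, if_pos ⟨i, hi, hj⟩]; field_simp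
          · rw [if_neg (fun h => hij (hinj h)), if_neg]
            · field_simp
            · rintro ⟨l, hl1, hl2⟩
              exact hij ((hiu l hl1).symm.trans (hju l hl2))
        · rw [sum_congr rfl fun x hx => by rw [hfx x hx], if_pos h1, if_pos h2]
          exact sum_abs_pair_point_le hpp.two_le (hc i) (hc j)
      · have hfx : ∀ x ∈ range p, f p x = (if x = c i then 1 - (p : ℝ) else 1) := by
          intro x hx
          simp only [hf, h1, h2, if_true, if_false, mul_one]
          rw [tupleFactor_eq hi hiu, hmod x hx]
        constructor
        · rw [sum_congr rfl hfx, hsum1, if_neg (fun h => h2 h.2), zero_div]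
        · rw [sum_congr rfl fun x hx => by rw [hfx x hx], if_pos h1, if_neg h2, mul_one]
          exact (sum_abs_point hpp.two_le (hc i)).le
    · have h2 : p ∈ T := (mem_union.mp hp).resolve_left h1
      obtain ⟨j, hj, hju⟩ := hT' p h2
      have hfx : ∀ x ∈ range p, f p x = (if x = c j then 1 - (p : ℝ) else 1) := by
        intro x hx
        simp only [hf, h1, h2, if_true, if_false, one_mul]
        rw [tupleFactor_eq hj hju, hmod x hx]
      constructor
      · rw [sum_congr rfl hfx, hsum1, if_neg (fun h => h1 h.1), zero_div]
      · rw [sum_congr rfl fun x hx => by rw [hfx x hx], if_neg h1, if_pos h2, one_mul]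
        exact (sum_abs_point hpp.two_le (hc j)).le
  have hcoef : ∏ p ∈ S ∪ T, ((∑ x ∈ range p, f p x) / p) = pairCoeff r s := by
    rw [prod_congr rfl fun p hp => (hloc p hp).1, pairCoeff]
    by_cases h : S = T
    · rw [if_pos h, ← h, union_self]
      exact prod_congr rfl fun p hp => by rw [if_pos ⟨hp, hp⟩]
    -- Some prime divides exactly one of the two products, and its mean value 0 kills the whole
    -- product.
    · rw [if_neg h]
      obtain ⟨p, hp, hn⟩ : ∃ p ∈ S ∪ T, ¬ (p ∈ S ∧ p ∈ T) := by
        by_contra hcon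
        push Not at hcon
        exact h (Finset.ext fun p => ⟨fun hp => (hcon p (mem_union_left _ hp)).2,
          fun hp => (hcon p (mem_union_right _ hp)).1⟩)
      exact prod_eq_zero hp (if_neg hn)
  rw [hcoef] at hmain
  simp only [hprod]
  refine hmain.trans ?_
  calc _ ≤ ∏ p ∈ S ∪ T, (if p ∈ S then 2 * ((p : ℝ) - 1) else 1) *
          (if p ∈ T then 2 * ((p : ℝ) - 1) else 1) :=
        prod_le_prod (fun p _ => sum_nonneg fun _ _ => abs_nonneg _) fun p hp => (hloc p hp).2
    _ = _ := by
        rw [prod_mul_distrib, prod_ite_mem, prod_ite_mem, union_inter_cancel_left,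
          union_inter_cancel_right]

end

end MultSieve

/-! ### Diagonalising the Selberg square and bounding its row sums -/

namespace MultSieve
noncomputable section

open Finset

variable {k : ℕ} {A : Fin k → ℕ} {B : Fin k → ℤ} {F : (Fin k → ℝ) → ℝ} {R : ℝ} {W : ℕ}

theorem prod_primeFactors_prod {r : Fin k → ℕ} (hr : ∏ i, r i ≠ 0) (g : ℕ → Fin k → ℝ) :
    ∏ p ∈ (∏ i, r i).primeFactors, ∏ i, (if p ∣ r i then g p i else 1) =
      ∏ i, ∏ p ∈ (r i).primeFactors, g p i := by
  rw [prod_comm]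
  refine prod_congr rfl fun i _ => ?_
  rw [← prod_filter]
  refine prod_congr ?_ fun _ _ => rfl
  ext p
  have hri : r i ≠ 0 := fun h => hr (prod_eq_zero (mem_univ i) h)
  simp only [mem_filter, Nat.mem_primeFactors]
  constructor
  · rintro ⟨⟨h1, -, -⟩, h⟩; exact ⟨h1, h, hri⟩
  · rintro ⟨h1, h, -⟩; exact ⟨⟨h1, h.trans (dvd_prod_of_mem r (mem_univ i)), hr⟩, h⟩

theorem wt_prod {r : Fin k → ℕ} (hr : Squarefree (∏ i, r i)) (b : ℕ → ℝ) :
    wt b (∏ i, r i) = ∏ i, wt b (r i) := by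
  unfold wt
  rw [← prod_primeFactors_prod hr.ne_zero (fun p _ => b p)]
  refine prod_congr rfl fun p hp => ?_
  obtain ⟨i, hi, hu⟩ := exists_unique_dvd hr (Nat.prime_of_mem_primeFactors hp)
    (Nat.dvd_of_mem_primeFactors hp)
  rw [prod_eq_single i]
  · rw [if_pos hi]
  · intro j _ hj
    rw [if_neg fun h => hj (hu j h)]
  · intro h; exact absurd (mem_univ i) h

/-- The summation runs over the divisors of gcd(m, l), so the sum is ∏ (1 - p) over the primes of
that gcd. -/
theorem sum_moebius_mul_dvd {m : ℕ} (hm : Squarefree m) {n : ℕ} (hmn : m ≤ n) (l : ℤ) :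
    ∑ d ∈ (Icc 1 n).filter (fun d : ℕ => (d : ℤ) ∣ l ∧ d ∣ m), (ArithmeticFunction.moebius d : ℝ) * d =
      ∏ p ∈ m.primeFactors, if (p : ℤ) ∣ l then 1 - (p : ℝ) else 1 := by
  have hm0 := hm.ne_zero
  set g := m.gcd l.natAbs with hg
  have hg0 : g ≠ 0 := by simp [hg, hm0]
  have hgs : Squarefree g := hm.squarefree_of_dvd (Nat.gcd_dvd_left _ _)
  have h := ArithmeticFunction.IsMultiplicative.prodPrimeFactors_one_sub_of_squarefree
    (R := ℝ) (f := ((ArithmeticFunction.id : ArithmeticFunction ℕ) : ArithmeticFunction ℝ))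
    (ArithmeticFunction.IsMultiplicative.natCast ArithmeticFunction.isMultiplicative_id) hgs
  simp only [ArithmeticFunction.natCoe_apply, ArithmeticFunction.id_apply] at h
  rw [← prod_filter]
  have e1 : m.primeFactors.filter (fun p : ℕ => (p : ℤ) ∣ l) = g.primeFactors := by
    ext p
    simp only [mem_filter, Nat.mem_primeFactors, hg, Nat.dvd_gcd_iff, Int.natCast_dvd]
    constructor
    · rintro ⟨⟨h1, h2, h3⟩, h4⟩; exact ⟨h1, ⟨h2, h4⟩, hg0⟩
    · rintro ⟨h1, ⟨h2, h4⟩, -⟩; exact ⟨⟨h1, h2, hm0⟩, h4⟩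
  have e2 : (Icc 1 n).filter (fun d : ℕ => (d : ℤ) ∣ l ∧ d ∣ m) = g.divisors := by
    ext d
    simp only [mem_filter, Nat.mem_divisors, hg, Nat.dvd_gcd_iff, Int.natCast_dvd, mem_Icc]
    constructor
    · rintro ⟨-, h1, h2⟩; exact ⟨⟨h2, h1⟩, hg0⟩
    · rintro ⟨⟨h2, h1⟩, -⟩
      exact ⟨⟨Nat.pos_of_dvd_of_pos h2 (Nat.pos_of_ne_zero hm0),
        (Nat.le_of_dvd (Nat.pos_of_ne_zero hm0) h2).trans hmn⟩, h1, h2⟩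
  rw [e1, e2, h]

theorem squarefree_of_prod {r : Fin k → ℕ} (hr : Squarefree (∏ i, r i)) (i : Fin k) :
    Squarefree (r i) := hr.squarefree_of_dvd (dvd_prod_of_mem r (mem_univ i))

/-- The sum factors over components; the truncation to the box is harmless because d_i ∣ r_i already
forces d_i ≤ R. -/
theorem sum_box_moebius_eq {r : Fin k → ℕ} (hr : Squarefree (∏ i, r i)) (hbox : r ∈ box k R)
    (n : ℕ) :
    ∑ d ∈ box k R with ((∀ i, (d i : ℤ) ∣ linForm A B i n) ∧ ∀ i, d i ∣ r i),
      ∏ i, (ArithmeticFunction.moebius (d i) : ℝ) * (d i : ℝ) = tupleChar A B r n := by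
  have e : (box k R).filter (fun d => (∀ i, (d i : ℤ) ∣ linForm A B i n) ∧ ∀ i, d i ∣ r i) =
      Fintype.piFinset fun i => (Icc 1 ⌊R⌋₊).filter
        (fun d : ℕ => (d : ℤ) ∣ linForm A B i n ∧ d ∣ r i) := by
    ext d
    simp only [box, mem_filter, Fintype.mem_piFinset, forall_and]
  rw [box, Fintype.mem_piFinset] at hbox
  rw [e, ← prod_univ_sum (fun i => (Icc 1 ⌊R⌋₊).filter
        (fun d : ℕ => (d : ℤ) ∣ linForm A B i n ∧ d ∣ r i))
        (fun _ d => (ArithmeticFunction.moebius d : ℝ) * (d : ℝ))]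
  unfold tupleChar tupleFactor locFactor
  rw [prod_primeFactors_prod hr.ne_zero
    (fun p i => if (p : ℤ) ∣ linForm A B i n then 1 - (p : ℝ) else 1)]
  exact prod_congr rfl fun i _ =>
    sum_moebius_mul_dvd (squarefree_of_prod hr i) (mem_Icc.mp (hbox i)).2 _

theorem weightY_ne_zero {r : Fin k → ℕ} (h : weightY F R W r ≠ 0) :
    Squarefree (∏ i, r i) ∧ Nat.Coprime (∏ i, r i) W ∧
      (∀ j, ((∏ i ∈ univ.erase j, r i : ℕ) : ℝ) < R) ∧
      weightY F R W r = F (fun i => Real.log (r i) / Real.log R) := by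
  unfold weightY at h ⊢
  split_ifs at h ⊢ with hc
  · exact ⟨hc.1, hc.2.1, hc.2.2, rfl⟩
  · exact absurd rfl h

/-- Exchanging d and r undoes the change of variables from y to λ: the inner Möbius sum over d is
the character ψ_r. -/
theorem sum_lam_eq (n : ℕ) :
    ∑ d ∈ box k R with (∀ i, (d i : ℤ) ∣ linForm A B i n), lam F R W d =
      ∑ r ∈ box k R, weightY F R W r / (∏ i, (Nat.totient (r i) : ℝ)) * tupleChar A B r n := by
  have e : ∀ d : Fin k → ℕ, lam F R W d = ∑ r ∈ box k R, if ∀ i, d i ∣ r i then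
      (∏ i, (ArithmeticFunction.moebius (d i) : ℝ) * (d i : ℝ)) *
        (weightY F R W r / ∏ i, (Nat.totient (r i) : ℝ)) else 0 := by
    intro d
    rw [lam, mul_sum, sum_filter]
  simp only [e]
  rw [sum_comm]
  refine sum_congr rfl fun r hr => ?_
  rw [← sum_filter, filter_filter, ← sum_mul, mul_comm]
  by_cases h : weightY F R W r = 0
  · simp [h]
  · rw [sum_box_moebius_eq (weightY_ne_zero h).1 hr]

/-- The tuples carrying a nonzero weight. -/
def suppY (F : (Fin k → ℝ) → ℝ) (R : ℝ) (W : ℕ) : Finset (Fin k → ℕ) :=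
  open scoped Classical in (box k R).filter fun r => weightY F R W r ≠ 0

theorem mem_suppY {r : Fin k → ℕ} : r ∈ suppY F R W ↔ r ∈ box k R ∧ weightY F R W r ≠ 0 := by
  classical
  simp [suppY]

theorem suppY_subset : suppY F R W ⊆ Fintype.piFinset fun _ : Fin k => sfc W R := by
  intro r hr
  obtain ⟨hb, hne⟩ := mem_suppY.mp hr
  obtain ⟨hs, hc, -, -⟩ := weightY_ne_zero hne
  rw [box, Fintype.mem_piFinset] at hb
  rw [Fintype.mem_piFinset]
  exact fun i => mem_sfc.mpr ⟨mem_Icc.mp (hb i), squarefree_of_prod hs i,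
    hc.coprime_dvd_left (dvd_prod_of_mem r (mem_univ i))⟩

theorem sum_box_eq_sum_suppY (f : (Fin k → ℕ) → ℝ) (hf : ∀ r, weightY F R W r = 0 → f r = 0) :
    ∑ r ∈ box k R, f r = ∑ r ∈ suppY F R W, f r := by
  classical
  rw [suppY, sum_filter]
  refine sum_congr rfl fun r _ => ?_
  split_ifs with h
  · rfl
  · exact hf r (not_not.mp h)

theorem prod_totient_eq {r : Fin k → ℕ} (hr : Squarefree (∏ i, r i)) :
    ∏ i, (Nat.totient (r i) : ℝ) = ∏ p ∈ (∏ i, r i).primeFactors, ((p : ℝ) - 1) := by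
  have := wt_prod hr (fun p => (p : ℝ) - 1)
  unfold wt at this
  rw [this]
  exact prod_congr rfl fun i _ => totient_eq_prod_of_squarefree (squarefree_of_prod hr i)

theorem prod_primeFactors_sub_one_pos (m : ℕ) : 0 < ∏ p ∈ m.primeFactors, ((p : ℝ) - 1) :=
  prod_pos fun p hp => by linarith [one_lt_cast_prime (Nat.prime_of_mem_primeFactors hp)]

/-- The expansion of the sum of `Λ²` over a residue class into mean values. -/
theorem abs_sum_LambdaSelSq_sub_le (hW : 0 < W)
    (hgood : ∀ p : ℕ, p.Prime → ¬ p ∣ W → GoodPrime A B p) {a b : ℕ} (hab : a ≤ b) (v : ℕ) :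
    |∑ n ∈ Ioc a b with n ≡ v [MOD W], LambdaSelSq A B F R W (n : ℤ) -
        ((b : ℝ) - a) / W * ∑ r ∈ suppY F R W, ∑ s ∈ suppY F R W,
          (weightY F R W r / ∏ i, (Nat.totient (r i) : ℝ)) *
            (weightY F R W s / ∏ i, (Nat.totient (s i) : ℝ)) * pairCoeff r s| ≤
      (∑ r ∈ suppY F R W, |weightY F R W r| * wt (fun _ => 2) (∏ i, r i)) ^ 2 := by
  set c : (Fin k → ℕ) → ℝ := fun r => weightY F R W r / ∏ i, (Nat.totient (r i) : ℝ) with hc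
  have hL : ∀ n : ℕ, LambdaSelSq A B F R W (n : ℤ) =
      ∑ r ∈ suppY F R W, ∑ s ∈ suppY F R W,
        c r * c s * (tupleChar A B r n * tupleChar A B s n) := by
    intro n
    rw [LambdaSelSq, sum_lam_eq, sum_box_eq_sum_suppY (F := F) (W := W) _ (fun r hr => by simp [hr]), sq, sum_mul_sum]
    refine sum_congr rfl fun r _ => sum_congr rfl fun s _ => ?_
    simp only [hc]; ring
  simp only [hL]
  rw [sum_comm, mul_sum, ← sum_sub_distrib, sq, sum_mul_sum]
  refine (abs_sum_le_sum_abs _ _).trans (sum_le_sum fun r hr => ?_)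
  rw [sum_comm, mul_sum, ← sum_sub_distrib]
  refine (abs_sum_le_sum_abs _ _).trans (sum_le_sum fun s hs => ?_)
  obtain ⟨hrs, hrc, -, -⟩ := weightY_ne_zero (mem_suppY.mp hr).2
  obtain ⟨hss, hsc, -, -⟩ := weightY_ne_zero (mem_suppY.mp hs).2
  have key := abs_sum_tupleChar_mul_sub_le hrs hss hW hrc hsc hgood hab v
  -- The totients in the coefficient cancel the factors p - 1 of the L¹ bound, so only 2 to the
  -- number of primes survives.
  have ha : ∀ r : Fin k → ℕ, Squarefree (∏ i, r i) →
      |c r| * ∏ p ∈ (∏ i, r i).primeFactors, (2 * ((p : ℝ) - 1)) =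
        |weightY F R W r| * wt (fun _ => 2) (∏ i, r i) := by
    intro r hr
    have hpos := prod_primeFactors_sub_one_pos (∏ i, r i)
    simp only [hc]
    rw [prod_totient_eq hr, abs_div, abs_of_pos hpos, prod_mul_distrib, wt]
    field_simp
  rw [← mul_sum, show c r * c s * ∑ n ∈ Ioc a b with n ≡ v [MOD W],
      tupleChar A B r n * tupleChar A B s n - ((b : ℝ) - a) / W * (c r * c s * pairCoeff r s) =
      c r * c s * (∑ n ∈ Ioc a b with n ≡ v [MOD W],
      tupleChar A B r n * tupleChar A B s n - ((b : ℝ) - a) / W * pairCoeff r s) by ring,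
    abs_mul, abs_mul, ← ha r hrs, ← ha s hss]
  calc _ ≤ |c r| * |c s| * _ := mul_le_mul_of_nonneg_left key (by positivity)
    _ = _ := by ring

theorem pairCoeff_self {r : Fin k → ℕ} (hr : Squarefree (∏ i, r i)) :
    pairCoeff r r = ∏ i, (Nat.totient (r i) : ℝ) := by
  rw [pairCoeff, if_pos rfl, prod_totient_eq hr]
  refine prod_congr rfl fun p hp => ?_
  obtain ⟨i, hi, -⟩ := exists_unique_dvd hr (Nat.prime_of_mem_primeFactors hp)
    (Nat.dvd_of_mem_primeFactors hp)
  rw [if_pos ⟨i, hi, hi⟩]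

/-- Row sums of the matrix of mean values. -/
theorem sum_abs_pairCoeff_le (hk : 0 < k) {r : Fin k → ℕ} (hr : Squarefree (∏ i, r i))
    (Y : Finset (Fin k → ℕ)) (hY : ∀ s ∈ Y, Squarefree (∏ i, s i)) :
    ∑ s ∈ Y, |pairCoeff r s| ≤
      ∏ p ∈ (∏ i, r i).primeFactors, (((p : ℝ) - 1) + ((k : ℝ) - 1)) := by
  classical
  set S := (∏ i, r i).primeFactors with hS
  set h : ℕ → Fin k → ℝ := fun p j => if p ∣ r j then (p : ℝ) - 1 else 1 with hh
  set Y' := Y.filter (fun s => (∏ i, s i).primeFactors = S) with hY'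
  have hne : Nonempty (Fin k) := ⟨⟨0, hk⟩⟩
  -- A tuple s with prime set S is encoded by the colouring that sends each prime to the component
  -- it divides; outside Y' the colour is an arbitrary default, which is where k > 0 enters.
  have hex : ∀ (s : Fin k → ℕ) (p : S), ∃ i, s ∈ Y' → ((p : ℕ) ∣ s i ∧ ∀ j, (p : ℕ) ∣ s j → j = i) := by
    intro s p
    by_cases hs : s ∈ Y'
    · rw [hY', mem_filter] at hs
      have hp : (p : ℕ) ∈ (∏ i, s i).primeFactors := hs.2.symm ▸ p.2
      obtain ⟨i, hi⟩ := exists_unique_dvd (hY s hs.1) (Nat.prime_of_mem_primeFactors hp)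
        (Nat.dvd_of_mem_primeFactors hp)
      exact ⟨i, fun _ => hi⟩
    · exact ⟨Classical.choice hne, fun h => absurd h hs⟩
  choose col hcol using hex
  have hp1 : ∀ p : S, (1 : ℝ) < (p : ℕ) := fun p =>
    one_lt_cast_prime (Nat.prime_of_mem_primeFactors p.2)
  have hh0 : ∀ (p : S) j, 0 ≤ h p j := by
    intro p j
    simp only [hh]
    split_ifs <;> linarith [hp1 p]
  have habs : ∀ s ∈ Y', |pairCoeff r s| = ∏ p : S, h p (col s p) := by
    intro s hs
    have hs2 := (mem_filter.mp hs).2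
    rw [pairCoeff, if_pos hs2.symm, abs_prod, ← hS, ← prod_coe_sort]
    refine prod_congr rfl fun p _ => ?_
    obtain ⟨h1, h2⟩ := hcol s p hs
    simp only [hh]
    by_cases hd : (p : ℕ) ∣ r (col s p)
    · rw [if_pos hd, if_pos ⟨_, hd, h1⟩, abs_of_pos (by linarith [hp1 p])]
    · rw [if_neg hd, if_neg, abs_neg, abs_one]
      rintro ⟨i, hi1, hi2⟩
      rw [h2 i hi2] at hi1
      exact hd hi1
  have hinj : Set.InjOn col (Y' : Set (Fin k → ℕ)) := by
    intro s hs t ht hst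
    have hs' := mem_filter.mp hs
    have ht' := mem_filter.mp ht
    funext i
    have hsi := squarefree_of_prod (hY s hs'.1) i
    have hti := squarefree_of_prod (hY t ht'.1) i
    rw [← Nat.prod_primeFactors_of_squarefree hsi, ← Nat.prod_primeFactors_of_squarefree hti]
    refine prod_congr ?_ fun _ _ => rfl
    have aux : ∀ u ∈ Y', ∀ p, p ∈ (u i).primeFactors ↔ ∃ hp : p ∈ S, col u ⟨p, hp⟩ = i := by
      intro u hu p
      have hu' := mem_filter.mp hu
      have hui := squarefree_of_prod (hY u hu'.1) i
      constructor
      · intro hp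
        have hpS : p ∈ S := by
          rw [← hu'.2]
          exact Nat.primeFactors_mono (dvd_prod_of_mem u (mem_univ i)) (hY u hu'.1).ne_zero hp
        exact ⟨hpS, ((hcol u ⟨p, hpS⟩ hu).2 i (Nat.dvd_of_mem_primeFactors hp)).symm⟩
      · rintro ⟨hp, rfl⟩
        exact Nat.mem_primeFactors.mpr ⟨Nat.prime_of_mem_primeFactors hp,
          (hcol u ⟨p, hp⟩ hu).1, hui.ne_zero⟩
    ext p
    rw [aux s hs, aux t ht, hst]
  -- The component of r containing p contributes p - 1, each of the other k - 1 contributes 1.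
  have hrow : ∀ p ∈ S, ∑ j, h p j = ((p : ℝ) - 1) + ((k : ℝ) - 1) := by
    intro p hp
    obtain ⟨i, hi, hu⟩ := exists_unique_dvd hr (Nat.prime_of_mem_primeFactors hp)
      (Nat.dvd_of_mem_primeFactors hp)
    have : ∀ j, h p j = 1 + if j = i then (p : ℝ) - 2 else 0 := by
      intro j
      simp only [hh]
      by_cases hj : j = i
      · subst hj; rw [if_pos hi, if_pos rfl]; ring
      · rw [if_neg (fun h => hj (hu j h)), if_neg hj, add_zero]
    rw [sum_congr rfl fun j _ => this j, sum_add_distrib, Finset.sum_ite_eq' , if_pos (mem_univ i)]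
    simp
    ring
  have hzero : ∑ s ∈ Y, |pairCoeff r s| = ∑ s ∈ Y', |pairCoeff r s| := by
    rw [hY', sum_filter]
    refine sum_congr rfl fun s _ => ?_
    split_ifs with hs
    · rfl
    · rw [pairCoeff, if_neg (fun h => hs h.symm), abs_zero]
  rw [hzero, sum_congr rfl habs]
  -- The encoding is injective and the terms are nonnegative, so the sum may be extended to all
  -- colourings, where it factors over primes.
  calc _ = ∑ g ∈ Y'.image col, ∏ p : S, h p (g p) := (sum_image (f := fun g : S → Fin k => ∏ p : S, h p (g p)) hinj).symm
    _ ≤ ∑ g ∈ Fintype.piFinset (fun _ : S => (univ : Finset (Fin k))), ∏ p : S, h p (g p) := by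
        refine sum_le_sum_of_subset_of_nonneg (fun g _ => by simp) fun g _ _ =>
          prod_nonneg fun p _ => hh0 p _
    _ = ∏ p : S, ∑ j, h p j := (prod_univ_sum _ _).symm
    _ = ∏ p ∈ S, ∑ j, h p j := prod_coe_sort S (fun p => ∑ j, h p j)
    _ = _ := prod_congr rfl hrow

end

end MultSieve

/-! ### Off-diagonal terms, the remainder, and masses of exceptional tuples -/

namespace MultSieve
noncomputable section

open Finset

variable {k : ℕ} {A : Fin k → ℕ} {B : Fin k → ℤ} {F : (Fin k → ℝ) → ℝ} {R : ℝ} {W : ℕ} {z : ℝ}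

/-- `∑_{u ≤ R} μ²(u)/φ(u) ∏_{p ∣ u} (1 + (k-1)/(p-1))` over `u` coprime to `W`. -/
def twistSum (k : ℕ) (W : ℕ) (R : ℝ) : ℝ :=
  ∑ u ∈ sfc W R, wt (fun p => 1 / ((p : ℝ) - 1) * (1 + ((k : ℝ) - 1) / ((p : ℝ) - 1))) u

theorem sum_prod_sfc (b : ℕ → ℝ) :
    ∑ r ∈ Fintype.piFinset (fun _ : Fin k => sfc W R), ∏ i, wt b (r i) =
      (∑ u ∈ sfc W R, wt b u) ^ k := by
  rw [sum_prod_piFinset (sfc W R) (fun _ u => wt b u), prod_const, card_univ, Fintype.card_fin]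

/-- A nonzero coefficient forces s to have the same totient product Φ as r. The off-diagonal part of
a row is thus at most M²/Φ² times (absolute row sum minus Φ), a difference of two multiplicative
weights. -/
theorem abs_quadForm_sub_diag_le (hk : 0 < k) {M : ℝ}
    (hM : ∀ r ∈ suppY F R W, |weightY F R W r| ≤ M) :
    |∑ r ∈ suppY F R W, ∑ s ∈ suppY F R W,
          (weightY F R W r / ∏ i, (Nat.totient (r i) : ℝ)) *
            (weightY F R W s / ∏ i, (Nat.totient (s i) : ℝ)) * pairCoeff r s -
        ∑ r ∈ suppY F R W, weightY F R W r ^ 2 / ∏ i, (Nat.totient (r i) : ℝ)| ≤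
      M ^ 2 * (twistSum k W R ^ k - totSum W R ^ k) := by
  classical
  have hk1 : (0 : ℝ) ≤ (k : ℝ) - 1 := by
    have : (1 : ℝ) ≤ k := by exact_mod_cast hk
    linarith
  set g₀ : ℕ → ℝ := fun p => 1 / ((p : ℝ) - 1) with hg0
  set g : ℕ → ℝ := fun p => 1 / ((p : ℝ) - 1) * (1 + ((k : ℝ) - 1) / ((p : ℝ) - 1)) with hg
  have hg0p : ∀ p : ℕ, p.Prime → 0 ≤ g₀ p := fun p hp => by
    have := one_lt_cast_prime hp
    exact (one_div_pos.mpr (by linarith)).le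
  have hgg : ∀ p : ℕ, p.Prime → g₀ p ≤ g p := fun p hp => by
    have := one_lt_cast_prime hp
    refine le_mul_of_one_le_right (hg0p p hp) ?_
    have : 0 ≤ ((k : ℝ) - 1) / ((p : ℝ) - 1) := div_nonneg hk1 (by linarith)
    linarith
  have hwt : ∀ u, wt g₀ u ≤ wt g u := fun u => prod_le_prod
    (fun p hp => hg0p p (Nat.prime_of_mem_primeFactors hp))
    (fun p hp => hgg p (Nat.prime_of_mem_primeFactors hp))
  rw [← sum_sub_distrib]
  have hrow : ∀ r ∈ suppY F R W,
      |∑ s ∈ suppY F R W, (weightY F R W r / ∏ i, (Nat.totient (r i) : ℝ)) *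
          (weightY F R W s / ∏ i, (Nat.totient (s i) : ℝ)) * pairCoeff r s -
        weightY F R W r ^ 2 / ∏ i, (Nat.totient (r i) : ℝ)| ≤
      M ^ 2 * (∏ i, wt g (r i) - ∏ i, wt g₀ (r i)) := by
    intro r hr
    obtain ⟨hrs, -, -, -⟩ := weightY_ne_zero (mem_suppY.mp hr).2
    set Φ := ∏ p ∈ (∏ i, r i).primeFactors, ((p : ℝ) - 1) with hΦ
    have hΦ0 : 0 < Φ := prod_primeFactors_sub_one_pos _
    have hΦr : ∏ i, (Nat.totient (r i) : ℝ) = Φ := prod_totient_eq hrs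
    rw [← add_sum_erase _ _ hr, pairCoeff_self hrs, hΦr]
    have e : weightY F R W r / Φ * (weightY F R W r / Φ) * Φ = weightY F R W r ^ 2 / Φ := by
      field_simp
    rw [e, add_sub_cancel_left]
    have hM0 : 0 ≤ M := (abs_nonneg _).trans (hM r hr)
    have hterm : ∀ s ∈ (suppY F R W).erase r,
        |weightY F R W r / Φ * (weightY F R W s / ∏ i, (Nat.totient (s i) : ℝ)) * pairCoeff r s| ≤
          M ^ 2 / Φ ^ 2 * |pairCoeff r s| := by
      intro s hs
      have hs' := (mem_erase.mp hs).2
      obtain ⟨hss, -, -, -⟩ := weightY_ne_zero (mem_suppY.mp hs').2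
      by_cases hpf : (∏ i, r i).primeFactors = (∏ i, s i).primeFactors
      · rw [prod_totient_eq hss, ← hpf, ← hΦ, abs_mul]
        refine mul_le_mul_of_nonneg_right ?_ (abs_nonneg _)
        rw [div_mul_div_comm, abs_div, abs_mul, sq, sq, abs_of_pos (mul_pos hΦ0 hΦ0)]
        gcongr
        · exact hM r hr
        · exact hM s hs'
      · have : pairCoeff r s = 0 := by rw [pairCoeff, if_neg hpf]
        simp [this]
    have hrs2 := sum_abs_pairCoeff_le hk hrs (suppY F R W)
      (fun s hs => (weightY_ne_zero (mem_suppY.mp hs).2).1)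
    rw [← add_sum_erase _ _ hr, pairCoeff_self hrs, hΦr, abs_of_pos hΦ0] at hrs2
    refine (abs_sum_le_sum_abs _ _).trans ((sum_le_sum hterm).trans ?_)
    rw [← mul_sum, ← wt_prod hrs, ← wt_prod hrs]
    have e1 : wt g₀ (∏ i, r i) = Φ / Φ ^ 2 := by
      rw [wt, hg0, prod_div_distrib, prod_const_one, ← hΦ]
      field_simp
    have e2 : wt g (∏ i, r i) =
        (∏ p ∈ (∏ i, r i).primeFactors, (((p : ℝ) - 1) + ((k : ℝ) - 1))) / Φ ^ 2 := by
      rw [wt, hΦ, ← prod_pow, ← prod_div_distrib]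
      refine prod_congr rfl fun p hp => ?_
      have := one_lt_cast_prime (Nat.prime_of_mem_primeFactors hp)
      have : (p : ℝ) - 1 ≠ 0 := by linarith
      simp only [hg]
      field_simp
    rw [e1, e2, ← sub_div, mul_div_assoc', div_mul_eq_mul_div]
    gcongr
    linarith
  refine (abs_sum_le_sum_abs _ _).trans ((sum_le_sum hrow).trans ?_)
  rw [← mul_sum]
  refine mul_le_mul_of_nonneg_left ?_ (sq_nonneg _)
  -- The differences are nonnegative, so the condition defining the support can be dropped; over all
  -- tuples both sums are k-th powers.
  calc _ ≤ ∑ r ∈ Fintype.piFinset (fun _ : Fin k => sfc W R),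
          (∏ i, wt g (r i) - ∏ i, wt g₀ (r i)) :=
        sum_le_sum_of_subset_of_nonneg suppY_subset fun r _ _ => sub_nonneg.mpr
          (prod_le_prod (fun i _ => wt_nonneg hg0p _) fun i _ => hwt _)
    _ = _ := by
        rw [sum_sub_distrib, sum_prod_sfc, sum_prod_sfc, twistSum, totSum_eq]

theorem one_add_pow_sub_one_le {y c : ℝ} (hy : 0 ≤ y) (hyc : y ≤ c) (k : ℕ) :
    (1 + y) ^ k - 1 ≤ y * (k * Real.exp (k * c)) := by
  have h1 : (1 + y) ^ k ≤ Real.exp (k * y) := by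
    rw [Real.exp_nat_mul]
    exact pow_le_pow_left₀ (by linarith) (by rw [add_comm]; exact Real.add_one_le_exp y) k
  have h2 := exp_sub_one_le (k * y)
  have h3 : Real.exp (k * y) ≤ Real.exp (k * c) := Real.exp_le_exp.mpr (by gcongr)
  have h4 : k * y * Real.exp (k * y) ≤ k * y * Real.exp (k * c) :=
    mul_le_mul_of_nonneg_left h3 (by positivity)
  linarith

/-- Constant in the bound for the off-diagonal terms. -/
def offConst (k : ℕ) : ℝ :=
  4 * ((k : ℝ) - 1) * Real.exp (4 * ((k : ℝ) - 1)) *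
    (k * Real.exp (k * (4 * ((k : ℝ) - 1) * Real.exp (4 * ((k : ℝ) - 1)))))

theorem offConst_nonneg (hk : 0 < k) : 0 ≤ offConst k := by
  have : (1 : ℝ) ≤ k := by exact_mod_cast hk
  have : (0 : ℝ) ≤ k - 1 := by linarith
  unfold offConst
  positivity

theorem Rough.twistSum_pow_sub_le (h : Rough W z) (hk : 0 < k) :
    twistSum k W R ^ k - totSum W R ^ k ≤ offConst k / z * totSum W R ^ k := by
  have hz := h.one_lt
  have hk1 : (0 : ℝ) ≤ (k : ℝ) - 1 := by
    have : (1 : ℝ) ≤ k := by exact_mod_cast hk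
    linarith
  set c := 4 * ((k : ℝ) - 1) * Real.exp (4 * ((k : ℝ) - 1)) with hc
  have hc0 : 0 ≤ c := by positivity
  have h1 : twistSum k W R ≤ (1 + c / z) * totSum W R := h.sum_twist_le hk1
  have h0 : 0 ≤ twistSum k W R := sum_nonneg fun u _ => wt_nonneg (fun p hp => by
    have : 0 < (p : ℝ) - 1 := by linarith [one_lt_cast_prime hp]
    positivity) u
  have h2 := pow_le_pow_left₀ h0 h1 k
  rw [mul_pow] at h2
  have h3 := one_add_pow_sub_one_le (div_nonneg hc0 (by linarith : (0 : ℝ) ≤ z))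
    (div_le_self hc0 hz.le) k
  have hT : 0 ≤ totSum W R ^ k := pow_nonneg totSum_nonneg k
  have h4 := mul_le_mul_of_nonneg_right h3 hT
  have h5 : c / z * (k * Real.exp (k * c)) = offConst k / z := by
    rw [offConst]; ring
  rw [h5] at h4
  linarith

/-- Rankin bound for the number of supported tuples, weighted by `2^ω`. -/
theorem sum_suppY_two_pow_le {X κ : ℝ} (hX : 0 ≤ X) (hκ : 0 < κ)
    (hprod : ∀ r ∈ suppY F R W, ((∏ i, r i : ℕ) : ℝ) ≤ X) :
    ∑ r ∈ suppY F R W, wt (fun _ => 2) (∏ i, r i) ≤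
      X ^ (1 + κ) * Real.exp (2 * ∑' n : ℕ, 1 / (n : ℝ) ^ (1 + κ)) ^ k := by
  have hsum : Summable fun n : ℕ => 1 / (n : ℝ) ^ (1 + κ) :=
    Real.summable_one_div_nat_rpow.mpr (by linarith)
  set b : ℕ → ℝ := fun p => 2 * (1 / (p : ℝ) ^ (1 + κ)) with hb
  have hb0 : ∀ p : ℕ, p.Prime → 0 ≤ b p := fun p _ => by positivity
  have hterm : ∀ r ∈ suppY F R W, wt (fun _ => 2) (∏ i, r i) ≤ X ^ (1 + κ) * ∏ i, wt b (r i) := by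
    intro r hr
    obtain ⟨hrs, -, -, -⟩ := weightY_ne_zero (mem_suppY.mp hr).2
    rw [← wt_prod hrs, wt, wt, hb, prod_mul_distrib, prod_div_distrib, prod_const_one,
      Real.finsetProd_rpow _ _ (fun _ _ => by positivity)]
    have e : ∏ p ∈ (∏ i, r i).primeFactors, (p : ℝ) = ((∏ i, r i : ℕ) : ℝ) := by
      rw [← Nat.cast_prod, Nat.prod_primeFactors_of_squarefree hrs]
    rw [e]
    set m : ℝ := ((∏ i, r i : ℕ) : ℝ) with hm
    have hm0 : 0 < m := by
      rw [hm]; exact_mod_cast Nat.pos_of_ne_zero hrs.ne_zero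
    have h1 : m ^ (1 + κ) ≤ X ^ (1 + κ) := Real.rpow_le_rpow hm0.le (hprod r hr) (by linarith)
    have h2 : 0 < m ^ (1 + κ) := Real.rpow_pos_of_pos hm0 _
    have h3 : (0 : ℝ) ≤ ∏ p ∈ (∏ i, r i).primeFactors, 2 := prod_nonneg fun _ _ => by norm_num
    -- Rankin's trick: a factor (X/m)^(1+κ) ≥ 1 is inserted. The exponent exceeds 1 so that the
    -- resulting Euler product is bounded independently of R and W.
    calc _ = (∏ p ∈ (∏ i, r i).primeFactors, (2 : ℝ)) * 1 := (mul_one _).symm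
      _ ≤ (∏ p ∈ (∏ i, r i).primeFactors, (2 : ℝ)) * (X ^ (1 + κ) / m ^ (1 + κ)) :=
          mul_le_mul_of_nonneg_left ((one_le_div h2).mpr h1) h3
      _ = _ := by ring
  refine (sum_le_sum hterm).trans ?_
  rw [← mul_sum]
  refine mul_le_mul_of_nonneg_left ?_ (Real.rpow_nonneg hX _)
  calc _ ≤ ∑ r ∈ Fintype.piFinset (fun _ : Fin k => sfc W R), ∏ i, wt b (r i) :=
        sum_le_sum_of_subset_of_nonneg suppY_subset fun r _ _ =>
          prod_nonneg fun i _ => wt_nonneg hb0 _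
    _ = (∑ u ∈ sfc W R, wt b u) ^ k := sum_prod_sfc b
    _ ≤ _ := by
        refine pow_le_pow_left₀ (sum_nonneg fun u _ => wt_nonneg hb0 u) ?_ k
        calc _ ≤ ∏ p ∈ primesOff W R, (1 + b p) := sum_wt_le_prod hb0
          _ ≤ ∏ p ∈ primesOff W R, Real.exp (b p) := prod_le_prod
              (fun p _ => by simp only [hb]; positivity)
              fun p _ => by rw [add_comm]; exact Real.add_one_le_exp _
          _ = Real.exp (∑ p ∈ primesOff W R, b p) := (Real.exp_sum _ _).symm
          _ ≤ _ := by
              rw [← mul_sum]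
              gcongr
              exact hsum.sum_le_tsum _ fun n _ => by positivity

/-- A point is an interval of length zero. -/
theorem NearUniform.atom {ι : Type*} {S : Finset ι} {w x : ι → ℝ} {ε : ℝ}
    (h : NearUniform S w x ε) (c : ℝ) : ∑ u ∈ S with x u = c, w u ≤ 2 * ε := by
  by_cases hc : c ∈ Set.Icc (0 : ℝ) 1
  · have := h.interval (J := {c}) Set.ordConnected_singleton (Set.singleton_subset_iff.mpr hc)
    simp only [Set.mem_singleton_iff] at this
    have h2 := (abs_le.mp this).2
    simpa [MeasureTheory.measureReal_def] using h2
  · rw [filter_false_of_mem, sum_empty]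
    · have := h.eps_nonneg; positivity
    · rintro u hu rfl
      exact hc (h.mem u hu)

theorem sum_piFinset_pin {ι : Type*} (S : Finset ι) (w : ι → ℝ) (P : ι → Prop) [DecidablePred P]
    (i₀ : Fin k) :
    ∑ u ∈ Fintype.piFinset (fun _ : Fin k => S) with P (u i₀), ∏ i, w (u i) =
      (∑ a ∈ S with P a, w a) * (∑ a ∈ S, w a) ^ (k - 1) := by
  have : ∀ u : Fin k → ι, (if P (u i₀) then ∏ i, w (u i) else 0) =
      ∏ i, (if i = i₀ then (if P (u i) then w (u i) else 0) else w (u i)) := by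
    intro u
    rw [← mul_prod_erase univ _ (mem_univ i₀), ← mul_prod_erase univ _ (mem_univ i₀), if_pos rfl]
    rw [prod_congr rfl fun i hi => if_neg (ne_of_mem_erase hi)]
    split_ifs <;> simp
  rw [sum_filter, sum_congr rfl fun u _ => this u,
    sum_prod_piFinset S (fun i a => if i = i₀ then (if P a then w a else 0) else w a),
    ← mul_prod_erase univ _ (mem_univ i₀), sum_filter]
  simp only [if_true]
  congr 1
  rw [prod_congr rfl fun i hi => sum_congr rfl fun a _ => if_neg (ne_of_mem_erase hi), prod_const,
    card_erase_of_mem (mem_univ _), card_univ, Fintype.card_fin]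

theorem sum_piFinset_pin_two {ι : Type*} (S : Finset ι) (w : ι → ℝ) (P : ι → Prop)
    [DecidablePred P] {i₀ j₀ : Fin k} (hij : i₀ ≠ j₀) :
    ∑ u ∈ Fintype.piFinset (fun _ : Fin k => S) with (P (u i₀) ∧ P (u j₀)), ∏ i, w (u i) =
      (∑ a ∈ S with P a, w a) ^ 2 * (∑ a ∈ S, w a) ^ (k - 2) := by
  have hj : j₀ ∈ univ.erase i₀ := mem_erase.mpr ⟨hij.symm, mem_univ _⟩
  set T : Finset (Fin k) := {i₀, j₀} with hT
  have hcard : (univ \ T).card = k - 2 := by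
    rw [card_sdiff_of_subset (subset_univ _), card_univ, Fintype.card_fin, hT, card_pair hij]
  have hpr : ∀ f : Fin k → ℝ, ∏ i, f i = (f i₀ * f j₀) * ∏ i ∈ univ \ T, f i := by
    intro f
    rw [← prod_sdiff (subset_univ T), hT, prod_pair hij, mul_comm]
  have hne : ∀ i ∈ univ \ T, ¬ (i = i₀ ∨ i = j₀) := by
    intro i hi
    simpa [hT] using hi
  have : ∀ u : Fin k → ι, (if P (u i₀) ∧ P (u j₀) then ∏ i, w (u i) else 0) =
      ∏ i, (if i = i₀ ∨ i = j₀ then (if P (u i) then w (u i) else 0) else w (u i)) := by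
    intro u
    rw [hpr, hpr, prod_congr rfl fun i hi => if_neg (hne i hi)]
    simp only [true_or, or_true, if_true]
    by_cases h1 : P (u i₀) <;> by_cases h2 : P (u j₀) <;> simp [h1, h2]
  rw [sum_filter, sum_congr rfl fun u _ => this u,
    sum_prod_piFinset S (fun i a => if i = i₀ ∨ i = j₀ then (if P a then w a else 0) else w a),
    hpr, sum_filter]
  simp only [true_or, or_true, if_true, sq]
  congr 1
  rw [prod_congr rfl fun i hi => sum_congr rfl fun a _ => if_neg (hne i hi), prod_const, hcard]

/-- Once the other coordinates are fixed, the hyperplane fixes the first one, so `NearUniform.atom`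
applies. -/
theorem NearUniform.sum_hyperplane_le {ι : Type*} {S : Finset ι} {w x : ι → ℝ} {ε : ℝ}
    (h : NearUniform S w x ε) (hk : 0 < k) (c : ℝ) :
    ∑ u ∈ Fintype.piFinset (fun _ : Fin k => S) with ∑ i, x (u i) = c, ∏ i, w (u i) ≤
      2 * ε * (∑ a ∈ S, w a) ^ (k - 1) := by
  obtain ⟨n, rfl⟩ : ∃ n, k = n + 1 := ⟨k - 1, by omega⟩
  rw [sum_filter, sum_piFinset_succ, sum_comm, Nat.add_sub_cancel]
  have hw0 : ∀ v ∈ Fintype.piFinset (fun _ : Fin n => S), 0 ≤ ∏ i, w (v i) := fun v hv =>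
    prod_nonneg fun i _ => h.nonneg _ (Fintype.mem_piFinset.mp hv i)
  calc _ ≤ ∑ v ∈ Fintype.piFinset (fun _ : Fin n => S), 2 * ε * ∏ i, w (v i) := by
        refine sum_le_sum fun v hv => ?_
        have : ∀ a ∈ S, (if ∑ i, x ((Fin.cons a v : Fin (n + 1) → ι) i) = c then
            ∏ i, w ((Fin.cons a v : Fin (n + 1) → ι) i) else 0) =
            if x a = c - ∑ i, x (v i) then w a * ∏ i, w (v i) else 0 := by
          intro a _
          rw [Fin.sum_univ_succ, Fin.prod_univ_succ]
          simp only [Fin.cons_zero, Fin.cons_succ, eq_sub_iff_add_eq]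
        rw [sum_congr rfl this, ← sum_filter, ← sum_mul]
        exact mul_le_mul_of_nonneg_right (h.atom _) (hw0 v hv)
    _ = _ := by
        rw [← mul_sum, sum_prod_piFinset S (fun _ a => w a), prod_const, card_univ,
          Fintype.card_fin]

end

end MultSieve

/-! ### The diagonal as a Riemann sum -/

namespace MultSieve
noncomputable section

open Finset

variable {k : ℕ} {A : Fin k → ℕ} {B : Fin k → ℤ} {F : (Fin k → ℝ) → ℝ} {R : ℝ} {W : ℕ} {z : ℝ}

/-- `U` is an open convex region in the unit cube on which `F` is differentiable and which carries
`F` up to coordinate hyperplanes and the hyperplane `∑ t_i = 1`. -/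
structure CarriedBy (F : (Fin k → ℝ) → ℝ) (U : Set (Fin k → ℝ)) : Prop where
  isOpen : IsOpen U
  convex : Convex ℝ U
  subset : U ⊆ Set.Icc 0 1
  differentiableOn : DifferentiableOn ℝ F U
  sum_lt : ∀ t ∈ U, ∀ j, ∑ i ∈ univ.erase j, t i < 1
  mem : ∀ t, F t ≠ 0 → (∀ i, 0 < t i) → (∀ j, ∑ i ∈ univ.erase j, t i < 1) → ∑ i, t i ≠ 1 → t ∈ U
  null : MeasureTheory.volume (Function.support F \ U) = 0

/-- The normalised weight `1/(φ(u) V)`. -/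
def nwt (V : ℝ) (u : ℕ) : ℝ := 1 / (Nat.totient u : ℝ) / V

/-- The position `log u / log R`. -/
def pos (R : ℝ) (u : ℕ) : ℝ := Real.log u / Real.log R

theorem sum_nwt (V : ℝ) : ∑ u ∈ sfc W R, nwt V u = totSum W R / V := by
  rw [totSum, sum_div]; rfl

theorem sum_nwt_dvd_le {V : ℝ} (hV : 0 < V) {p : ℕ} (hp : p.Prime) :
    ∑ u ∈ sfc W R with p ∣ u, nwt V u ≤ 1 / ((p : ℝ) - 1) * ∑ u ∈ sfc W R, nwt V u := by
  have h := sum_wt_dvd_le (W := W) (x := R) (b := fun p => 1 / ((p : ℝ) - 1)) (fun p hp => by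
    have := one_lt_cast_prime hp
    exact (one_div_pos.mpr (by linarith)).le) hp
  rw [← totSum_eq] at h
  rw [sum_nwt, mul_div_assoc', le_div_iff₀ hV, sum_mul]
  refine le_trans (le_of_eq (sum_congr rfl fun u hu => ?_)) h
  rw [nwt, div_mul_cancel₀ _ hV.ne', inv_totient_eq_wt (mem_sfc.mp (mem_filter.mp hu).1).2.1]

open scoped Classical in
/-- Tuples sharing a prime between two components. -/
theorem Rough.sum_shared_prime_le (h : Rough W z) {V m : ℝ} (hV : 0 < V)
    (hm : ∑ u ∈ sfc W R, nwt V u ≤ m) (hk : 2 ≤ k) :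
    ∑ u ∈ Fintype.piFinset (fun _ : Fin k => sfc W R) with
        (∃ i j, i ≠ j ∧ ∃ p : ℕ, p.Prime ∧ p ∣ u i ∧ p ∣ u j), ∏ i, nwt V (u i) ≤
      4 * (k : ℝ) ^ 2 * m ^ k / z := by
  classical
  have hw : ∀ u, 0 ≤ nwt V u := fun u => by unfold nwt; positivity
  have hm0 : 0 ≤ ∑ u ∈ sfc W R, nwt V u := sum_nonneg fun u _ => hw u
  have hz := h.one_lt
  set I : Finset (Fin k × Fin k) := univ.filter fun q => q.1 ≠ q.2 with hI
  -- For a fixed pair of components and a fixed p, divisibility of both by p costs 1/(p-1)² by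
  -- independence; the sum over p ≥ z gives the factor 1/z.
  have hcov : (Fintype.piFinset (fun _ : Fin k => sfc W R)).filter
        (fun u => ∃ i j, i ≠ j ∧ ∃ p : ℕ, p.Prime ∧ p ∣ u i ∧ p ∣ u j) ⊆
      (I ×ˢ primesOff W R).biUnion fun q =>
        (Fintype.piFinset (fun _ : Fin k => sfc W R)).filter
          (fun u => q.2 ∣ u q.1.1 ∧ q.2 ∣ u q.1.2) := by
    intro u hu
    rw [mem_filter] at hu
    obtain ⟨hu1, i, j, hij, p, hp, hpi, hpj⟩ := hu
    rw [mem_biUnion]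
    have hui := mem_sfc.mp (Fintype.mem_piFinset.mp hu1 i)
    refine ⟨((i, j), p), mem_product.mpr ⟨by simp [hI, hij], ?_⟩, mem_filter.mpr ⟨hu1, hpi, hpj⟩⟩
    exact primeFactors_subset_primesOff hui.1.2 hui.2.2
      (Nat.mem_primeFactors.mpr ⟨hp, hpi, hui.2.1.ne_zero⟩)
  set f : (Fin k → ℕ) → ℝ := fun u => ∏ i, nwt V (u i) with hf
  have hf0 : ∀ u, 0 ≤ f u := fun u => prod_nonneg fun i _ => hw _
  have hpp : ∀ q ∈ I ×ˢ primesOff W R,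
      ∑ u ∈ (Fintype.piFinset (fun _ : Fin k => sfc W R)).filter
          (fun u => q.2 ∣ u q.1.1 ∧ q.2 ∣ u q.1.2), f u ≤ 1 / ((q.2 : ℝ) - 1) ^ 2 * m ^ k := by
    rintro ⟨⟨i, j⟩, p⟩ hq
    have hq := mem_product.mp hq
    have hij : i ≠ j := by simpa [hI] using hq.1
    have hp := (mem_primesOff.mp hq.2).2.1
    have h1 : 0 < (p : ℝ) - 1 := by linarith [one_lt_cast_prime hp]
    simp only
    rw [hf, sum_piFinset_pin_two (sfc W R) (nwt V) (fun a => p ∣ a) hij]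
    have h2 := sum_nwt_dvd_le (W := W) (R := R) hV hp
    have h3 : 0 ≤ ∑ u ∈ sfc W R with p ∣ u, nwt V u := sum_nonneg fun u _ => hw u
    calc _ ≤ (1 / ((p : ℝ) - 1) * ∑ u ∈ sfc W R, nwt V u) ^ 2 *
          (∑ u ∈ sfc W R, nwt V u) ^ (k - 2) := by gcongr
      _ = 1 / ((p : ℝ) - 1) ^ 2 * (∑ u ∈ sfc W R, nwt V u) ^ k := by
          rw [mul_pow, mul_assoc, ← pow_add, show 2 + (k - 2) = k by omega, div_pow, one_pow]
      _ ≤ _ := by gcongr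
  have hm0' : 0 ≤ m := hm0.trans hm
  calc _ ≤ ∑ u ∈ (I ×ˢ primesOff W R).biUnion fun q =>
        (Fintype.piFinset (fun _ : Fin k => sfc W R)).filter
          (fun u => q.2 ∣ u q.1.1 ∧ q.2 ∣ u q.1.2), f u :=
        sum_le_sum_of_subset_of_nonneg hcov fun u _ _ => hf0 u
    _ ≤ _ := sum_biUnion_le_sum _ _ hf0
    _ ≤ ∑ q ∈ I ×ˢ primesOff W R, 1 / ((q.2 : ℝ) - 1) ^ 2 * m ^ k := sum_le_sum hpp
    _ = (I.card : ℝ) * ((∑ p ∈ primesOff W R, 1 / ((p : ℝ) - 1) ^ 2) * m ^ k) := by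
        rw [sum_product]
        simp only [sum_const, nsmul_eq_mul, sum_mul]
    _ ≤ (k : ℝ) ^ 2 * (4 / z * m ^ k) := by
        gcongr
        · have : I.card ≤ k ^ 2 := by
            refine (card_le_univ I).trans (le_of_eq ?_)
            simp [sq]
          exact_mod_cast this
        · exact h.sum_primesOff
    _ = _ := by ring

theorem squarefree_prod_of_pairwise {u : Fin k → ℕ} (hu : ∀ i, Squarefree (u i))
    (hc : ∀ i j, i ≠ j → ∀ p : ℕ, p.Prime → p ∣ u i → ¬ p ∣ u j) : Squarefree (∏ i, u i) := by
  have hcop : ∀ i j, i ≠ j → (u i).Coprime (u j) := fun i j hij =>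
    Nat.Coprime.symm (Nat.Coprime.symm (Nat.coprime_of_dvd fun p hp h1 => hc i j hij p hp h1))
  exact Finset.squarefree_prod_of_pairwise_isCoprime
    (fun i _ j _ hij => (Nat.coprime_iff_isRelPrime.mp (hcop i j hij))) fun i _ => hu i

theorem prod_lt_iff (hR : 1 < R) {u : Fin k → ℕ} (hu : ∀ i, 1 ≤ u i) (T : Finset (Fin k)) :
    ((∏ i ∈ T, u i : ℕ) : ℝ) < R ↔ ∑ i ∈ T, pos R (u i) < 1 := by
  have hl := Real.log_pos hR
  have hu0 : ∀ i, (0 : ℝ) < u i := fun i => by exact_mod_cast hu i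
  unfold pos
  rw [← sum_div, div_lt_one hl, ← Real.log_prod fun i _ => (hu0 i).ne', Nat.cast_prod]
  exact (Real.log_lt_log_iff (prod_pos fun i _ => hu0 i) (by linarith)).symm

/-- With no shared primes the product is square-free, and its coprimality to W holds componentwise.
The condition ∏_{i≠j} r_i < R reads ∑_{i≠j} t_i < 1, which holds on U; where it fails, both sides
vanish. -/
theorem weightY_sq_eq_indicator (hR : 1 < R) {U : Set (Fin k → ℝ)} (hF : CarriedBy F U)
    {u : Fin k → ℕ} (hu : ∀ i, u i ∈ sfc W R)
    (h1 : ¬ ∃ i j, i ≠ j ∧ ∃ p : ℕ, p.Prime ∧ p ∣ u i ∧ p ∣ u j) (h2 : ∀ i, pos R (u i) ≠ 0)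
    (h3 : ∑ i, pos R (u i) ≠ 1) :
    weightY F R W u ^ 2 = U.indicator (fun t => F t ^ 2) (fun i => pos R (u i)) := by
  classical
  have hu' := fun i => mem_sfc.mp (hu i)
  have hu1 : ∀ i, 1 ≤ u i := fun i => (hu' i).1.1
  have hl := Real.log_pos hR
  have hpos : ∀ i, 0 < pos R (u i) := fun i => lt_of_le_of_ne
    (div_nonneg (Real.log_nonneg (by exact_mod_cast hu1 i)) hl.le) (h2 i).symm
  have hsq : Squarefree (∏ i, u i) := squarefree_prod_of_pairwise (fun i => (hu' i).2.1)
    fun i j hij p hp hpi hpj => h1 ⟨i, j, hij, p, hp, hpi, hpj⟩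
  have hcop : Nat.Coprime (∏ i, u i) W := Nat.Coprime.prod_left fun i _ => (hu' i).2.2
  by_cases hlt : ∀ j, ((∏ i ∈ univ.erase j, u i : ℕ) : ℝ) < R
  · rw [weightY, if_pos ⟨hsq, hcop, hlt⟩]
    by_cases hU : (fun i => pos R (u i)) ∈ U
    · rw [Set.indicator_of_mem hU]; rfl
    · rw [Set.indicator_of_notMem hU]
      have : F (fun i => pos R (u i)) = 0 := by
        by_contra hne
        exact hU (hF.mem _ hne hpos (fun j => (prod_lt_iff hR hu1 _).mp (hlt j)) h3)
      show F (fun i => pos R (u i)) ^ 2 = 0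
      rw [this]; simp
  · rw [weightY, if_neg (fun h => hlt h.2.2), Set.indicator_of_notMem]
    · simp
    · intro hU
      exact hlt fun j => (prod_lt_iff hR hu1 _).mpr (hF.sum_lt _ hU j)

theorem abs_weightY_le (hb : BddAbove (sizeAt F '' Set.Icc 0 1)) (hR : 1 < R) {u : Fin k → ℕ}
    (hu : ∀ i, u i ∈ sfc W R) : |weightY F R W u| ≤ Fmax F := by
  unfold weightY
  split_ifs
  · have hl := Real.log_pos hR
    refine abs_le_Fmax hb ⟨fun i => ?_, fun i => ?_⟩
    · have := (mem_sfc.mp (hu i)).1.1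
      exact div_nonneg (Real.log_nonneg (by exact_mod_cast this)) hl.le
    · have h := (mem_sfc.mp (hu i)).1
      refine (div_le_one hl).mpr (Real.log_le_log (by exact_mod_cast h.1) ?_)
      exact (Nat.le_floor_iff (by linarith)).mp h.2
  · simpa using Fmax_nonneg hb

/-- The weights y² agree with F² restricted to U except on three thin families: a shared prime, a
component equal to 1, or ∑ t_i = 1. On these the difference is at most `Fmax F`², so only their
masses matter. -/
theorem Rough.abs_diag_sub_le (h : Rough W z) (hk : 2 ≤ k) (hR : 1 < R) {V ε m : ℝ} (hV : 0 < V)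
    (hN : NearUniform (sfc W R) (nwt V) (pos R) ε) (hm : 1 ≤ m)
    (hS : ∑ u ∈ sfc W R, nwt V u ≤ m)
    (hb : BddAbove (sizeAt F '' Set.Icc 0 1)) {U : Set (Fin k → ℝ)} (hF : CarriedBy F U) :
    |∑ r ∈ suppY F R W, weightY F R W r ^ 2 / ∏ i, (Nat.totient (r i) : ℝ) -
        V ^ k * ∫ t in Set.Icc (0 : Fin k → ℝ) 1, F t ^ 2| ≤
      V ^ k * (Fmax F ^ 2 * ((4 * (k : ℝ) ^ 2 / z + 2 * ε * (8 * k + 1)) * m ^ k)) := by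
  classical
  have hF0 := Fmax_nonneg hb
  have hε := hN.eps_nonneg
  have hw : ∀ u, 0 ≤ nwt V u := fun u => by unfold nwt; positivity
  set P := Fintype.piFinset (fun _ : Fin k => sfc W R) with hP
  set f : (Fin k → ℕ) → ℝ := fun u => ∏ i, nwt V (u i) with hf
  have hf0 : ∀ u, 0 ≤ f u := fun u => prod_nonneg fun i _ => hw _
  set ind : (Fin k → ℕ) → ℝ := fun u => U.indicator (fun t => F t ^ 2) (fun i => pos R (u i))
    with hind
  have hD : ∑ r ∈ suppY F R W, weightY F R W r ^ 2 / ∏ i, (Nat.totient (r i) : ℝ) =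
      V ^ k * ∑ u ∈ P, f u * weightY F R W u ^ 2 := by
    rw [mul_sum]
    have e : ∀ u, V ^ k * (f u * weightY F R W u ^ 2) =
        weightY F R W u ^ 2 / ∏ i, (Nat.totient (u i) : ℝ) := by
      intro u
      simp only [hf, nwt]
      rw [prod_div_distrib, prod_const, card_univ, Fintype.card_fin, prod_div_distrib,
        prod_const_one]
      field_simp
    simp only [e]
    refine sum_subset suppY_subset fun u hu hn => ?_
    have : weightY F R W u = 0 := by
      by_contra hne
      refine hn (mem_suppY.mpr ⟨?_, hne⟩)
      rw [box, Fintype.mem_piFinset]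
      exact fun i => mem_Icc.mpr (mem_sfc.mp (Fintype.mem_piFinset.mp hu i)).1
    simp [this]
  have hmain := hN.sum_indicator_sq hm hS hb hF.isOpen hF.convex hF.subset hF.differentiableOn
    hF.null
  set b₁ : (Fin k → ℕ) → ℝ := fun u =>
    if ∃ i j, i ≠ j ∧ ∃ p : ℕ, p.Prime ∧ p ∣ u i ∧ p ∣ u j then f u else 0 with hb1
  set b₂ : (Fin k → ℕ) → ℝ := fun u => ∑ i, if pos R (u i) = 0 then f u else 0 with hb2
  set b₃ : (Fin k → ℕ) → ℝ := fun u => if ∑ i, pos R (u i) = 1 then f u else 0 with hb3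
  have hpt : ∀ u ∈ P, |f u * weightY F R W u ^ 2 - f u * ind u| ≤
      Fmax F ^ 2 * (b₁ u + b₂ u + b₃ u) := by
    intro u hu
    have hu' := Fintype.mem_piFinset.mp hu
    have h1 : 0 ≤ b₁ u := by simp only [hb1]; split_ifs; exacts [hf0 u, le_rfl]
    have h2 : 0 ≤ b₂ u := sum_nonneg fun i _ => by split_ifs; exacts [hf0 u, le_rfl]
    have h3 : 0 ≤ b₃ u := by simp only [hb3]; split_ifs; exacts [hf0 u, le_rfl]
    have hle : |weightY F R W u ^ 2 - ind u| ≤ Fmax F ^ 2 := by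
      have y1 := pow_le_pow_left₀ (abs_nonneg _) (abs_weightY_le hb hR hu') 2
      rw [sq_abs] at y1
      have y2 := abs_indicator_sq_le hb hF.subset (fun i => pos R (u i))
      have y3 : 0 ≤ ind u := Set.indicator_nonneg (fun _ _ => sq_nonneg _) _
      have y4 := (abs_le.mp y2).2
      have y5 := sq_nonneg (weightY F R W u)
      have y6 : ind u ≤ Fmax F ^ 2 := y4
      rw [abs_le]
      constructor <;> linarith
    have hfu : f u ≤ b₁ u + b₂ u + b₃ u → |f u * weightY F R W u ^ 2 - f u * ind u| ≤
        Fmax F ^ 2 * (b₁ u + b₂ u + b₃ u) := by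
      intro hfb
      rw [← mul_sub, abs_mul, abs_of_nonneg (hf0 u), mul_comm]
      exact mul_le_mul hle hfb (hf0 u) (sq_nonneg _)
    by_cases c1 : ∃ i j, i ≠ j ∧ ∃ p : ℕ, p.Prime ∧ p ∣ u i ∧ p ∣ u j
    · apply hfu
      have : b₁ u = f u := if_pos c1
      linarith
    by_cases c2 : ∃ i, pos R (u i) = 0
    · apply hfu
      obtain ⟨i, hi⟩ := c2
      have : f u ≤ b₂ u := by
        have := single_le_sum (f := fun i => if pos R (u i) = 0 then f u else 0) (s := univ)
          (fun i _ => by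
            show 0 ≤ if pos R (u i) = 0 then f u else 0
            split_ifs; exacts [hf0 u, le_rfl]) (mem_univ i)
        simpa [hi] using this
      linarith
    by_cases c3 : ∑ i, pos R (u i) = 1
    · apply hfu
      have : b₃ u = f u := if_pos c3
      linarith
    · rw [weightY_sq_eq_indicator hR hF hu' c1 (fun i hi => c2 ⟨i, hi⟩) c3]
      simp only [hind, sub_self, abs_zero]
      positivity
  have hB1 : ∑ u ∈ P, b₁ u ≤ 4 * (k : ℝ) ^ 2 * m ^ k / z := by
    rw [hb1, ← sum_filter]
    exact h.sum_shared_prime_le hV hS hk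
  have hm0 : 0 ≤ ∑ u ∈ sfc W R, nwt V u := sum_nonneg fun u _ => hw u
  have hmk : (∑ u ∈ sfc W R, nwt V u) ^ (k - 1) ≤ m ^ k :=
    (pow_le_pow_left₀ hm0 hS _).trans (pow_le_pow_right₀ hm (Nat.sub_le _ _))
  have hB2 : ∑ u ∈ P, b₂ u ≤ k * (2 * ε * m ^ k) := by
    rw [hb2, sum_comm]
    calc _ ≤ ∑ i : Fin k, 2 * ε * m ^ k := sum_le_sum fun i _ => by
          rw [← sum_filter, hf, sum_piFinset_pin (sfc W R) (nwt V) (fun a => pos R a = 0) i]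
          exact mul_le_mul (hN.atom 0) hmk (pow_nonneg hm0 _) (by positivity)
      _ = _ := by simp
  have hB3 : ∑ u ∈ P, b₃ u ≤ 2 * ε * m ^ k := by
    rw [hb3, ← sum_filter]
    exact (hN.sum_hyperplane_le (by omega) 1).trans (mul_le_mul_of_nonneg_left hmk (by positivity))
  have hdiff : |∑ u ∈ P, f u * weightY F R W u ^ 2 - ∑ u ∈ P, f u * ind u| ≤
      Fmax F ^ 2 * (4 * (k : ℝ) ^ 2 * m ^ k / z + k * (2 * ε * m ^ k) + 2 * ε * m ^ k) := by
    rw [← sum_sub_distrib]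
    refine (abs_sum_le_sum_abs _ _).trans ((sum_le_sum hpt).trans ?_)
    rw [← mul_sum, sum_add_distrib, sum_add_distrib]
    gcongr
  rw [hD, ← mul_sub, abs_mul, abs_of_pos (pow_pos hV k)]
  refine mul_le_mul_of_nonneg_left ?_ (pow_nonneg hV.le k)
  -- The coefficient 2ε(8k + 1) collects 2kε from the coordinate hyperplanes, 2ε from ∑ t_i = 1 and
  -- 14kε from the comparison with the integral.
  refine (abs_sub_le _ (∑ u ∈ P, f u * ind u) _).trans ((add_le_add hdiff hmain).trans (le_of_eq ?_))
  ring

/-- The atoms at positions up to t are the u ≤ R^t, so the distribution function is the totient sum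
at R^t divided by V. -/
theorem Rough.nearUniform (h : Rough W z) (hR : 1 < R) :
    NearUniform (sfc W R) (nwt ((Nat.totient W : ℝ) / W * Real.log R)) (pos R)
      (4 * Real.exp 4 / z * (1 + (W : ℝ) ^ 2 / Real.log R) + (W : ℝ) ^ 2 / Real.log R) := by
  have hl := Real.log_pos hR
  have hW : 0 < W := Nat.pos_of_ne_zero h.ne_zero
  have hW0 : (0 : ℝ) < W := by exact_mod_cast hW
  have hφ : (1 : ℝ) ≤ Nat.totient W := by exact_mod_cast Nat.totient_pos.mpr hW
  set V := (Nat.totient W : ℝ) / W * Real.log R with hV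
  have hV0 : 0 < V := by positivity
  have hz := h.one_lt
  refine ⟨fun u _ => ?_, fun u hu => ?_, fun t ht => ?_⟩
  · unfold nwt; positivity
  · have hu := (mem_sfc.mp hu).1
    refine ⟨div_nonneg (Real.log_nonneg (by exact_mod_cast hu.1)) hl.le, ?_⟩
    refine (div_le_one hl).mpr (Real.log_le_log (by exact_mod_cast hu.1) ?_)
    exact (Nat.le_floor_iff (by linarith)).mp hu.2
  · have hx1 : 1 ≤ R ^ t := Real.one_le_rpow hR.le ht.1
    have hlx : Real.log (R ^ t) = t * Real.log R := Real.log_rpow (by linarith) t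
    have hset : (sfc W R).filter (fun u => pos R u ≤ t) = sfc W (R ^ t) := by
      ext u
      rw [mem_filter, mem_sfc, mem_sfc, Nat.le_floor_iff (by linarith), Nat.le_floor_iff (by linarith)]
      have key : 1 ≤ u → (pos R u ≤ t ↔ (u : ℝ) ≤ R ^ t) := by
        intro hu
        have hu0 : (0 : ℝ) < u := by exact_mod_cast hu
        rw [pos, div_le_iff₀ hl, ← hlx, Real.log_le_log_iff hu0 (by linarith)]
      have hle : R ^ t ≤ R := by
        have := Real.rpow_le_rpow_of_exponent_le hR.le ht.2
        rwa [Real.rpow_one] at this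
      constructor
      · rintro ⟨⟨⟨h1, h2⟩, h3⟩, h4⟩; exact ⟨⟨h1, (key h1).mp h4⟩, h3⟩
      · rintro ⟨⟨h1, h2⟩, h3⟩; exact ⟨⟨⟨h1, h2.trans hle⟩, h3⟩, (key h1).mpr h2⟩
    rw [hset, sum_nwt]
    have hT := h.abs_totSum_sub_le hx1
    rw [hlx] at hT
    have e : totSum W (R ^ t) / V - t =
        (totSum W (R ^ t) - (Nat.totient W : ℝ) / W * (t * Real.log R)) / V := by
      rw [sub_div]
      congr 1
      rw [hV]; field_simp
    -- Only φ(W) ≥ 1 is used; the loss of a factor W is affordable.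
    have hWV : (W : ℝ) / V ≤ (W : ℝ) ^ 2 / Real.log R := by
      rw [hV, div_le_div_iff₀ hV0 hl]
      have : (W : ℝ) ^ 2 * ((Nat.totient W : ℝ) / W * Real.log R) =
          (W * Real.log R) * Nat.totient W := by field_simp
      rw [this]
      exact le_mul_of_one_le_right (by positivity) hφ
    rw [e, abs_div, abs_of_pos hV0]
    calc _ ≤ (4 * Real.exp 4 / z * ((Nat.totient W : ℝ) / W * (t * Real.log R) + W) + W) / V := by
          gcongr
      _ = 4 * Real.exp 4 / z * (t + W / V) + W / V := by
          have : (Nat.totient W : ℝ) / W * (t * Real.log R) = t * V := by rw [hV]; ring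
          rw [this]
          field_simp
      _ ≤ _ := by
          gcongr
          exact ht.2

end

end MultSieve

/-! ### Size of W, good primes, and assembly of the asymptotic formula -/

namespace MultSieve
noncomputable section

open Finset

variable {k : ℕ} {A : Fin k → ℕ} {B : Fin k → ℤ} {F : (Fin k → ℝ) → ℝ} {N : ℝ}

theorem one_lt_log_of_sixteen_lt (hN : 16 < N) : 1 < Real.log N := by
  rw [Real.lt_log_iff_exp_lt (by linarith)]
  linarith [Real.exp_one_lt_d9]

/-- As e^{D_0} = log log N, a power of it is dominated by log N = exp(log log N), through a single
term of the exponential series. -/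
theorem exp_mul_D0_le (c : ℝ) :
    ∃ C : ℝ, 0 < C ∧ ∀ N : ℝ, 16 < N → 1 < D0 N → Real.exp (c * D0 N) ≤ C * Real.log N := by
  refine ⟨(⌈c⌉₊.factorial : ℝ), by positivity, fun N hN hD => ?_⟩
  have h1 := one_lt_log_of_sixteen_lt hN
  have hy : 0 < Real.log (Real.log N) := Real.log_pos h1
  have hexp : Real.exp (D0 N) = Real.log (Real.log N) := Real.exp_log hy
  have h2 := Real.pow_div_factorial_le_exp (Real.log (Real.log N)) hy.le ⌈c⌉₊
  rw [Real.exp_log (by linarith), div_le_iff₀ (by positivity)] at h2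
  calc Real.exp (c * D0 N) ≤ Real.exp (⌈c⌉₊ * D0 N) := by
        apply Real.exp_le_exp.mpr
        exact mul_le_mul_of_nonneg_right (Nat.le_ceil c) (by linarith)
    _ = Real.log (Real.log N) ^ ⌈c⌉₊ := by rw [Real.exp_nat_mul, hexp]
    _ ≤ _ := by rw [mul_comm]; exact h2

theorem D0_le_self (hN : 16 < N) : D0 N ≤ N := by
  have h1 := one_lt_log_of_sixteen_lt hN
  have hy : 0 < Real.log (Real.log N) := Real.log_pos h1
  have a := Real.log_le_sub_one_of_pos hy
  have b := Real.log_le_sub_one_of_pos (show 0 < Real.log N by linarith)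
  have c := Real.log_le_sub_one_of_pos (show 0 < N by linarith)
  unfold D0
  linarith

theorem bigW_pos (N : ℝ) : 0 < bigW N :=
  prod_pos fun _ hp => (mem_filter.mp hp).2.pos

theorem rough_bigW (hD : 1 < D0 N) : Rough (bigW N) (D0 N) := by
  refine ⟨(bigW_pos N).ne', hD, fun p hp hd => ?_⟩
  by_contra hlt
  exact hd (dvd_prod_of_mem _ (mem_bigW_index.mpr ⟨not_le.mp hlt, hp⟩))

theorem bigW_le_exp (hD : 1 < D0 N) : (bigW N : ℝ) ≤ Real.exp (2 * D0 N) := by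
  -- The range below ⌈D_0⌉ is the range of the primorial of m = ⌈D_0⌉ - 1, so the bound 4^m applies
  -- with m < D_0.
  obtain ⟨m, hm⟩ : ∃ m, ⌈D0 N⌉₊ = m + 1 :=
    ⟨⌈D0 N⌉₊ - 1, by have := Nat.ceil_pos.mpr (show 0 < D0 N by linarith); omega⟩
  have hmD : (m : ℝ) < D0 N := Nat.lt_ceil.mp (by omega)
  have h1 : bigW N ≤ 4 ^ m := by
    have := primorial_le_four_pow m
    rwa [primorial, ← hm] at this
  have h2 : (4 : ℝ) ≤ Real.exp 2 := by
    have := Real.add_one_le_exp 1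
    have h3 : Real.exp 2 = Real.exp 1 * Real.exp 1 := by rw [← Real.exp_add]; norm_num
    nlinarith
  calc (bigW N : ℝ) ≤ 4 ^ m := by exact_mod_cast h1
    _ ≤ Real.exp 2 ^ m := pow_le_pow_left₀ (by norm_num) h2 m
    _ = Real.exp (m * 2) := (Real.exp_nat_mul 2 m).symm
    _ ≤ _ := Real.exp_le_exp.mpr (by linarith)

theorem Admissible.not_dvd_both (h : Admissible A B) (i : Fin k) {p : ℕ} (hp : p.Prime)
    (hA : p ∣ A i) : ¬ (p : ℤ) ∣ B i := by
  intro hB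
  have := h.rootCount_lt p hp
  rw [rootCount, filter_true_of_mem] at this
  · simp at this
  · intro n _
    refine Dvd.dvd.trans ?_ (dvd_prod_of_mem (fun i => linForm A B i (n : ℤ)) (mem_univ i))
    exact dvd_add ((Int.natCast_dvd_natCast.mpr hA).mul_right _) hB

/-- Admissibility makes every form primitive, since a common prime of A_i and B_i would divide all
values. Proportional primitive forms with positive leading coefficients are equal, contrary to
distinctness. -/
theorem Admissible.resultant_ne_zero (h : Admissible A B) {i j : Fin k} (hij : i ≠ j) :
    (A i : ℤ) * B j - (A j : ℤ) * B i ≠ 0 := by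
  intro h0
  have hcop : ∀ i, IsCoprime (A i : ℤ) (B i) := by
    intro i
    rw [Int.isCoprime_iff_gcd_eq_one]
    by_contra hne
    obtain ⟨p, hp, hd⟩ := Nat.exists_prime_and_dvd hne
    have h1 : (p : ℤ) ∣ (A i : ℤ) := (Int.natCast_dvd_natCast.mpr hd).trans (Int.gcd_dvd_left _ _)
    have h2 : (p : ℤ) ∣ B i := (Int.natCast_dvd_natCast.mpr hd).trans (Int.gcd_dvd_right _ _)
    exact h.not_dvd_both i hp (Int.natCast_dvd_natCast.mp h1) h2
  have e : (A i : ℤ) * B j = A j * B i := by linarith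
  have d1 : (A i : ℤ) ∣ A j := (hcop i).dvd_of_dvd_mul_right ⟨B j, e.symm⟩
  have d2 : (A j : ℤ) ∣ A i := (hcop j).dvd_of_dvd_mul_right ⟨B i, e⟩
  have hA : A i = A j := Nat.dvd_antisymm (Int.natCast_dvd_natCast.mp d1)
    (Int.natCast_dvd_natCast.mp d2)
  refine h.distinct i j hij (Prod.ext hA ?_)
  rw [hA] at e
  have hpos : (A j : ℤ) ≠ 0 := by exact_mod_cast (h.pos j).ne'
  exact (mul_left_cancel₀ hpos e).symm

theorem Admissible.goodPrime (h : Admissible A B)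
    (h1 : ∀ i j, (((A i : ℤ) * B j - (A j : ℤ) * B i : ℤ) : ℝ) < D0 N)
    (h2 : ∀ i, (A i : ℝ) < D0 N) (hD : 1 < D0 N) {p : ℕ} (hp : p.Prime) (hpW : ¬ p ∣ bigW N) :
    GoodPrime A B p := by
  have hpD := (rough_bigW hD).le_prime p hp hpW
  refine ⟨hp, fun i hd => ?_, fun i j hij hd => ?_⟩
  · have : (p : ℝ) ≤ A i := by exact_mod_cast Nat.le_of_dvd (h.pos i) hd
    linarith [h2 i]
  · have hle := Int.le_of_dvd (abs_pos.mpr (h.resultant_ne_zero hij)) ((dvd_abs _ _).mpr hd)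
    have hle' : (p : ℝ) ≤ |(((A i : ℤ) * B j - (A j : ℤ) * B i : ℤ) : ℝ)| := by exact_mod_cast hle
    -- Applying the hypothesis to both orders of the pair bounds the resultant in absolute value.
    have a := h1 i j
    have b := h1 j i
    have : |(((A i : ℤ) * B j - (A j : ℤ) * B i : ℤ) : ℝ)| < D0 N := by
      rw [abs_lt]
      refine ⟨?_, a⟩
      push_cast at b ⊢
      linarith
    linarith

theorem NearUniform.mono {ι : Type*} {S : Finset ι} {w x : ι → ℝ} {ε ε' : ℝ}
    (h : NearUniform S w x ε) (he : ε ≤ ε') : NearUniform S w x ε' :=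
  ⟨h.nonneg, h.mem, fun t ht => (h.cdf t ht).trans he⟩

theorem selSum_eq (A : Fin k → ℕ) (B : Fin k → ℤ) (F : (Fin k → ℝ) → ℝ) (θ N : ℝ) (ν₀ : ℤ) :
    selSum A B F θ N ν₀ = ∑ n ∈ Ioc ⌊N⌋₊ ⌊2 * N⌋₊ with
      n ≡ (ν₀ % (bigW N : ℤ)).toNat [MOD bigW N],
      LambdaSelSq A B F (N ^ θ) (bigW N) (n : ℤ) := by
  unfold selSum
  refine sum_congr (filter_congr fun n _ => ?_) fun _ _ => rfl
  have hW : (bigW N : ℤ) ≠ 0 := by exact_mod_cast (bigW_pos N).ne'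
  rw [← Int.natCast_modEq_iff, Int.toNat_of_nonneg (Int.emod_nonneg _ hW), Int.ModEq, Int.ModEq,
    Int.emod_emod]

theorem integral_sq_le (hb : BddAbove (sizeAt F '' Set.Icc 0 1)) :
    |∫ t in Set.Icc (0 : Fin k → ℝ) 1, F t ^ 2| ≤ Fmax F ^ 2 := by
  have h := MeasureTheory.norm_setIntegral_le_of_norm_le_const
    (μ := MeasureTheory.volume) (s := Set.Icc (0 : Fin k → ℝ) 1) (C := Fmax F ^ 2)
    (f := fun t => F t ^ 2) (by rw [Real.volume_Icc_pi]; simp) (fun t ht => by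
      rw [Real.norm_eq_abs, abs_pow]
      exact pow_le_pow_left₀ (abs_nonneg _) (abs_le_Fmax hb ht) 2)
  simpa [MeasureTheory.measureReal_def, Real.volume_Icc_pi] using h

theorem rpow_mul_le_of_le_log {N δ C G : ℝ} (hN : 0 < N) (hδ : 0 < δ) (hC : 0 ≤ C)
    (hG : G ≤ C * Real.log N) : N ^ (1 - δ / 2) * G ≤ C * (2 / δ) * N := by
  have h := Real.log_le_rpow_div hN.le (half_pos hδ)
  calc _ ≤ N ^ (1 - δ / 2) * (C * (N ^ (δ / 2) / (δ / 2))) := by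
        refine mul_le_mul_of_nonneg_left (hG.trans ?_) (Real.rpow_nonneg hN.le _)
        exact mul_le_mul_of_nonneg_left h hC
    _ = C * (2 / δ) * (N ^ (1 - δ / 2) * N ^ (δ / 2)) := by field_simp
    _ = _ := by rw [← Real.rpow_add hN]; simp

/-- With δ = 1 - 2β the exponent on the left is (1 - δ)(1 + δ/2) ≤ 1 - δ/2. -/
theorem sq_rpow_rpow_le {N β : ℝ} (hN : 1 ≤ N) (hβ : β < 1 / 2) :
    ((N ^ β) ^ (1 + (1 - 2 * β) / 2)) ^ 2 ≤ N ^ (1 - (1 - 2 * β) / 2) := by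
  have hN0 : 0 ≤ N := by linarith
  rw [← Real.rpow_mul hN0, ← Real.rpow_natCast, ← Real.rpow_mul hN0]
  apply Real.rpow_le_rpow_of_exponent_le hN
  push_cast
  nlinarith

set_option maxHeartbeats 1000000 in
/-- The asymptotic formula, for weights supported on `∏ r_i ≤ N ^ β` with `β < 1/2`. -/
theorem exists_selSum_bound (hk : 2 ≤ k) (hAB : Admissible A B) {θ β : ℝ} (hθ : 0 < θ)
    (hβ0 : 0 < β) (hβ : β < 1 / 2) :
    ∃ C : ℝ, 0 < C ∧ ∀ N : ℝ, 16 < N →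
      (∀ i j, (((A i : ℤ) * B j - (A j : ℤ) * B i : ℤ) : ℝ) < D0 N) →
      (∀ i, (A i : ℝ) < D0 N) → ∀ (ν₀ : ℤ) (F : (Fin k → ℝ) → ℝ) (U : Set (Fin k → ℝ)),
      BddAbove (sizeAt F '' Set.Icc 0 1) → CarriedBy F U →
      (∀ r ∈ suppY F (N ^ θ) (bigW N), ((∏ i, r i : ℕ) : ℝ) ≤ N ^ β) →
      |selSum A B F θ N ν₀ -
          (Nat.totient (bigW N) : ℝ) ^ k * N * Real.log (N ^ θ) ^ k / (bigW N : ℝ) ^ (k + 1) *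
            ∫ t in Set.Icc (0 : Fin k → ℝ) 1, F t ^ 2| ≤
        C * (Fmax F ^ 2 * (Nat.totient (bigW N) : ℝ) ^ k * N *
          Real.log (N ^ θ) ^ k / ((bigW N : ℝ) ^ (k + 1) * D0 N)) := by
  -- With W ≤ e^{2 D_0} and D_0 ≤ e^{D_0}, the exponents 5 and 2(k+1) + 1 dominate W² D_0 and
  -- W^(k+1) D_0.
  obtain ⟨C5, hC5, hgrow5⟩ := exp_mul_D0_le 5
  obtain ⟨C6, hC6, hgrow6⟩ := exp_mul_D0_le (2 * (k + 1) + 1)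
  -- Roles: c₀ bounds W²/log R, c₁ the discrepancy and c₂ the relative error of the quadratic form,
  -- all up to 1/D_0; m bounds the total mass, δ is the power saving, E the Rankin constant and c₄
  -- the remainder constant.
  set c₀ := C5 / θ with hc0
  set c₁ := 4 * Real.exp 4 * (1 + c₀) + c₀ with hc1
  set m := 1 + c₁ with hm
  set c₂ := offConst k * m ^ k + (4 * (k : ℝ) ^ 2 + 2 * c₁ * (8 * k + 1)) * m ^ k with hc2
  set δ := 1 - 2 * β with hδ
  obtain ⟨E, hE⟩ : ∃ E, E = Real.exp (2 * ∑' n : ℕ, 1 / (n : ℝ) ^ (1 + δ / 2)) ^ k := ⟨_, rfl⟩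
  set c₄ := E ^ 2 * (C6 * (2 / δ) / θ ^ k) with hc4
  have hδ0 : 0 < δ := by rw [hδ]; linarith
  have hoff := offConst_nonneg (k := k) (by omega)
  have hc00 : 0 < c₀ := by positivity
  have hc10 : 0 < c₁ := by positivity
  have hc20 : 0 ≤ c₂ := by positivity
  have hE0 : 0 < E := by rw [hE]; positivity
  have hc40 : 0 < c₄ := by positivity
  -- The three terms pay for the remainder, for replacing ⌊2N⌋ - ⌊N⌋ by N, and for replacing the
  -- quadratic form by its integral.
  refine ⟨c₄ + (1 + c₂) + c₂, by positivity, fun N hN hres hA ν₀ F U hb hF hsupp => ?_⟩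
  set z := D0 N with hz
  set W := bigW N with hWdef
  set R := N ^ θ with hRdef
  set M := Fmax F with hM
  set I := ∫ t in Set.Icc (0 : Fin k → ℝ) 1, F t ^ 2 with hI
  have hN0 : 0 < N := by linarith
  have hz1 : 1 < z := by
    have i : Fin k := ⟨0, by omega⟩
    have : (1 : ℝ) ≤ A i := by exact_mod_cast hAB.pos i
    linarith [hA i]
  have hz0 : 0 < z := by linarith
  have hlogN := one_lt_log_of_sixteen_lt hN
  have hW : 0 < W := bigW_pos N
  have hW0 : (0 : ℝ) < W := by exact_mod_cast hW
  have hrough : Rough W z := rough_bigW hz1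
  have hR : 1 < R := Real.one_lt_rpow (by linarith) hθ
  have hlR : Real.log R = θ * Real.log N := Real.log_rpow hN0 θ
  have hl0 : 0 < Real.log R := Real.log_pos hR
  have hφ : (1 : ℝ) ≤ Nat.totient W := by exact_mod_cast Nat.totient_pos.mpr hW
  set V := (Nat.totient W : ℝ) / W * Real.log R with hV
  have hV0 : 0 < V := by positivity
  have hM0 : 0 ≤ M := Fmax_nonneg hb
  have hWexp : (W : ℝ) ≤ Real.exp (2 * z) := bigW_le_exp hz1
  have hzexp : z ≤ Real.exp z := by linarith [Real.add_one_le_exp z]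
  have hW2 : (W : ℝ) ^ 2 / Real.log R ≤ c₀ / z := by
    rw [div_le_div_iff₀ hl0 hz0, hlR, hc0]
    have : (W : ℝ) ^ 2 * z ≤ C5 * Real.log N := by
      calc (W : ℝ) ^ 2 * z ≤ Real.exp (2 * z) ^ 2 * Real.exp z := by gcongr
        _ = Real.exp (5 * z) := by
            rw [← Real.exp_nat_mul, ← Real.exp_add]; congr 1; push_cast; ring
        _ ≤ _ := hgrow5 N hN hz1
    refine this.trans (le_of_eq ?_)
    field_simp
  have hc0z : c₀ / z ≤ c₀ := div_le_self hc00.le hz1.le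
  have hnear : NearUniform (sfc W R) (nwt V) (pos R) (c₁ / z) := by
    refine (hrough.nearUniform hR).mono ?_
    calc _ ≤ 4 * Real.exp 4 / z * (1 + c₀) + c₀ / z := by
          gcongr
          exact hW2.trans hc0z
      _ = _ := by rw [hc1]; ring
  have hSm : ∑ u ∈ sfc W R, nwt V u ≤ m :=
    hnear.sum_le.trans (by rw [hm]; gcongr; exact div_le_self hc10.le hz1.le)
  have hm1 : 1 ≤ m := by rw [hm]; linarith
  have hT : totSum W R ^ k ≤ V ^ k * m ^ k := by
    rw [sum_nwt, div_le_iff₀ hV0, mul_comm] at hSm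
    rw [← mul_pow]
    exact pow_le_pow_left₀ totSum_nonneg hSm k
  set Q := ∑ r ∈ suppY F R W, ∑ s ∈ suppY F R W,
          (weightY F R W r / ∏ i, (Nat.totient (r i) : ℝ)) *
            (weightY F R W s / ∏ i, (Nat.totient (s i) : ℝ)) * pairCoeff r s with hQ
  have hyM : ∀ r ∈ suppY F R W, |weightY F R W r| ≤ M := fun r hr =>
    abs_weightY_le hb hR fun i => Fintype.mem_piFinset.mp (suppY_subset hr) i
  have hQD := abs_quadForm_sub_diag_le (F := F) (R := R) (W := W) (by omega) hyM
  have hDI := hrough.abs_diag_sub_le hk hR hV0 hnear hm1 hSm hb hF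
  have hQI : |Q - V ^ k * I| ≤ V ^ k * M ^ 2 * (c₂ / z) := by
    have h1 : M ^ 2 * (twistSum k W R ^ k - totSum W R ^ k) ≤
        M ^ 2 * (offConst k / z * (V ^ k * m ^ k)) := by
      refine mul_le_mul_of_nonneg_left ?_ (sq_nonneg _)
      exact (hrough.twistSum_pow_sub_le (by omega)).trans
        (mul_le_mul_of_nonneg_left hT (by positivity))
    refine (abs_sub_le _ _ _).trans ((add_le_add (hQD.trans h1) hDI).trans (le_of_eq ?_))
    rw [hc2, ← hM]
    field_simp
  have hIM : |I| ≤ M ^ 2 := integral_sq_le hb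
  have hVk : 0 < V ^ k := pow_pos hV0 k
  have hQabs : |Q| ≤ V ^ k * M ^ 2 * (1 + c₂) := by
    have h1 : |V ^ k * I| ≤ V ^ k * M ^ 2 := by
      rw [abs_mul, abs_of_pos hVk]; gcongr
    have h2 : V ^ k * M ^ 2 * (c₂ / z) ≤ V ^ k * M ^ 2 * c₂ := by
      gcongr; exact div_le_self hc20 hz1.le
    have h3 := abs_sub_abs_le_abs_sub Q (V ^ k * I)
    linarith
  -- the remainder
  have hrem : (∑ r ∈ suppY F R W, |weightY F R W r| * wt (fun _ => 2) (∏ i, r i)) ^ 2 ≤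
      c₄ * (M ^ 2 * V ^ k * N / (W * z)) := by
    have hX0 : 0 ≤ N ^ β := Real.rpow_nonneg hN0.le _
    have h1 : ∑ r ∈ suppY F R W, |weightY F R W r| * wt (fun _ => 2) (∏ i, r i) ≤
        M * ((N ^ β) ^ (1 + δ / 2) * E) := by
      calc _ ≤ ∑ r ∈ suppY F R W, M * wt (fun _ => 2) (∏ i, r i) := sum_le_sum fun r hr =>
            mul_le_mul_of_nonneg_right (hyM r hr) (wt_nonneg (fun _ _ => by norm_num) _)
        _ ≤ _ := by
            rw [← mul_sum, hE]
            exact mul_le_mul_of_nonneg_left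
              (sum_suppY_two_pow_le hX0 (by positivity) hsupp) hM0
    have h2 : ((N ^ β) ^ (1 + δ / 2)) ^ 2 ≤ N ^ (1 - δ / 2) :=
      sq_rpow_rpow_le (by linarith) hβ
    have h3 : N ^ (1 - δ / 2) * ((W : ℝ) ^ (k + 1) * z) ≤ C6 * (2 / δ) * N := by
      refine rpow_mul_le_of_le_log hN0 hδ0 hC6.le ?_
      calc (W : ℝ) ^ (k + 1) * z ≤ Real.exp (2 * z) ^ (k + 1) * Real.exp z := by gcongr
        _ = Real.exp ((2 * (k + 1) + 1) * z) := by
            rw [← Real.exp_nat_mul, ← Real.exp_add]; congr 1; push_cast; ring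
        _ ≤ _ := hgrow6 N hN hz1
    have h4 : θ ^ k ≤ V ^ k * (W : ℝ) ^ k := by
      rw [← mul_pow]
      apply pow_le_pow_left₀ hθ.le
      have : V * W = Nat.totient W * Real.log R := by rw [hV]; field_simp
      rw [this, hlR]
      calc θ ≤ θ * Real.log N := le_mul_of_one_le_right hθ.le hlogN.le
        _ ≤ _ := le_mul_of_one_le_left (by positivity) hφ
    have h5 : N ^ (1 - δ / 2) ≤ C6 * (2 / δ) / θ ^ k * (V ^ k * N / (W * z)) := by
      rw [div_mul_div_comm, le_div_iff₀ (by positivity)]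
      calc N ^ (1 - δ / 2) * (θ ^ k * (W * z)) ≤
            N ^ (1 - δ / 2) * ((V ^ k * (W : ℝ) ^ k) * (W * z)) := by gcongr
        _ = V ^ k * (N ^ (1 - δ / 2) * ((W : ℝ) ^ (k + 1) * z)) := by ring
        _ ≤ V ^ k * (C6 * (2 / δ) * N) := by gcongr
        _ = _ := by ring
    calc _ ≤ (M * ((N ^ β) ^ (1 + δ / 2) * E)) ^ 2 := by
          refine pow_le_pow_left₀ (sum_nonneg fun r _ => mul_nonneg (abs_nonneg _)
            (wt_nonneg (fun _ _ => by norm_num) _)) h1 2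
      _ = M ^ 2 * E ^ 2 * ((N ^ β) ^ (1 + δ / 2)) ^ 2 := by ring
      _ ≤ M ^ 2 * E ^ 2 * (C6 * (2 / δ) / θ ^ k * (V ^ k * N / (W * z))) := by
          gcongr
          exact h2.trans h5
      _ = _ := by rw [hc4]; ring
  have hfl : |(((⌊2 * N⌋₊ : ℕ) : ℝ) - (⌊N⌋₊ : ℕ)) - N| ≤ 1 := by
    have a1 := Nat.floor_le (show 0 ≤ N by linarith)
    have a2 := Nat.lt_floor_add_one N
    have a3 := Nat.floor_le (show 0 ≤ 2 * N by linarith)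
    have a4 := Nat.lt_floor_add_one (2 * N)
    rw [abs_le]
    constructor <;> linarith
  have hab : ⌊N⌋₊ ≤ ⌊2 * N⌋₊ := Nat.floor_le_floor (by linarith)
  have hexpand := abs_sum_LambdaSelSq_sub_le (F := F) (R := R) hW
    (fun p hp hpW => hAB.goodPrime hres hA hz1 hp hpW) hab (ν₀ % (W : ℤ)).toNat
  rw [← hQ, ← selSum_eq] at hexpand
  have hmain : (Nat.totient W : ℝ) ^ k * N * Real.log R ^ k / (W : ℝ) ^ (k + 1) * I =
      N / W * (V ^ k * I) := by
    rw [hV, mul_pow, div_pow, pow_succ (W : ℝ) k]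
    field_simp
  have herr : M ^ 2 * (Nat.totient W : ℝ) ^ k * N * Real.log R ^ k / ((W : ℝ) ^ (k + 1) * z) =
      M ^ 2 * V ^ k * N / (W * z) := by
    rw [hV, mul_pow, div_pow, pow_succ (W : ℝ) k]
    field_simp
  rw [hmain, herr]
  have s2 : |((((⌊2 * N⌋₊ : ℕ) : ℝ) - (⌊N⌋₊ : ℕ)) / W * Q) - N / W * Q| ≤
      (1 + c₂) * (M ^ 2 * V ^ k * N / (W * z)) := by
    have : (((⌊2 * N⌋₊ : ℕ) : ℝ) - (⌊N⌋₊ : ℕ)) / W * Q - N / W * Q =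
        ((((⌊2 * N⌋₊ : ℕ) : ℝ) - (⌊N⌋₊ : ℕ)) - N) * (1 / W * Q) := by ring
    rw [this, abs_mul, abs_mul, abs_of_pos (by positivity : (0 : ℝ) < 1 / W)]
    -- The rounding error 1 in the number of integers is affordable because N/D_0 ≥ 1.
    have hNz : 1 ≤ N / z := (one_le_div hz0).mpr (D0_le_self hN)
    calc _ ≤ 1 * (1 / W * (V ^ k * M ^ 2 * (1 + c₂))) := by gcongr
      _ ≤ N / z * (1 / W * (V ^ k * M ^ 2 * (1 + c₂))) := by gcongr
      _ = _ := by field_simp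
  have s3 : |N / W * Q - N / W * (V ^ k * I)| ≤ c₂ * (M ^ 2 * V ^ k * N / (W * z)) := by
    rw [← mul_sub, abs_mul, abs_of_pos (by positivity : (0 : ℝ) < N / W)]
    calc _ ≤ N / W * (V ^ k * M ^ 2 * (c₂ / z)) := by gcongr
      _ = _ := by field_simp
  have s1 := hexpand.trans hrem
  have t1 := abs_sub_le (selSum A B F θ N ν₀)
    ((((⌊2 * N⌋₊ : ℕ) : ℝ) - (⌊N⌋₊ : ℕ)) / W * Q) (N / W * (V ^ k * I))
  have t2 := abs_sub_le ((((⌊2 * N⌋₊ : ℕ) : ℝ) - (⌊N⌋₊ : ℕ)) / W * Q) (N / W * Q)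
    (N / W * (V ^ k * I))
  linarith

end

end MultSieve

/-! ### The two support regions and the final choice of exponents -/

namespace MultSieve
noncomputable section

open Finset

variable {k : ℕ} {F : (Fin k → ℝ) → ℝ} {N : ℝ}

/-- Positive vectors with `∑_{i ∈ S j} t_i < 1` for all `j`. -/
def openSimplex {κ : Type*} (S : κ → Finset (Fin k)) : Set (Fin k → ℝ) :=
  {t | (∀ i, 0 < t i) ∧ ∀ j, ∑ i ∈ S j, t i < 1}

section openSimplex

variable {κ : Type*} (S : κ → Finset (Fin k))

theorem isOpen_openSimplex [Finite κ] : IsOpen (openSimplex S) := by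
  have e : openSimplex S = (⋂ i, {t | 0 < t i}) ∩ ⋂ j, {t | ∑ i ∈ S j, t i < 1} := by
    ext t; simp [openSimplex]
  rw [e]
  refine (isOpen_iInter_of_finite fun i => ?_).inter (isOpen_iInter_of_finite fun j => ?_)
  · exact isOpen_lt continuous_const (continuous_apply i)
  · exact isOpen_lt (continuous_finsetSum _ fun i _ => continuous_apply i) continuous_const

/-- Any positive share of an interior point makes all the inequalities strict; this yields both
convexity and density in the closed region. -/
theorem combo_mem_openSimplex {s t : Fin k → ℝ} (hs : s ∈ openSimplex S) (ht0 : ∀ i, 0 ≤ t i)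
    (ht1 : ∀ j, ∑ i ∈ S j, t i ≤ 1) {a b : ℝ} (ha : 0 < a) (hb : 0 ≤ b) (hab : a + b = 1) :
    a • s + b • t ∈ openSimplex S := by
  refine ⟨fun i => ?_, fun j => ?_⟩
  · have := mul_pos ha (hs.1 i)
    have := mul_nonneg hb (ht0 i)
    simp only [Pi.add_apply, Pi.smul_apply, smul_eq_mul]
    linarith
  · simp only [Pi.add_apply, Pi.smul_apply, smul_eq_mul]
    rw [sum_add_distrib, ← mul_sum, ← mul_sum]
    have := mul_lt_mul_of_pos_left (hs.2 j) ha
    have := mul_le_mul_of_nonneg_left (ht1 j) hb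
    linarith

theorem convex_openSimplex : Convex ℝ (openSimplex S) := by
  intro s hs t ht a b ha hb hab
  rcases ha.eq_or_lt with h | h
  · have hb1 : b = 1 := by linarith
    simpa [← h, hb1] using ht
  · exact combo_mem_openSimplex S hs (fun i => (ht.1 i).le) (fun j => (ht.2 j).le) h hb hab

theorem openSimplex_nonempty : (fun _ => 1 / ((k : ℝ) + 1)) ∈ openSimplex S := by
  refine ⟨fun i => by positivity, fun j => ?_⟩
  rw [sum_const, nsmul_eq_mul, mul_one_div, div_lt_one (by positivity)]
  have : ((S j).card : ℝ) ≤ k := by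
    have := card_le_univ (S j)
    rw [Fintype.card_fin] at this
    exact_mod_cast this
  linarith

theorem mem_closure_openSimplex {t : Fin k → ℝ} (ht0 : ∀ i, 0 ≤ t i)
    (ht1 : ∀ j, ∑ i ∈ S j, t i ≤ 1) : t ∈ closure (openSimplex S) := by
  set s : Fin k → ℝ := fun _ => 1 / ((k : ℝ) + 1) with hs
  have hlim : Filter.Tendsto (fun a : ℝ => a • s + (1 - a) • t) (nhdsWithin 0 (Set.Ioi 0))
      (nhds t) := by
    have hc : Continuous fun a : ℝ => a • s + (1 - a) • t := by fun_prop
    have := (hc.tendsto 0).mono_left (nhdsWithin_le_nhds (s := Set.Ioi 0))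
    simpa using this
  refine mem_closure_of_tendsto hlim ?_
  filter_upwards [Ioo_mem_nhdsGT (zero_lt_one (α := ℝ))] with a ha
  exact combo_mem_openSimplex S (openSimplex_nonempty S) ht0 ht1 ha.1 (by linarith [ha.2]) (by ring)

/-- The difference lies in the frontier of a convex set, which is null. -/
theorem volume_diff_openSimplex [Finite κ] {T : Set (Fin k → ℝ)}
    (hT : ∀ t ∈ T, (∀ i, 0 ≤ t i) ∧ ∀ j, ∑ i ∈ S j, t i ≤ 1) :
    MeasureTheory.volume (T \ openSimplex S) = 0 := by
  refine MeasureTheory.measure_mono_null (fun t ht => ?_)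
    ((convex_openSimplex S).addHaar_frontier MeasureTheory.volume)
  rw [frontier, (isOpen_openSimplex S).interior_eq]
  exact ⟨mem_closure_openSimplex S (hT t ht.1).1 (hT t ht.1).2, ht.2⟩

end openSimplex

theorem carriedBy_region (hsupp : Function.support F ⊆ region k)
    (hd : DifferentiableOn ℝ F (interior (region k))) :
    CarriedBy F (openSimplex fun _ : Unit => (univ : Finset (Fin k))) := by
  set S := fun _ : Unit => (univ : Finset (Fin k)) with hS
  have hle : ∀ t ∈ openSimplex S, ∀ T : Finset (Fin k), ∑ i ∈ T, t i < 1 := fun t ht T =>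
    (sum_le_sum_of_subset_of_nonneg (subset_univ T) fun i _ _ => (ht.1 i).le).trans_lt (ht.2 ())
  have hle1 : ∀ t ∈ openSimplex S, ∀ i, t i ≤ 1 := fun t ht i => by
    simpa using (hle t ht {i}).le
  have hsub : openSimplex S ⊆ region k := fun t ht =>
    ⟨fun i => ⟨(ht.1 i).le, hle1 t ht i⟩, (ht.2 ()).le⟩
  exact
    { isOpen := isOpen_openSimplex S
      convex := convex_openSimplex S
      subset := fun t ht => ⟨fun i => (ht.1 i).le, hle1 t ht⟩
      differentiableOn := hd.mono (interior_maximal hsub (isOpen_openSimplex S))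
      sum_lt := fun t ht j => hle t ht _
      mem := fun t hne hpos _ hne1 => ⟨hpos, fun _ => lt_of_le_of_ne (hsupp hne).2 hne1⟩
      null := volume_diff_openSimplex S fun t ht =>
        ⟨fun i => ((hsupp ht).1 i).1, fun _ => (hsupp ht).2⟩ }

/-- The bound t_i ≤ 1 needs k ≥ 2: some j ≠ i exists, and t_i is one of the terms of the sum
omitting j. -/
theorem carriedBy_regionExt (hk : 2 ≤ k) (hsupp : Function.support F ⊆ regionExt k)
    (hd : DifferentiableOn ℝ F (interior (regionExt k))) :
    CarriedBy F (openSimplex fun j : Fin k => univ.erase j) := by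
  set S := fun j : Fin k => univ.erase j with hS
  have hle1 : ∀ t ∈ openSimplex S, ∀ i, t i ≤ 1 := fun t ht i => by
    have : Nontrivial (Fin k) := Fin.nontrivial_iff_two_le.mpr hk
    obtain ⟨j, hj⟩ := exists_ne i
    exact (single_le_sum (fun l _ => (ht.1 l).le) (mem_erase.mpr ⟨hj.symm, mem_univ i⟩)).trans
      (ht.2 j).le
  have hsub : openSimplex S ⊆ regionExt k := fun t ht =>
    ⟨fun i => ⟨(ht.1 i).le, hle1 t ht i⟩, fun j => (ht.2 j).le⟩
  exact
    { isOpen := isOpen_openSimplex S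
      convex := convex_openSimplex S
      subset := fun t ht => ⟨fun i => (ht.1 i).le, hle1 t ht⟩
      differentiableOn := hd.mono (interior_maximal hsub (isOpen_openSimplex S))
      sum_lt := fun t ht j => ht.2 j
      mem := fun t _ hpos hlt _ => ⟨hpos, hlt⟩
      null := volume_diff_openSimplex S fun t ht =>
        ⟨fun i => ((hsupp ht).1 i).1, (hsupp ht).2⟩ }

theorem prod_le_rpow_of_sum_pos_le {θ γ : ℝ} (hN : 1 < N) (hθ : 0 < θ) {r : Fin k → ℕ}
    (hr : ∀ i, 1 ≤ r i) (h : ∑ i, pos (N ^ θ) (r i) ≤ γ) :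
    ((∏ i, r i : ℕ) : ℝ) ≤ N ^ (θ * γ) := by
  have hN0 : 0 < N := by linarith
  have hr0 : ∀ i, (0 : ℝ) < r i := fun i => by exact_mod_cast hr i
  have hl : 0 < Real.log (N ^ θ) := Real.log_pos (Real.one_lt_rpow hN hθ)
  unfold pos at h
  rw [← sum_div, div_le_iff₀ hl, ← Real.log_prod fun i _ => (hr0 i).ne', Real.log_rpow hN0] at h
  rw [Nat.cast_prod, ← Real.log_le_log_iff (prod_pos fun i _ => hr0 i) (Real.rpow_pos_of_pos hN0 _),
    Real.log_rpow hN0]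
  linarith

theorem one_le_of_mem_suppY {R : ℝ} {W : ℕ} {r : Fin k → ℕ} (hr : r ∈ suppY F R W) (i : Fin k) :
    1 ≤ r i :=
  (mem_sfc.mp (Fintype.mem_piFinset.mp (suppY_subset hr) i)).1.1

theorem pos_mem_support {R : ℝ} {W : ℕ} {r : Fin k → ℕ} (hr : r ∈ suppY F R W) :
    (fun i => pos R (r i)) ∈ Function.support F := by
  have h := (mem_suppY.mp hr).2
  obtain ⟨-, -, -, e⟩ := weightY_ne_zero h
  rwa [e] at h

end

end MultSieve

theorem proposition1p13 (k : ℕ) (hk : 3 ≤ k) (A : Fin k → ℕ) (B : Fin k → ℤ)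
    (hAB : MultSieve.Admissible A B) (θ : ℝ) (hθ : 0 < θ) :
    ∃ C : ℝ, 0 < C ∧
      ∀ N : ℝ, 16 < N →
        (∀ i j, (((A i : ℤ) * B j - (A j : ℤ) * B i : ℤ) : ℝ) < MultSieve.D0 N) →
        (∀ i, (A i : ℝ) < MultSieve.D0 N) →
      ∀ ν₀ : ℤ, IsCoprime (MultSieve.formProd A B ν₀) (MultSieve.bigW N : ℤ) →
      ∀ F : (Fin k → ℝ) → ℝ, F ≠ 0 → (∀ t, 0 ≤ F t) →
        BddAbove (MultSieve.sizeAt F '' Set.Icc 0 1) →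
        (((∃ η : ℝ, 0 < η ∧ θ < 1 / 2 - η) ∧
            Function.support F ⊆ MultSieve.region k ∧
            DifferentiableOn ℝ F (interior (MultSieve.region k))) ∨
          ((∃ η : ℝ, 0 < η ∧ θ < ((k : ℝ) - 1) / (2 * (k : ℝ)) - η) ∧
            Function.support F ⊆ MultSieve.regionExt k ∧
            DifferentiableOn ℝ F (interior (MultSieve.regionExt k)))) →
        |MultSieve.selSum A B F θ N ν₀ -
            (Nat.totient (MultSieve.bigW N) : ℝ) ^ k * N * Real.log (N ^ θ) ^ k /
              (MultSieve.bigW N : ℝ) ^ (k + 1) *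
              ∫ t in Set.Icc (0 : Fin k → ℝ) 1, F t ^ 2| ≤
          C * (MultSieve.Fmax F ^ 2 * (Nat.totient (MultSieve.bigW N) : ℝ) ^ k * N *
            Real.log (N ^ θ) ^ k / ((MultSieve.bigW N : ℝ) ^ (k + 1) * MultSieve.D0 N)) := by
  open MultSieve in
  have hk2 : 2 ≤ k := by omega
  have hkR : (3 : ℝ) ≤ k := by exact_mod_cast hk
  have hk1 : (0 : ℝ) < (k : ℝ) - 1 := by linarith
  -- The constant must be chosen before F and the case are known. For β ≥ 1/2 the case cannot occur
  -- and any constant serves, so both constants exist and η never enters.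
  have hex : ∀ β : ℝ, 0 < β → ∃ C : ℝ, 0 < C ∧ (β < 1 / 2 → ∀ N : ℝ, 16 < N →
      (∀ i j, (((A i : ℤ) * B j - (A j : ℤ) * B i : ℤ) : ℝ) < D0 N) →
      (∀ i, (A i : ℝ) < D0 N) → ∀ (ν₀ : ℤ) (F : (Fin k → ℝ) → ℝ) (U : Set (Fin k → ℝ)),
      BddAbove (sizeAt F '' Set.Icc 0 1) → CarriedBy F U →
      (∀ r ∈ suppY F (N ^ θ) (bigW N), ((∏ i, r i : ℕ) : ℝ) ≤ N ^ β) →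
      |selSum A B F θ N ν₀ -
          (Nat.totient (bigW N) : ℝ) ^ k * N * Real.log (N ^ θ) ^ k / (bigW N : ℝ) ^ (k + 1) *
            ∫ t in Set.Icc (0 : Fin k → ℝ) 1, F t ^ 2| ≤
        C * (Fmax F ^ 2 * (Nat.totient (bigW N) : ℝ) ^ k * N *
          Real.log (N ^ θ) ^ k / ((bigW N : ℝ) ^ (k + 1) * D0 N))) := by
    intro β hβ0
    by_cases hβ : β < 1 / 2
    · obtain ⟨C, hC, h⟩ := exists_selSum_bound hk2 hAB hθ hβ0 hβ
      exact ⟨C, hC, fun _ => h⟩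
    · exact ⟨1, one_pos, fun h => absurd h hβ⟩
  obtain ⟨C₁, hC₁, h₁⟩ := hex (θ * 1) (by positivity)
  -- On the larger region ∑ t_i can reach k/(k-1), and ϑ < (k-1)/(2k) is exactly what keeps this
  -- exponent below 1/2.
  obtain ⟨C₂, hC₂, h₂⟩ := hex (θ * ((k : ℝ) / (k - 1))) (by positivity)
  refine ⟨C₁ + C₂, by positivity, fun N hN hres hA ν₀ _ F _ _ hb hcase => ?_⟩
  have hN1 : 1 < N := by linarith
  have hR : 1 < N ^ θ := Real.one_lt_rpow hN1 hθ
  have hD : 0 < D0 N := lt_of_le_of_lt (Nat.cast_nonneg _) (hA ⟨0, by omega⟩)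
  have hnn : 0 ≤ Fmax F ^ 2 * (Nat.totient (bigW N) : ℝ) ^ k * N *
      Real.log (N ^ θ) ^ k / ((bigW N : ℝ) ^ (k + 1) * D0 N) := by
    have := (Real.log_pos hR).le
    have : 0 ≤ N := by linarith
    positivity
  rcases hcase with ⟨⟨η, hη, hθη⟩, hsupp, hd⟩ | ⟨⟨η, hη, hθη⟩, hsupp, hd⟩
  · refine (h₁ (by linarith) N hN hres hA ν₀ F _ hb (carriedBy_region hsupp hd)
      fun r hr => ?_).trans ?_
    · exact prod_le_rpow_of_sum_pos_le hN1 hθ (one_le_of_mem_suppY hr)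
        (hsupp (pos_mem_support hr)).2
    · exact mul_le_mul_of_nonneg_right (by linarith) hnn
  · have hβ : θ * ((k : ℝ) / (k - 1)) < 1 / 2 := by
      have h1 : θ < ((k : ℝ) - 1) / (2 * k) := by linarith
      rw [lt_div_iff₀ (by linarith)] at h1
      rw [mul_div_assoc', div_lt_div_iff₀ hk1 (by norm_num)]
      linarith
    refine (h₂ hβ N hN hres hA ν₀ F _ hb (carriedBy_regionExt hk2 hsupp hd)
      fun r hr => ?_).trans ?_
    · refine prod_le_rpow_of_sum_pos_le hN1 hθ (one_le_of_mem_suppY hr) ?_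
      have hmem := (hsupp (pos_mem_support hr)).2
      -- Adding the k constraints counts each coordinate k - 1 times, so (k - 1) ∑ t_i ≤ k.
      have hsum : ∑ j, ∑ i ∈ Finset.univ.erase j, pos (N ^ θ) (r i) ≤ ∑ j : Fin k, (1 : ℝ) :=
        Finset.sum_le_sum fun j _ => hmem j
      have he : ∀ j, ∑ i ∈ Finset.univ.erase j, pos (N ^ θ) (r i) =
          ∑ i, pos (N ^ θ) (r i) - pos (N ^ θ) (r j) := fun j => by
        rw [← Finset.add_sum_erase Finset.univ _ (Finset.mem_univ j)]; ring
      simp only [he, Finset.sum_sub_distrib, Finset.sum_const, Finset.card_univ, Fintype.card_fin,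
        nsmul_eq_mul, mul_one] at hsum
      rw [le_div_iff₀ hk1]
      linarith
    · exact mul_le_mul_of_nonneg_right (by linarith) hnn
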